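/- **Setting.** Let $k$ be a field and let $Q$ be a quiver that is locally finite (every vertex is the source of only finitely many arrows and the target of only finitely many arrows) and gradable: its vertex set is a disjoint union $Q_0=\bigsqcup_{n\in\mathbb Z}Q^n$ such that every arrow goes from some $Q^n$ to $Q^{n+1}$. Fix such a grading. Paths are composed from right to left. Write $kQ(x,y)$ for the vector space with basis the paths from $x$ to $y$, $kQ_n(x,y)$ for the span of those of length $n$, $Q_1(x,y)$ for the set of arrows $x\to y$, $Q^{\rm o}$ for the opposite quiver with the grading $(Q^{\rm o})^n=Q^{-n}$, and $\gamma\mapsto\gamma^{\rm o}$ for the linear maps $kQ(x,y)\to kQ^{\rm o}(y,x)$ that reverse paths. Let $R$ be a homogeneous ideal of $kQ$, that is, an ideal generated by elements each of which lies in some $kQ_n(x,y)$ with $n\ge 2$. Put $R_n(x,y)=R\cap kQ_n(x,y)$ and $\Lambda=kQ/R$; write $\bar\gamma$ for the class of $\gamma$ and $e_x$ for the class of the trivial path at $x$. $\mathrm{Mod}\,\Lambda$ is the category of all unitary left $\Lambda$-modules, identified with the category of all representations $M=(M(x),M(\alpha))$ over $k$, of arbitrary dimension, of the bound quiver $(Q,R)$,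 where $M(x)=e_xM$. Let $J$ be the ideal of $\Lambda$ generated by the classes of the arrows, $P_a=\Lambda e_a$, and $S_a=P_a/JP_a$. The module $P_a$ is graded by path length: the part of degree $n$ of $e_yP_a=e_y\Lambda e_a$ is the image of $kQ_n(a,y)$. **Koszul algebras.** Suppose that $\Lambda$ is Koszul, that is, every simple module $S_a$, $a\in Q_0$, has a linear projective resolution: an exact sequence $$\cdots\to P^{-2}\xrightarrow{d^{-2}}P^{-1}\xrightarrow{d^{-1}}P^0\xrightarrow{d^0}S_a\to 0$$ in which every $P^{-n}$ is a finite direct sum of modules of the form $P_x$, $\mathrm{Ker}(d^{-n})\subseteq JP^{-n}$ for all $n\ge0$, and $d^{-n}$ is homogeneous of degree one for all $n>0$. **Quadratic dual.** For $\rho=\sum_p\lambda_p\,p\in kQ_2(x,y)$ let $\rho^*$ be the linear form on $kQ_2(x,y)$ with $\rho^*(p)=\lambda_p$ for every path $p$ of length two. Let $R^!$ be the ideal of $kQ^{\rm o}$ generated by all $\rho^{\rm o}$ such that $\rho\in kQ_2(x,y)$, for some $x,y\in Q_0$, and $\rho^*$ vanishes on $R_2(x,y)$, and put $\Lambda^!=kQ^{\rm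 o}/R^!$. **Koszul functors.** Let $I^!_a\in\mathrm{Mod}\,\Lambda^!$ be the module with $I^!_a(x)=\mathrm{Hom}_k(e_a\Lambda^!e_x,k)$, on which $u\in e_y\Lambda^!e_x$ acts by $(uf)(v)=f(vu)$. For a $\Lambda$-module (or $\Lambda^!$-module) $L$ and a vector space $W$, $L\otimes W$ is the module with $(L\otimes W)(x)=L(x)\otimes_kW$. * $F:\mathrm{Mod}\,\Lambda^!\to C(\mathrm{Mod}\,\Lambda)$ sends $M$ to the complex with $F(M)^n=\bigoplus_{x\in (Q^{\rm o})^n}P_x\otimes M(x)$, whose differential has the components $\sum_{\alpha\in Q_1(y,x)}P[\bar\alpha]\otimes M(\alpha^{\rm o}):P_x\otimes M(x)\to P_y\otimes M(y)$, where $P[\bar\alpha]:P_x\to P_y$ is the right multiplication by $\bar\alpha$. * $G:\mathrm{Mod}\,\Lambda\to C(\mathrm{Mod}\,\Lambda^!)$ sends $N$ to the complex with $G(N)^n=\bigoplus_{x\in Q^n}I^!_x\otimes N(x)$, whose differential has the components $\sum_{\alpha\in Q_1(x,y)}I[\alpha^!]\otimes N(\alpha):I^!_x\otimes N(x)\to I^!_y\otimes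 N(y)$, where $\alpha^!$ is the class of $\alpha^{\rm o}$ in $\Lambda^!$ and $I[\alpha^!]:I^!_x\to I^!_y$ is the transpose of the left multiplication by $\alpha^!$. * $F^C:C(\mathrm{Mod}\,\Lambda^!)\to C(\mathrm{Mod}\,\Lambda)$ sends a complex $M^\bullet$ to the total complex of the double complex $F(M^i)^j$: its term of degree $n$ is $\bigoplus_{i+j=n}F(M^i)^j$, and its differential restricts on $F(M^i)^j$ to $F(d_M^i)^j+(-1)^i\,d^{\,j}_{F(M^i)}$. All functors are defined on morphisms in the evident way. **Proposition.** There is a natural transformation $\eta$ from $F^C\circ G$ to the functor that sends a module $M\in\mathrm{Mod}\,\Lambda$ to the complex with $M$ in degree $0$ and zero elsewhere, such that $\eta_M:(F^C\circ G)(M)\to M$ is a quasi-isomorphism for every $M\in\mathrm{Mod}\,\Lambda$. Moreover, for every $M\in\mathrm{Mod}\,\Lambda$, all terms of $(F^C\circ G)(M)$ are projective and its terms of positive degree are zero, so that $\eta_M$ is a projective resolution of $M$. -/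

import Mathlib

open CategoryTheory CategoryTheory.Limits Opposite

universe u

noncomputable section

namespace BoundQuiver

/-! ### Quivers -/

/-- A quiver is locally finite if every vertex is the source of only finitely many arrows and the
target of only finitely many arrows. -/
class LocallyFinite (V : Type u) [Quiver.{u} V] : Prop where
  finite_out : ∀ x : V, Finite (Σ y : V, x ⟶ y)
  finite_in : ∀ x : V, Finite (Σ y : V, y ⟶ x)

/-- A grading `Q₀ = ⊔ Qⁿ` of a quiver, encoded by the function `deg` with `x ∈ Q^(deg x)`; every
arrow goes from some `Qⁿ` to `Qⁿ⁺¹`. A quiver is gradable if it has a grading. -/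
structure Grading (V : Type u) [Quiver.{u} V] where
  deg : V → ℤ
  deg_arrow : ∀ {x y : V}, (x ⟶ y) → deg y = deg x + 1

/-- The path `ρᵒ` of the opposite quiver obtained by reversing `ρ`. -/
def opPath {V : Type u} [Quiver.{u} V] : ∀ {x y : V}, Quiver.Path x y → Quiver.Path (op y) (op x)
  | _, _, .nil => .nil
  | _, _, .cons p a => a.op.toPath.comp (opPath p)

section Quiver

variable {V : Type u} [Quiver.{u} V]

instance finite_out [LocallyFinite V] (x : V) : Finite (Σ y : V, x ⟶ y) :=
  LocallyFinite.finite_out x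

instance finite_in [LocallyFinite V] (x : V) : Finite (Σ y : V, y ⟶ x) :=
  LocallyFinite.finite_in x

instance fintype_out [LocallyFinite V] (x : V) : Fintype (Σ y : V, x ⟶ y) :=
  Fintype.ofFinite _

instance [LocallyFinite V] : LocallyFinite Vᵒᵖ where
  finite_out x := Finite.of_surjective
    (fun p : (Σ y : V, y ⟶ x.unop) => (⟨op p.1, p.2.op⟩ : Σ y : Vᵒᵖ, x ⟶ y))
    fun p => ⟨⟨p.1.unop, p.2.unop⟩, rfl⟩
  finite_in x := Finite.of_surjective
    (fun p : (Σ y : V, x.unop ⟶ y) => (⟨op p.1, p.2.op⟩ : Σ y : Vᵒᵖ, y ⟶ x))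
    fun p => ⟨⟨p.1.unop, p.2.unop⟩, rfl⟩

/-- The induced grading of the opposite quiver: `(Qᵒ)ⁿ = Q⁻ⁿ`. -/
def Grading.op (g : Grading V) : Grading Vᵒᵖ where
  deg x := -g.deg x.unop
  deg_arrow a := by have := g.deg_arrow a.unop; omega

/-- Pairs of composable arrows from `x` to `z`, i.e. paths of length two. -/
abbrev Arrow₂ (x z : V) : Type u := Σ y : V, (x ⟶ y) × (y ⟶ z)

/-- The path `x ⟶ y ⟶ z` attached to a pair of composable arrows. -/
def Arrow₂.path {x z : V} (t : Arrow₂ x z) : Quiver.Path x z := (t.2.1.toPath).cons t.2.2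

instance [LocallyFinite V] (x z : V) : Finite (Arrow₂ x z) :=
  Finite.of_injective
    (fun t => ((⟨t.1, t.2.1⟩, ⟨t.1, t.2.2⟩) : (Σ y : V, x ⟶ y) × (Σ y : V, y ⟶ z)))
    (by rintro ⟨y, a, b⟩ ⟨y', a', b'⟩ h; simp only [Prod.mk.injEq] at h
        obtain ⟨h1, h2⟩ := h; cases h1; cases h2; rfl)

instance [LocallyFinite V] (x z : V) : Fintype (Arrow₂ x z) := Fintype.ofFinite _

lemma Arrow₂.path_injective {x z : V} :
    Function.Injective (Arrow₂.path : Arrow₂ x z → Quiver.Path x z) := by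
  rintro ⟨y, a, b⟩ ⟨y', a', b'⟩ h
  simp only [Arrow₂.path, Quiver.Hom.toPath] at h
  cases h; rfl

lemma Arrow₂.length_path {x z : V} (t : Arrow₂ x z) : t.path.length = 2 := rfl

lemma Arrow₂.opPath_path {x z : V} (t : Arrow₂ x z) :
    opPath t.path = t.2.2.op.toPath.comp t.2.1.op.toPath := by
  simp only [Arrow₂.path, Quiver.Hom.toPath, opPath]
  rfl

lemma Arrow₂.exists_path_eq {x z : V} (p : Quiver.Path x z) (hp : p.length = 2) :
    ∃ t : Arrow₂ x z, t.path = p := by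
  match p, hp with
  | .cons (.cons .nil a) b, _ => exact ⟨⟨_, a, b⟩, rfl⟩
  | .cons (.cons (.cons _ _) _) _, h => simp at h

end Quiver

/-! ### Path algebras, ideals and bound quivers -/

/-- `kQ(x, y)`, the vector space with basis the set of paths from `x` to `y`. -/
abbrev PathSpace (k : Type u) [Field k] {V : Type u} [Quiver.{u} V] (x y : V) : Type u :=
  Quiver.Path x y →₀ k

section PathAlgebra

variable {k : Type u} [Field k] {V : Type u} [Quiver.{u} V]

variable (k) in
/-- `kQₙ(x, y)`, the subspace of `kQ(x, y)` spanned by the paths of length `n`. -/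
def homogeneous (n : ℕ) (x y : V) : Submodule k (PathSpace k x y) :=
  Finsupp.supported k k {p | p.length = n}

/-- Composition with a path `q : y → z`, that is, left multiplication `γ ↦ qγ`. -/
def postcomp {x y z : V} (q : Quiver.Path y z) : PathSpace k x y →ₗ[k] PathSpace k x z :=
  Finsupp.lmapDomain k k fun p => p.comp q

/-- Composition with a path `p : x → y`, that is, right multiplication `γ ↦ γp`. -/
def precomp {x y z : V} (p : Quiver.Path x y) : PathSpace k y z →ₗ[k] PathSpace k x z :=
  Finsupp.lmapDomain k k fun q => p.comp q

@[simp] lemma postcomp_single {x y z : V} (q : Quiver.Path y z) (p : Quiver.Path x y) (c : k) :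
    postcomp q (Finsupp.single p c) = Finsupp.single (p.comp q) c := by
  simp [postcomp]

@[simp] lemma precomp_single {x y z : V} (p : Quiver.Path x y) (q : Quiver.Path y z) (c : k) :
    precomp p (Finsupp.single q c) = Finsupp.single (p.comp q) c := by
  simp [precomp]

lemma postcomp_postcomp {x y z w : V} (q : Quiver.Path y z) (r : Quiver.Path z w)
    (γ : PathSpace k x y) : postcomp r (postcomp q γ) = postcomp (q.comp r) γ := by
  induction γ using Finsupp.induction_linear with
  | zero => simp
  | add f g hf hg => simp only [map_add, hf, hg]
  | single p c => simp

lemma precomp_precomp {x y z w : V} (p : Quiver.Path x y) (q : Quiver.Path y z)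
    (γ : PathSpace k z w) : precomp p (precomp q γ) = precomp (p.comp q) γ := by
  induction γ using Finsupp.induction_linear with
  | zero => simp
  | add f g hf hg => simp only [map_add, hf, hg]
  | single p c => simp

lemma precomp_postcomp {x y z w : V} (p : Quiver.Path x y) (q : Quiver.Path z w)
    (γ : PathSpace k y z) : precomp p (postcomp q γ) = postcomp q (precomp p γ) := by
  induction γ using Finsupp.induction_linear with
  | zero => simp
  | add f g hf hg => simp only [map_add, hf, hg]
  | single p c => simp

@[simp] lemma postcomp_nil {x y : V} (γ : PathSpace k x y) : postcomp .nil γ = γ := by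
  induction γ using Finsupp.induction_linear with
  | zero => simp
  | add f g hf hg => simp only [map_add, hf, hg]
  | single p c => simp

@[simp] lemma precomp_nil {x y : V} (γ : PathSpace k x y) : precomp .nil γ = γ := by
  induction γ using Finsupp.induction_linear with
  | zero => simp
  | add f g hf hg => simp only [map_add, hf, hg]
  | single p c => simp

variable (k V) in
/-- A two-sided ideal `R` of the path algebra `kQ`. Because `kQ` is spanned by the orthogonal
idempotents `ε_x` as a bimodule, `R` is the direct sum of its components
`R(x, y) = R ∩ kQ(x, y)`, and it is recorded through these components. -/
@[ext] structure PathIdeal where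
  carrier : ∀ x y : V, Submodule k (PathSpace k x y)
  postcomp_mem : ∀ {x y z : V} (q : Quiver.Path y z) {γ : PathSpace k x y},
    γ ∈ carrier x y → postcomp q γ ∈ carrier x z
  precomp_mem : ∀ {x y z : V} (p : Quiver.Path x y) {γ : PathSpace k y z},
    γ ∈ carrier y z → precomp p γ ∈ carrier x z

/-- The ideal of `kQ` generated by a set `S` of relations: its component at `(x, y)` is spanned by
the products `q ρ p` with `ρ ∈ S`, and `p`, `q` paths. -/
def PathIdeal.span (S : ∀ x y : V, Set (PathSpace k x y)) : PathIdeal k V where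
  carrier x y := Submodule.span k
    {γ | ∃ (a b : V) (p : Quiver.Path x a) (q : Quiver.Path b y), ∃ ρ ∈ S a b,
      γ = postcomp q (precomp p ρ)}
  postcomp_mem {x y z} q γ hγ := by
    refine (Submodule.span_le (p := (Submodule.span k _).comap (postcomp q))).2 ?_ hγ
    rintro _ ⟨a, b, p, q', ρ, hρ, rfl⟩
    exact Submodule.subset_span ⟨a, b, p, q'.comp q, ρ, hρ, postcomp_postcomp _ _ _⟩
  precomp_mem {x y z} p γ hγ := by
    refine (Submodule.span_le (p := (Submodule.span k _).comap (precomp p))).2 ?_ hγ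
    rintro _ ⟨a, b, p', q, ρ, hρ, rfl⟩
    refine Submodule.subset_span ⟨a, b, p.comp p', q, ρ, hρ, ?_⟩
    rw [precomp_postcomp, precomp_precomp]

lemma PathIdeal.subset_span (S : ∀ x y : V, Set (PathSpace k x y)) {x y : V} {ρ : PathSpace k x y}
    (hρ : ρ ∈ S x y) : ρ ∈ (PathIdeal.span S).carrier x y :=
  Submodule.subset_span ⟨x, y, .nil, .nil, ρ, hρ, by simp⟩

/-- An ideal is homogeneous if it is generated by relations each of which lies in some
`kQₙ(x, y)` with `n ≥ 2`. -/
def PathIdeal.IsHomogeneous (R : PathIdeal k V) : Prop :=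
  ∃ S : ∀ x y : V, Set (PathSpace k x y),
    (∀ x y, ∀ ρ ∈ S x y, ∃ n, 2 ≤ n ∧ ρ ∈ homogeneous k n x y) ∧ R = PathIdeal.span S

/-- The component `e_y Λ e_x = kQ(x, y) / R(x, y)` of the algebra `Λ = kQ / R`. -/
abbrev PathIdeal.Alg (R : PathIdeal k V) (x y : V) : Type u := PathSpace k x y ⧸ R.carrier x y

/-- The degree `n` part `e_y Λₙ e_x` of `e_y Λ e_x`, spanned by the classes of the paths of
length `n`. -/
def PathIdeal.algDegree (R : PathIdeal k V) (n : ℕ) (x y : V) : Submodule k (R.Alg x y) :=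
  (homogeneous k n x y).map (R.carrier x y).mkQ

/-- Left multiplication `e_y Λ e_x → e_z Λ e_x` by the class of a path `q : y → z`. -/
def PathIdeal.lmul (R : PathIdeal k V) {x y z : V} (q : Quiver.Path y z) :
    R.Alg x y →ₗ[k] R.Alg x z :=
  Submodule.mapQ _ _ (postcomp q) fun _ h => R.postcomp_mem q h

/-- Right multiplication `e_z Λ e_y → e_z Λ e_x` by the class of a path `p : x → y`. -/
def PathIdeal.rmul (R : PathIdeal k V) {x y z : V} (p : Quiver.Path x y) :
    R.Alg y z →ₗ[k] R.Alg x z :=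
  Submodule.mapQ _ _ (precomp p) fun _ h => R.precomp_mem p h

@[simp] lemma PathIdeal.lmul_mk (R : PathIdeal k V) {x y z : V} (q : Quiver.Path y z)
    (γ : PathSpace k x y) :
    R.lmul q (Submodule.Quotient.mk γ) = Submodule.Quotient.mk (postcomp q γ) := rfl

@[simp] lemma PathIdeal.rmul_mk (R : PathIdeal k V) {x y z : V} (p : Quiver.Path x y)
    (γ : PathSpace k y z) :
    R.rmul p (Submodule.Quotient.mk γ) = Submodule.Quotient.mk (precomp p γ) := rfl

lemma PathIdeal.lmul_rmul (R : PathIdeal k V) {x y z w : V} (p : Quiver.Path x y)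
    (q : Quiver.Path z w) (u : R.Alg y z) : R.lmul q (R.rmul p u) = R.rmul p (R.lmul q u) := by
  obtain ⟨γ, rfl⟩ := Submodule.Quotient.mk_surjective _ u
  simp [precomp_postcomp]

lemma PathIdeal.lmul_lmul (R : PathIdeal k V) {x y z w : V} (q : Quiver.Path y z)
    (r : Quiver.Path z w) (u : R.Alg x y) : R.lmul r (R.lmul q u) = R.lmul (q.comp r) u := by
  obtain ⟨γ, rfl⟩ := Submodule.Quotient.mk_surjective _ u
  simp [postcomp_postcomp]

lemma PathIdeal.rmul_rmul (R : PathIdeal k V) {x y z w : V} (p : Quiver.Path x y)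
    (q : Quiver.Path y z) (u : R.Alg z w) : R.rmul p (R.rmul q u) = R.rmul (p.comp q) u := by
  obtain ⟨γ, rfl⟩ := Submodule.Quotient.mk_surjective _ u
  simp [precomp_precomp]

@[simp] lemma PathIdeal.lmul_nil (R : PathIdeal k V) {x y : V} (u : R.Alg x y) :
    R.lmul .nil u = u := by
  obtain ⟨γ, rfl⟩ := Submodule.Quotient.mk_surjective _ u
  simp

@[simp] lemma PathIdeal.rmul_nil (R : PathIdeal k V) {x y : V} (u : R.Alg x y) :
    R.rmul .nil u = u := by
  obtain ⟨γ, rfl⟩ := Submodule.Quotient.mk_surjective _ u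
  simp

/-- Left multiplication by an element of `kQ(y, z)`. -/
def PathIdeal.lmulLin (R : PathIdeal k V) (x y z : V) :
    PathSpace k y z →ₗ[k] R.Alg x y →ₗ[k] R.Alg x z :=
  Finsupp.linearCombination k fun q => R.lmul q

/-- Right multiplication by an element of `kQ(x, y)`. -/
def PathIdeal.rmulLin (R : PathIdeal k V) (x y z : V) :
    PathSpace k x y →ₗ[k] R.Alg y z →ₗ[k] R.Alg x z :=
  Finsupp.linearCombination k fun p => R.rmul p

lemma PathIdeal.lmulLin_single (R : PathIdeal k V) {x y z : V} (q : Quiver.Path y z) :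
    R.lmulLin x y z (Finsupp.single q 1) = R.lmul q := by
  simp [PathIdeal.lmulLin]

lemma PathIdeal.rmulLin_single (R : PathIdeal k V) {x y z : V} (p : Quiver.Path x y) :
    R.rmulLin x y z (Finsupp.single p 1) = R.rmul p := by
  simp [PathIdeal.rmulLin]

lemma PathIdeal.lmulLin_mk_single (R : PathIdeal k V) {x y z : V} (p : Quiver.Path x y)
    (σ : PathSpace k y z) :
    R.lmulLin x y z σ (Submodule.Quotient.mk (Finsupp.single p 1)) =
      Submodule.Quotient.mk (precomp p σ) := by
  induction σ using Finsupp.induction_linear with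
  | zero => simp
  | add f g hf hg => simp only [map_add, LinearMap.add_apply, hf, hg, Submodule.Quotient.mk_add]
  | single q c =>
    simp only [PathIdeal.lmulLin, Finsupp.linearCombination_single, LinearMap.smul_apply,
      PathIdeal.lmul_mk, postcomp_single, precomp_single, ← Submodule.Quotient.mk_smul,
      Finsupp.smul_single, smul_eq_mul, mul_one]

lemma PathIdeal.rmulLin_mk_single (R : PathIdeal k V) {x y z : V} (q : Quiver.Path y z)
    (ρ : PathSpace k x y) :
    R.rmulLin x y z ρ (Submodule.Quotient.mk (Finsupp.single q 1)) =
      Submodule.Quotient.mk (postcomp q ρ) := by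
  induction ρ using Finsupp.induction_linear with
  | zero => simp
  | add f g hf hg => simp only [map_add, LinearMap.add_apply, hf, hg, Submodule.Quotient.mk_add]
  | single p c =>
    simp only [PathIdeal.rmulLin, Finsupp.linearCombination_single, LinearMap.smul_apply,
      PathIdeal.rmul_mk, postcomp_single, precomp_single, ← Submodule.Quotient.mk_smul,
      Finsupp.smul_single, smul_eq_mul, mul_one]

lemma PathIdeal.Alg.hom_ext (R : PathIdeal k V) {x y : V} {M : Type*} [AddCommGroup M] [Module k M]
    {f f' : R.Alg x y →ₗ[k] M}
    (h : ∀ p : Quiver.Path x y, f (Submodule.Quotient.mk (Finsupp.single p 1)) =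
      f' (Submodule.Quotient.mk (Finsupp.single p 1))) : f = f' := by
  refine Submodule.linearMap_qext _ (Finsupp.lhom_ext' fun p => LinearMap.ext_ring ?_)
  exact h p

lemma PathIdeal.lmulLin_eq_zero (R : PathIdeal k V) {x y z : V} {σ : PathSpace k y z}
    (h : σ ∈ R.carrier y z) : R.lmulLin x y z σ = 0 :=
  PathIdeal.Alg.hom_ext R fun p => by
    rw [R.lmulLin_mk_single, LinearMap.zero_apply, Submodule.Quotient.mk_eq_zero]
    exact R.precomp_mem p h

lemma PathIdeal.rmulLin_eq_zero (R : PathIdeal k V) {x y z : V} {ρ : PathSpace k x y}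
    (h : ρ ∈ R.carrier x y) : R.rmulLin x y z ρ = 0 :=
  PathIdeal.Alg.hom_ext R fun q => by
    rw [R.rmulLin_mk_single, LinearMap.zero_apply, Submodule.Quotient.mk_eq_zero]
    exact R.postcomp_mem q h

/-! ### The quadratic dual -/

/-- The bilinear form on `kQ(x, y)` for which the paths form an orthonormal basis. It is
`(γ, δ) ↦ γ^*(δ)`, where `γ^*` is the linear form attached to `γ` by the dual basis of the basis of
paths. -/
def pathPairing {x y : V} (γ δ : PathSpace k x y) : k := γ.sum fun p c => c * δ p

/-- The ideal `R^!` of `kQᵒ` generated by all `ρᵒ` with `ρ ∈ kQ₂(x, y)` such that `ρ^*` vanishes on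
`R₂(x, y) = R(x, y) ∩ kQ₂(x, y)`. The quadratic dual of `Λ = kQ / R` is `Λ^! = kQᵒ / R^!`. -/
def PathIdeal.dual (R : PathIdeal k V) : PathIdeal k Vᵒᵖ :=
  PathIdeal.span fun y x =>
    {σ | ∃ ρ ∈ homogeneous k 2 x.unop y.unop,
      (∀ δ ∈ R.carrier x.unop y.unop ⊓ homogeneous k 2 x.unop y.unop, pathPairing ρ δ = 0) ∧
      σ = Finsupp.mapDomain opPath ρ}

/-- The canonical element `∑ p ⊗ pᵒ`, summed over the paths `p` of length two from `x` to `z`, dies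
in every quotient in which `R₂` and `R^!₂` die. -/
lemma PathIdeal.sum_arrow₂_eq_zero [LocallyFinite V] (R : PathIdeal k V) {x z : V}
    {C : Type u} [AddCommGroup C] [Module k C]
    (B : PathSpace k x z →ₗ[k] PathSpace k (op z) (op x) →ₗ[k] C)
    (h₁ : ∀ ρ ∈ R.carrier x z, B ρ = 0)
    (h₂ : ∀ σ ∈ R.dual.carrier (op z) (op x), ∀ ρ, B ρ σ = 0) :
    ∑ t : Arrow₂ x z, B (Finsupp.single t.path 1) (Finsupp.single (opPath t.path) 1) = 0 := by
  classical
  let P : (Arrow₂ x z → k) →ₗ[k] PathSpace k x z :=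
    Fintype.linearCombination k fun t => Finsupp.single t.path 1
  have hP : ∀ c t, P c t.path = c t := by
    intro c t
    simp only [P, Fintype.linearCombination_apply, Finsupp.finsetSum_apply, Finsupp.smul_apply,
      Finsupp.single_apply, Arrow₂.path_injective.eq_iff]
    simp
  have hPe : ∀ t, P (Pi.single t 1) = Finsupp.single t.path 1 := by
    intro t; simp [P]
  have hPmem : ∀ c, P c ∈ homogeneous k 2 x z := by
    intro c
    simp only [P, Fintype.linearCombination_apply]
    refine Submodule.sum_mem _ fun t _ => Submodule.smul_mem _ _ ?_
    exact Finsupp.single_mem_supported k 1 (Arrow₂.length_path t)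
  let S : Submodule k (Arrow₂ x z → k) := (R.carrier x z).comap P
  obtain ⟨g, hg⟩ := LinearMap.exists_leftInverse_of_injective S.subtype (by simp)
  have hg' : ∀ s : S, g s = s := fun s => by simpa using LinearMap.congr_fun hg s
  let π : (Arrow₂ x z → k) →ₗ[k] (Arrow₂ x z → k) := LinearMap.id - S.subtype ∘ₗ g
  have hπS : ∀ c ∈ S, π c = 0 := by
    intro c hc
    have := hg' ⟨c, hc⟩
    simp [π, this]
  have hBπ : ∀ c σ, B (P c) σ = B (P (π c)) σ := by
    intro c σ
    have h : B (P (g c : Arrow₂ x z → k)) = 0 := h₁ _ (g c).2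
    simp [π, h]
  have hexp : ∀ c : Arrow₂ x z → k, ∀ σ, B (P c) σ = ∑ s, c s • B (Finsupp.single s.path 1) σ := by
    intro c σ
    simp only [P, Fintype.linearCombination_apply, map_sum, map_smul, LinearMap.sum_apply,
      LinearMap.smul_apply]
  calc ∑ t : Arrow₂ x z, B (Finsupp.single t.path 1) (Finsupp.single (opPath t.path) 1)
      = ∑ t : Arrow₂ x z, ∑ s, π (Pi.single t 1) s •
          B (Finsupp.single s.path 1) (Finsupp.single (opPath t.path) 1) := by
        refine Finset.sum_congr rfl fun t _ => ?_
        rw [← hPe, hBπ, hexp]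
    _ = ∑ s : Arrow₂ x z, B (Finsupp.single s.path 1)
          (Finsupp.mapDomain opPath (P fun t => π (Pi.single t 1) s)) := by
        rw [Finset.sum_comm]
        refine Finset.sum_congr rfl fun s _ => ?_
        simp only [P, Fintype.linearCombination_apply, Finsupp.mapDomain_finsetSum, map_sum,
          Finsupp.mapDomain_smul, Finsupp.mapDomain_single, map_smul]
    _ = 0 := by
        refine Finset.sum_eq_zero fun s _ => h₂ _ (PathIdeal.subset_span _ ⟨_, hPmem _, ?_, rfl⟩) _
        rintro δ ⟨hδR, hδ⟩
        let c : Arrow₂ x z → k := fun t => δ t.path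
        have hδc : P c = δ := by
          ext p
          by_cases hp : p.length = 2
          · obtain ⟨t, rfl⟩ := Arrow₂.exists_path_eq p hp
            exact hP c t
          · have h1 : ∀ γ ∈ homogeneous k 2 x z, γ p = 0 := fun γ hγ => by
              by_contra hne
              exact hp (hγ (Finsupp.mem_support_iff.2 hne))
            rw [h1 _ (hPmem c), h1 _ hδ]
        have hc : c ∈ S := by
          refine Submodule.mem_comap.2 ?_
          rw [hδc]; exact hδR
        have hsum : ∑ t, π (Pi.single t 1) s * c t = 0 := by
          have : π c s = 0 := by rw [hπS c hc]; rfl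
          rw [← this]
          conv_rhs => rw [← Finset.univ_sum_single c]
          simp only [map_sum, Finset.sum_apply]
          refine Finset.sum_congr rfl fun t _ => ?_
          have : (Pi.single t (c t) : Arrow₂ x z → k) = c t • Pi.single t 1 := by
            rw [← Pi.single_smul]; simp
          rw [this, map_smul, Pi.smul_apply, smul_eq_mul, mul_comm]
        rw [← hsum]
        change (P _).sum _ = _
        simp only [P, Fintype.linearCombination_apply]
        rw [← Finsupp.sum_finsetSum_index (by simp) (by intros; ring)]
        refine Finset.sum_congr rfl fun t _ => ?_
        simp [c]

/-! ### Modules as representations -/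

/-- A vertex of the quiver, regarded as an object of its category of paths. -/
def vtx (x : V) : Paths V := x

/-- A path of the quiver, regarded as a morphism of its category of paths. -/
def pathHom {x y : V} (p : Quiver.Path x y) : vtx x ⟶ vtx y := p

lemma pathHom_nil (x : V) : pathHom (.nil : Quiver.Path x x) = 𝟙 (vtx x) := rfl

lemma pathHom_comp {x y z : V} (p : Quiver.Path x y) (q : Quiver.Path y z) :
    pathHom (p.comp q) = pathHom p ≫ pathHom q := rfl

/-- The value `M(γ) : M(x) → M(y)` of a representation `M` of the quiver at `γ ∈ kQ(x, y)`, that is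
`∑ λᵢ M(pᵢ)` for `γ = ∑ λᵢ pᵢ`. A representation of a quiver (without relations) is the same thing
as a functor on its category of paths. -/
def evalPath (M : Paths V ⥤ ModuleCat.{u} k) (x y : V) :
    PathSpace k x y →ₗ[k] (M.obj (vtx x) →ₗ[k] M.obj (vtx y)) :=
  Finsupp.linearCombination k fun p : Quiver.Path x y => (M.map (pathHom p)).hom

/-- `M` is a representation of the bound quiver `(Q, R)`: `M(ρ) = 0` for all `ρ ∈ R(x, y)`. -/
def PathIdeal.IsRep (R : PathIdeal k V) : ObjectProperty (Paths V ⥤ ModuleCat.{u} k) :=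
  fun M => ∀ x y : V, ∀ ρ ∈ R.carrier x y, evalPath M x y ρ = 0

/-- The category `Mod Λ = Rep(Q, R)` of (unitary left) modules over `Λ = kQ / R`, regarded as the
representations of the bound quiver `(Q, R)`. -/
abbrev PathIdeal.Mod (R : PathIdeal k V) : Type (u + 1) := R.IsRep.FullSubcategory

lemma evalPath_single (M : Paths V ⥤ ModuleCat.{u} k) {x y : V} (p : Quiver.Path x y) (c : k) :
    evalPath M x y (Finsupp.single p c) = c • (M.map (pathHom p)).hom := by
  simp [evalPath]

lemma evalPath_naturality {M N : Paths V ⥤ ModuleCat.{u} k} (f : M ⟶ N) {x y : V}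
    (ρ : PathSpace k x y) :
    (f.app (vtx y)).hom ∘ₗ evalPath M x y ρ = evalPath N x y ρ ∘ₗ (f.app (vtx x)).hom := by
  induction ρ using Finsupp.induction_linear with
  | zero => simp
  | add ρ σ h₁ h₂ => simp only [map_add, LinearMap.comp_add, LinearMap.add_comp, h₁, h₂]
  | single p c =>
    have := congrArg ModuleCat.Hom.hom (f.naturality (pathHom p))
    simp only [ModuleCat.hom_comp] at this
    simp only [evalPath_single, LinearMap.comp_smul, LinearMap.smul_comp, this]

lemma evalPath_comp (M : Paths V ⥤ ModuleCat.{u} k) (T : ModuleCat.{u} k ⥤ ModuleCat.{u} k)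
    [T.Additive] [T.Linear k] {x y : V} (ρ : PathSpace k x y) :
    evalPath (M ⋙ T) x y ρ = (T.map (ModuleCat.ofHom (evalPath M x y ρ))).hom := by
  induction ρ using Finsupp.induction_linear with
  | zero => simp
  | add ρ σ h₁ h₂ => simp only [map_add, h₁, h₂, ModuleCat.ofHom_add, Functor.map_add,
      ModuleCat.hom_add]
  | single p c =>
    have h : ModuleCat.ofHom (c • (M.map (pathHom p)).hom) = c • M.map (pathHom p) :=
      rfl
    rw [evalPath_single, evalPath_single, h, Functor.map_smul]
    rfl

variable (k) in
/-- The functor `M ↦ M(x)`. -/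
abbrev evalAt (x : V) : (Paths V ⥤ ModuleCat.{u} k) ⥤ ModuleCat.{u} k :=
  (evaluation (Paths V) (ModuleCat.{u} k)).obj (vtx x)

section Abelian

variable (R : PathIdeal k V)

instance : R.IsRep.IsClosedUnderSubobjects where
  prop_of_mono {M N} f _ hN x y ρ hρ := by
    have h := evalPath_naturality f ρ
    rw [hN x y ρ hρ, LinearMap.zero_comp] at h
    have hf : Function.Injective (f.app (vtx y)).hom :=
      (ModuleCat.mono_iff_injective _).1 (inferInstanceAs (Mono ((evalAt k y).map f)))
    ext m
    exact hf (by simpa using LinearMap.congr_fun h m)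

instance : R.IsRep.IsClosedUnderQuotients where
  prop_of_epi {M N} f _ hM x y ρ hρ := by
    have h := evalPath_naturality f ρ
    rw [hM x y ρ hρ, LinearMap.comp_zero] at h
    have hf : Function.Surjective (f.app (vtx x)).hom :=
      (ModuleCat.epi_iff_surjective _).1 (inferInstanceAs (Epi ((evalAt k x).map f)))
    ext m
    obtain ⟨m, rfl⟩ := hf m
    simpa using (LinearMap.congr_fun h m).symm

instance (J : Type) [Category.{0} J] : R.IsRep.IsClosedUnderLimitsOfShape J where
  limitsOfShape_le := by
    rintro M ⟨h⟩ x y ρ hρ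
    have key : ModuleCat.ofHom (evalPath M x y ρ) = 0 := by
      refine (isLimitOfPreserves (evalAt k y) h.isLimit).hom_ext fun j => ?_
      have := evalPath_naturality (h.π.app j) ρ
      rw [h.prop_diag_obj j x y ρ hρ, LinearMap.zero_comp] at this
      rw [zero_comp]; exact ModuleCat.hom_ext this
    simpa using congrArg ModuleCat.Hom.hom key

instance isClosedUnderColimits (J : Type*) [Category J]
    [HasColimitsOfShape J (ModuleCat.{u} k)] : R.IsRep.IsClosedUnderColimitsOfShape J where
  colimitsOfShape_le := by
    rintro M ⟨h⟩ x y ρ hρ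
    have key : ModuleCat.ofHom (evalPath M x y ρ) = 0 := by
      refine (isColimitOfPreserves (evalAt k x) h.isColimit).hom_ext fun j => ?_
      have := evalPath_naturality (h.ι.app j) ρ
      rw [h.prop_diag_obj j x y ρ hρ, LinearMap.comp_zero] at this
      rw [comp_zero]; exact ModuleCat.hom_ext this.symm
    simpa using congrArg ModuleCat.Hom.hom key

instance : R.IsRep.ContainsZero where
  exists_zero := by
    obtain ⟨Z, hZ⟩ := HasZeroObject.zero (C := Paths V ⥤ ModuleCat.{u} k)
    refine ⟨Z, hZ, fun x y ρ _ => ?_⟩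
    have h : IsZero ((evalAt k y).obj Z) := (evalAt k y).map_isZero hZ
    exact congrArg ModuleCat.Hom.hom (h.eq_of_tgt (ModuleCat.ofHom (evalPath Z x y ρ)) 0)

instance : R.IsRep.IsClosedUnderFiniteProducts where

instance : Abelian R.Mod := inferInstance

instance : HasFiniteBiproducts R.Mod := Abelian.hasFiniteBiproducts

end Abelian

/-! ### Projective, injective and simple modules -/

/-- The indecomposable projective module `P_a = Λ e_a`. -/
def PathIdeal.P (R : PathIdeal k V) (a : V) : R.Mod where
  obj :=
    { obj := fun y => ModuleCat.of k (R.Alg a y)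
      map := fun p => ModuleCat.ofHom (R.lmul p)
      map_id := fun _ => ModuleCat.hom_ext (LinearMap.ext fun u => R.lmul_nil u)
      map_comp := fun p q => ModuleCat.hom_ext (LinearMap.ext fun u => (R.lmul_lmul p q u).symm) }
  property _ _ _ hρ := R.lmulLin_eq_zero hρ

/-- The morphism `P[u] : P_y → P_x` given by right multiplication by the class `u` of a path
`p : x → y`. -/
def PathIdeal.Pmap (R : PathIdeal k V) {x y : V} (p : Quiver.Path x y) : R.P y ⟶ R.P x :=
  R.IsRep.homMk
    { app := fun _ => ModuleCat.ofHom (R.rmul p)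
      naturality := fun _ _ q =>
        ModuleCat.hom_ext (LinearMap.ext fun u => (R.lmul_rmul p q u).symm) }

/-- The functor on paths underlying the indecomposable injective module `I_a`. -/
def PathIdeal.IFunctor (R : PathIdeal k V) (a : V) : Paths V ⥤ ModuleCat.{u} k where
  obj x := ModuleCat.of k (Module.Dual k (R.Alg x a))
  map p := ModuleCat.ofHom (R.rmul p).dualMap
  map_id _ := ModuleCat.hom_ext (LinearMap.ext fun f => LinearMap.ext fun u =>
    congrArg f (R.rmul_nil u))
  map_comp p q := ModuleCat.hom_ext (LinearMap.ext fun f => LinearMap.ext fun u =>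
    (congrArg f (R.rmul_rmul p q u)).symm)

lemma PathIdeal.evalPath_IFunctor (R : PathIdeal k V) (a : V) {x y : V} (ρ : PathSpace k x y) :
    evalPath (R.IFunctor a) x y ρ = (R.rmulLin x y a ρ).dualMap := by
  induction ρ using Finsupp.induction_linear with
  | zero =>
    simp only [map_zero]
    exact LinearMap.ext fun (f : Module.Dual k (R.Alg x a)) => LinearMap.ext fun u =>
      (map_zero f).symm
  | add ρ σ h₁ h₂ =>
    simp only [map_add, h₁, h₂]
    exact LinearMap.ext fun (f : Module.Dual k (R.Alg x a)) => LinearMap.ext fun u =>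
      (map_add f _ _).symm
  | single p c =>
    rw [evalPath_single, PathIdeal.rmulLin, Finsupp.linearCombination_single]
    exact LinearMap.ext fun (f : Module.Dual k (R.Alg x a)) => LinearMap.ext fun u =>
      (map_smul f c _).symm

/-- The indecomposable injective module `I_a`, with `I_a(x) = Hom_k(e_a Λ e_x, k)`, on which a path
`p : x → y` acts as the transpose of the right multiplication by `p`. -/
def PathIdeal.I (R : PathIdeal k V) (a : V) : R.Mod where
  obj := R.IFunctor a
  property x y ρ hρ := by
    rw [R.evalPath_IFunctor, R.rmulLin_eq_zero hρ]
    exact LinearMap.ext fun (f : Module.Dual k (R.Alg x a)) => LinearMap.ext fun u => map_zero f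

/-- The morphism `I[u] : I_y → I_x` attached to the class `u` of a path `q : x → y`: the transpose
of the left multiplication by `u`. -/
def PathIdeal.Imap (R : PathIdeal k V) {x y : V} (q : Quiver.Path x y) : R.I y ⟶ R.I x :=
  R.IsRep.homMk
    { app := fun _ => ModuleCat.ofHom (R.lmul q).dualMap
      naturality := fun z _ p => ModuleCat.hom_ext (LinearMap.ext fun f => LinearMap.ext fun u =>
        DFunLike.congr_arg (F := Module.Dual k (R.Alg z y)) f (R.lmul_rmul p q u).symm) }

/-- `(JM)(y)`, where `J` is the ideal of `Λ` generated by the classes of the arrows: the sum of the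
images of the maps `M(α)`, where `α` runs over the arrows ending at `y`. -/
def PathIdeal.radical (R : PathIdeal k V) (M : R.Mod) (y : V) : Submodule k (M.obj.obj (vtx y)) :=
  ⨆ p : (Σ z : V, z ⟶ y), LinearMap.range (M.obj.map (pathHom p.2.toPath)).hom

lemma PathIdeal.map_mem_radical (R : PathIdeal k V) (M : R.Mod) {x y : V} (p : Quiver.Path x y)
    {m : M.obj.obj (vtx x)} (hm : m ∈ R.radical M x) :
    (M.obj.map (pathHom p)).hom m ∈ R.radical M y := by
  cases p with
  | nil => rwa [pathHom_nil, M.obj.map_id]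
  | @cons z _ q a =>
    have h : pathHom (q.cons a) = pathHom q ≫ pathHom a.toPath := rfl
    rw [h, M.obj.map_comp, ModuleCat.hom_comp]
    exact Submodule.mem_iSup_of_mem (p := fun p : (Σ z : V, z ⟶ y) =>
      LinearMap.range (M.obj.map (pathHom p.2.toPath)).hom) ⟨z, a⟩ ⟨_, rfl⟩

/-- The functor on paths underlying `M / JM`. -/
def PathIdeal.topFunctor (R : PathIdeal k V) (M : R.Mod) : Paths V ⥤ ModuleCat.{u} k where
  obj x := ModuleCat.of k (M.obj.obj x ⧸ R.radical M x)
  map {x y} p := ModuleCat.ofHom (Submodule.mapQ (R.radical M x) (R.radical M y) (M.obj.map p).hom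
    fun _ hm => R.map_mem_radical M p hm)
  map_id _ := ModuleCat.hom_ext (Submodule.linearMap_qext _ (LinearMap.ext fun m =>
    congrArg (Submodule.mkQ (R.radical M _))
      (congrArg (fun f => (ModuleCat.Hom.hom f) m) (M.obj.map_id _))))
  map_comp {_ _ z} p q := ModuleCat.hom_ext (Submodule.linearMap_qext _ (LinearMap.ext fun m =>
    congrArg (Submodule.mkQ (R.radical M z))
      (congrArg (fun f => (ModuleCat.Hom.hom f) m) (M.obj.map_comp p q))))

/-- The canonical projection `M → M / JM`. -/
def PathIdeal.topProj (R : PathIdeal k V) (M : R.Mod) : M.obj ⟶ R.topFunctor M where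
  app x := ModuleCat.ofHom (Submodule.mkQ (R.radical M x))
  naturality _ _ _ := rfl

instance (R : PathIdeal k V) (M : R.Mod) : Epi (R.topProj M) := by
  rw [NatTrans.epi_iff_epi_app]
  exact fun x => (ModuleCat.epi_iff_surjective _).2 (Submodule.mkQ_surjective _)

/-- The module `M / JM`. -/
def PathIdeal.top (R : PathIdeal k V) (M : R.Mod) : R.Mod where
  obj := R.topFunctor M
  property := R.IsRep.prop_of_epi (R.topProj M) M.property

/-- The simple module `S_a = P_a / J P_a`. -/
def PathIdeal.S (R : PathIdeal k V) (a : V) : R.Mod := R.top (R.P a)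

/-- The linear map `f(y) : M(y) → N(y)` given by a morphism of modules `f`. -/
abbrev PathIdeal.mapAt (R : PathIdeal k V) {M N : R.Mod} (f : M ⟶ N) (y : V) :
    M.obj.obj (vtx y) →ₗ[k] N.obj.obj (vtx y) :=
  (f.hom.app (vtx y)).hom

/-! ### Koszul algebras -/

/-- A linear projective resolution `⋯ ⟶ P⁻² ⟶ P⁻¹ ⟶ P⁰ ⟶ S_a ⟶ 0` of the simple module `S_a`. -/
structure PathIdeal.LinearResolution (R : PathIdeal k V) (a : V) where
  /-- `P⁻ⁿ` is the direct sum of `rank n` modules of the form `P_x`. -/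
  rank : ℕ → ℕ
  /-- The vertices `x` of the direct summands `P_x` of `P⁻ⁿ`. -/
  vertex : ∀ n, Fin (rank n) → V
  /-- The morphism `P⁻⁽ⁿ⁺¹⁾ ⟶ P⁻ⁿ`. -/
  d : ∀ n, (⨁ fun i => R.P (vertex (n + 1) i)) ⟶ ⨁ fun i => R.P (vertex n i)
  /-- The morphism `P⁰ ⟶ S_a`. -/
  aug : (⨁ fun i => R.P (vertex 0 i)) ⟶ R.S a
  surjective_aug : ∀ y, Function.Surjective (R.mapAt aug y)
  exact_aug : ∀ y, Function.Exact (R.mapAt (d 0) y) (R.mapAt aug y)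
  exact_d : ∀ n y, Function.Exact (R.mapAt (d (n + 1)) y) (R.mapAt (d n) y)
  /-- `P⁰ ⟶ S_a` is a projective `J`-cover. -/
  ker_aug_le : ∀ y, LinearMap.ker (R.mapAt aug y) ≤ R.radical _ y
  /-- The corestriction of `P⁻⁽ⁿ⁺¹⁾ ⟶ P⁻ⁿ` to its image is a projective `J`-cover. -/
  ker_d_le : ∀ n y, LinearMap.ker (R.mapAt (d n) y) ≤ R.radical _ y
  /-- The morphism `P⁻⁽ⁿ⁺¹⁾ ⟶ P⁻ⁿ` is homogeneous of degree one, where `P_x` is generated in degree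
  zero: each of its entries `P_x ⟶ P_{x'}` maps `e_y Λₘ e_x` to `e_y Λₘ₊₁ e_{x'}`. -/
  homogeneous_d : ∀ n (i : Fin (rank (n + 1))) (j : Fin (rank n)) (m : ℕ) (y : V)
    (u : R.Alg (vertex (n + 1) i) y), u ∈ R.algDegree m (vertex (n + 1) i) y →
    (R.mapAt (biproduct.ι (fun i => R.P (vertex (n + 1) i)) i ≫ d n ≫
      biproduct.π (fun j => R.P (vertex n j)) j) y u : R.Alg (vertex n j) y) ∈
        R.algDegree (m + 1) (vertex n j) y

/-- `Λ = kQ / R` is Koszul: `R` is homogeneous, and every simple module `S_a` has a linear projective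
resolution. -/
def PathIdeal.IsKoszul (R : PathIdeal k V) : Prop :=
  R.IsHomogeneous ∧ ∀ a : V, Nonempty (R.LinearResolution a)

/-- The tensor product `M ⊗ W` over `k` of a module `M` and a vector space `W`, with
`(M ⊗ W)(x) = M(x) ⊗ W`. -/
def PathIdeal.tens (R : PathIdeal k V) (M : R.Mod) (W : ModuleCat.{u} k) : R.Mod where
  obj := M.obj ⋙ MonoidalCategory.tensorRight W
  property x y ρ hρ := by
    rw [evalPath_comp, M.property x y ρ hρ]
    exact congrArg ModuleCat.Hom.hom (Functor.map_zero _ _ _)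

open MonoidalCategory in
/-- The morphism `f ⊗ g : M ⊗ W → M' ⊗ W'`. -/
def PathIdeal.tensMap (R : PathIdeal k V) {M M' : R.Mod} {W W' : ModuleCat.{u} k} (f : M ⟶ M')
    (g : W ⟶ W') : R.tens M W ⟶ R.tens M' W' :=
  R.IsRep.homMk
    { app := fun x => f.hom.app x ⊗ₘ g
      naturality := fun x y p => by
        dsimp [PathIdeal.tens]
        rw [← tensorHom_id, ← tensorHom_id, tensorHom_comp_tensorHom, tensorHom_comp_tensorHom,
          f.hom.naturality, Category.id_comp, Category.comp_id] }

lemma PathIdeal.tensMap_id (R : PathIdeal k V) (M : R.Mod) (W : ModuleCat.{u} k) :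
    R.tensMap (𝟙 M) (𝟙 W) = 𝟙 (R.tens M W) := by
  ext x : 3
  exact MonoidalCategory.id_tensorHom_id _ _

lemma PathIdeal.tensMap_comp (R : PathIdeal k V) {M M' M'' : R.Mod} {W W' W'' : ModuleCat.{u} k}
    (f : M ⟶ M') (g : W ⟶ W') (f' : M' ⟶ M'') (g' : W' ⟶ W'') :
    R.tensMap f g ≫ R.tensMap f' g' = R.tensMap (f ≫ f') (g ≫ g') := by
  ext x : 3
  exact MonoidalCategory.tensorHom_comp_tensorHom _ _ _ _

lemma PathIdeal.tensMap_add (R : PathIdeal k V) {M M' : R.Mod} {W W' : ModuleCat.{u} k}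
    (f : M ⟶ M') (g h : W ⟶ W') :
    R.tensMap f (g + h) = R.tensMap f g + R.tensMap f h := by
  ext x : 3
  exact MonoidalPreadditive.tensor_add _ _ _

/-- Evaluation of morphisms of modules at an element. -/
def PathIdeal.evalHom (R : PathIdeal k V) (M N : R.Mod) (x : V) (m : M.obj.obj (vtx x)) :
    (M ⟶ N) →+ N.obj.obj (vtx x) where
  toFun f := (f.hom.app (vtx x)).hom m
  map_zero' := rfl
  map_add' _ _ := rfl

lemma PathIdeal.hom_ext (R : PathIdeal k V) {M N : R.Mod} {f f' : M ⟶ N}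
    (h : ∀ x m, R.evalHom M N x m f = R.evalHom M N x m f') : f = f' :=
  ObjectProperty.hom_ext _ (NatTrans.ext (funext fun x => ModuleCat.hom_ext (LinearMap.ext
    fun m => h x m)))

open scoped TensorProduct in
lemma PathIdeal.hom_ext_tens (R : PathIdeal k V) {M N : R.Mod} {W : ModuleCat.{u} k}
    {f f' : R.tens M W ⟶ N} (h : ∀ (x : V) (m : M.obj.obj (vtx x)) (w : W),
      R.evalHom (R.tens M W) N x (m ⊗ₜ[k] w) f = R.evalHom (R.tens M W) N x (m ⊗ₜ[k] w) f') :
    f = f' :=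
  ObjectProperty.hom_ext _ (NatTrans.ext (funext fun x => ModuleCat.hom_ext (TensorProduct.ext'
    fun m w => h x m w)))

end PathAlgebra

/-! ### Complexes attached to graded families -/

section GradedFamily

variable {W : Type u} [Quiver.{u} W] [LocallyFinite W] (𝒞 : Type (u + 1)) [Category.{u} 𝒞]
  [Preadditive 𝒞] 

variable (W) in
/-- Objects `T x` of `𝒞` indexed by the vertices of a quiver and morphisms `τ α : T x ⟶ T y` indexed
by its arrows `α : x ⟶ y`, such that for all `x`, `z` the composites `τ β ∘ τ α` along the paths
`x ⟶ y ⟶ z` sum up to zero. -/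
structure GradedFamily where
  T : W → 𝒞
  τ : ∀ {x y : W}, (x ⟶ y) → (T x ⟶ T y)
  sum_eq_zero : ∀ x z : W, ∑ t : Arrow₂ x z, τ t.2.1 ≫ τ t.2.2 = 0

namespace GradedFamily

variable {𝒞} (D : GradedFamily W 𝒞)

lemma sum_comp_comp_eq_zero (x : W) {Y : 𝒞} (f : ∀ z, D.T z ⟶ Y) :
    ∑ p : (Σ y : W, x ⟶ y), ∑ q : (Σ z : W, p.1 ⟶ z), D.τ p.2 ≫ D.τ q.2 ≫ f q.1 = 0 := by
  classical
  let A := Σ p : (Σ y : W, x ⟶ y), Σ z : W, p.1 ⟶ z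
  have h1 : ∑ p : (Σ y : W, x ⟶ y), ∑ q : (Σ z : W, p.1 ⟶ z), D.τ p.2 ≫ D.τ q.2 ≫ f q.1 =
      ∑ a : A, D.τ a.1.2 ≫ D.τ a.2.2 ≫ f a.2.1 :=
    (Fintype.sum_sigma fun a : A => D.τ a.1.2 ≫ D.τ a.2.2 ≫ f a.2.1).symm
  rw [h1, ← Finset.sum_fiberwise_of_maps_to (s := Finset.univ)
    (t := Finset.univ.image fun a : A => a.2.1) (g := fun a : A => a.2.1) (by simp)]
  refine Finset.sum_eq_zero fun z _ => ?_
  have h2 := congrArg (fun φ => φ ≫ f z) (D.sum_eq_zero x z)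
  simp only [Preadditive.sum_comp, zero_comp, Category.assoc] at h2
  rw [← h2]
  symm
  refine Finset.sum_bij (fun t _ => (⟨⟨t.1, t.2.1⟩, ⟨z, t.2.2⟩⟩ : A)) ?_ ?_ ?_ ?_
  · intro t _; simp
  · rintro ⟨y, a, b⟩ _ ⟨y', a', b'⟩ _ h
    cases h; rfl
  · rintro ⟨⟨y, a⟩, ⟨z', b⟩⟩ h
    simp only [Finset.mem_filter, Finset.mem_univ, true_and] at h
    subst h
    exact ⟨⟨y, a, b⟩, Finset.mem_univ _, rfl⟩
  · intro t _; rfl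

variable [HasCoproducts.{u} 𝒞] (g : Grading W)

/-- `⨁ T x`, the direct sum over the vertices `x` of degree `n`. -/
def X (n : ℤ) : 𝒞 := ∐ fun x : {x : W // g.deg x = n} => D.T x

/-- The inclusion of `T x` into the direct sum of degree `n` if `x` is of degree `n`, and zero
otherwise. -/
def ι (n : ℤ) (x : W) : D.T x ⟶ D.X g n :=
  if h : g.deg x = n then Sigma.ι (fun x : {x : W // g.deg x = n} => D.T x) ⟨x, h⟩ else 0

lemma ι_of_ne {n : ℤ} {x : W} (h : g.deg x ≠ n) : D.ι g n x = 0 := dif_neg h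

lemma ι_of_eq {n : ℤ} (x : {x : W // g.deg x = n}) :
    D.ι g n x = Sigma.ι (fun x : {x : W // g.deg x = n} => D.T x) x := dif_pos x.2

lemma hom_ext {n : ℤ} {Y : 𝒞} {f f' : D.X g n ⟶ Y}
    (h : ∀ x, g.deg x = n → D.ι g n x ≫ f = D.ι g n x ≫ f') : f = f' :=
  Sigma.hom_ext _ _ fun x => by
    have := h x x.2
    rwa [ι_of_eq] at this

/-- The differential: its component `T x ⟶ T y` is the sum of the `τ α` over the arrows
`α : x ⟶ y`. -/
def d (i j : ℤ) : D.X g i ⟶ D.X g j :=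
  Sigma.desc fun x => ∑ p : Σ y : W, x.1 ⟶ y, D.τ p.2 ≫ D.ι g j p.1

lemma ι_d {i : ℤ} (j : ℤ) {x : W} (h : g.deg x = i) :
    D.ι g i x ≫ D.d g i j = ∑ p : Σ y : W, x ⟶ y, D.τ p.2 ≫ D.ι g j p.1 := by
  have := D.ι_of_eq g ⟨x, h⟩
  dsimp only at this
  rw [this, d]
  exact Sigma.ι_desc _ _

/-- The complex with terms `⨁ T x`. -/
def complex : CochainComplex 𝒞 ℤ where
  X := D.X g
  d := D.d g
  shape i j h := D.hom_ext g fun x hx => by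
    rw [ι_d _ _ _ hx, comp_zero]
    refine Finset.sum_eq_zero fun p _ => ?_
    rw [ι_of_ne, comp_zero]
    rw [g.deg_arrow p.2, hx]; exact h
  d_comp_d' i j l hij hjl := D.hom_ext g fun x hx => by
    simp only [ComplexShape.up_Rel] at hij hjl
    have h1 : ∀ p : Σ y : W, x ⟶ y, g.deg p.1 = j := fun p => by
      rw [g.deg_arrow p.2, hx, hij]
    rw [← Category.assoc, ι_d _ _ _ hx, Preadditive.sum_comp, comp_zero]
    have e : ∀ p : Σ y : W, x ⟶ y, (D.τ p.2 ≫ D.ι g j p.1) ≫ D.d g j l =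
        ∑ q : Σ z : W, p.1 ⟶ z, D.τ p.2 ≫ D.τ q.2 ≫ D.ι g l q.1 := fun p => by
      rw [Category.assoc, ι_d _ _ _ (h1 p), Preadditive.comp_sum]
    simp only [e]
    exact D.sum_comp_comp_eq_zero x fun z => D.ι g l z

/-- The morphism `⨁ T x ⟶ ⨁ T' x` induced by morphisms `φ x : T x ⟶ T' x`. -/
def mapX {D D' : GradedFamily W 𝒞} (φ : ∀ x, D.T x ⟶ D'.T x) (n : ℤ) : D.X g n ⟶ D'.X g n :=
  Limits.Sigma.map fun x : {x : W // g.deg x = n} => φ x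

lemma ι_mapX {D D' : GradedFamily W 𝒞} (φ : ∀ x, D.T x ⟶ D'.T x) (n : ℤ) (x : W) :
    D.ι g n x ≫ mapX g φ n = φ x ≫ D'.ι g n x := by
  by_cases h : g.deg x = n
  · have h₁ := D.ι_of_eq g ⟨x, h⟩
    have h₂ := D'.ι_of_eq g ⟨x, h⟩
    dsimp only at h₁ h₂
    rw [h₁, h₂]
    exact Sigma.ι_map (fun x : {x : W // g.deg x = n} => φ x) ⟨x, h⟩
  · rw [ι_of_ne _ _ h, ι_of_ne _ _ h, zero_comp, comp_zero]

/-- The morphism of complexes induced by a compatible family of morphisms `φ x : T x ⟶ T' x`. -/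
def complexMap {D D' : GradedFamily W 𝒞} (φ : ∀ x, D.T x ⟶ D'.T x)
    (hφ : ∀ {x y : W} (a : x ⟶ y), D.τ a ≫ φ y = φ x ≫ D'.τ a) : D.complex g ⟶ D'.complex g where
  f n := mapX g φ n
  comm' i j _ := D.hom_ext g fun x hx => by
    change D.ι g i x ≫ mapX g φ i ≫ D'.d g i j = D.ι g i x ≫ D.d g i j ≫ mapX g φ j
    rw [← Category.assoc, ι_mapX, Category.assoc, ι_d _ _ _ hx, ← Category.assoc, ι_d _ _ _ hx,
      Preadditive.comp_sum, Preadditive.sum_comp]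
    refine Finset.sum_congr rfl fun p _ => ?_
    rw [Category.assoc, ι_mapX, ← Category.assoc, ← Category.assoc, hφ]

lemma complexMap_eq_id (φ : ∀ x, D.T x ⟶ D.T x)
    (hφ : ∀ {x y : W} (a : x ⟶ y), D.τ a ≫ φ y = φ x ≫ D.τ a) (h : ∀ x, φ x = 𝟙 _) :
    complexMap g φ hφ = 𝟙 (D.complex g) :=
  HomologicalComplex.hom_ext _ _ fun n => D.hom_ext g fun x _ => by
    change D.ι g n x ≫ mapX g φ n = D.ι g n x ≫ 𝟙 _
    rw [ι_mapX, h, Category.id_comp, Category.comp_id]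

lemma complexMap_comp {D D' D'' : GradedFamily W 𝒞} (φ : ∀ x, D.T x ⟶ D'.T x)
    (hφ : ∀ {x y : W} (a : x ⟶ y), D.τ a ≫ φ y = φ x ≫ D'.τ a) (ψ : ∀ x, D'.T x ⟶ D''.T x)
    (hψ : ∀ {x y : W} (a : x ⟶ y), D'.τ a ≫ ψ y = ψ x ≫ D''.τ a) (χ : ∀ x, D.T x ⟶ D''.T x)
    (hχ : ∀ {x y : W} (a : x ⟶ y), D.τ a ≫ χ y = χ x ≫ D''.τ a) (h : ∀ x, φ x ≫ ψ x = χ x) :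
    complexMap g χ hχ = complexMap g φ hφ ≫ complexMap g ψ hψ :=
  HomologicalComplex.hom_ext _ _ fun n => D.hom_ext g fun x _ => by
    change D.ι g n x ≫ mapX g χ n = D.ι g n x ≫ mapX g φ n ≫ mapX g ψ n
    rw [ι_mapX, ← Category.assoc, ι_mapX, Category.assoc, ι_mapX, ← Category.assoc, h]

lemma complexMap_add {D D' : GradedFamily W 𝒞} (φ : ∀ x, D.T x ⟶ D'.T x)
    (hφ : ∀ {x y : W} (a : x ⟶ y), D.τ a ≫ φ y = φ x ≫ D'.τ a) (ψ : ∀ x, D.T x ⟶ D'.T x)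
    (hψ : ∀ {x y : W} (a : x ⟶ y), D.τ a ≫ ψ y = ψ x ≫ D'.τ a) (χ : ∀ x, D.T x ⟶ D'.T x)
    (hχ : ∀ {x y : W} (a : x ⟶ y), D.τ a ≫ χ y = χ x ≫ D'.τ a) (h : ∀ x, χ x = φ x + ψ x) :
    complexMap g χ hχ = complexMap g φ hφ + complexMap g ψ hψ :=
  HomologicalComplex.hom_ext _ _ fun n => D.hom_ext g fun x _ => by
    change D.ι g n x ≫ mapX g χ n = D.ι g n x ≫ (mapX g φ n + mapX g ψ n)
    rw [Preadditive.comp_add, ι_mapX, ι_mapX, ι_mapX, h, Preadditive.add_comp]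

end GradedFamily

end GradedFamily

/-! ### The Koszul functors -/

section Koszul

variable {k : Type u} [Field k] {V : Type u} [Quiver.{u} V] [LocallyFinite V]

/-- Pairs of composable arrows of the opposite quiver. -/
def arrow₂Op (x z : Vᵒᵖ) : Arrow₂ x z ≃ Arrow₂ z.unop x.unop where
  toFun t := ⟨t.1.unop, t.2.2.unop, t.2.1.unop⟩
  invFun t := ⟨op t.1, t.2.2.op, t.2.1.op⟩
  left_inv _ := rfl
  right_inv _ := rfl

open scoped TensorProduct in
/-- The modules `P_x ⊗ M(x)` and the morphisms `P[α] ⊗ M(αᵒ)` attached to a module `M` over the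
quadratic dual. -/
def PathIdeal.familyF (R : PathIdeal k V) (M : R.dual.Mod) : GradedFamily Vᵒᵖ R.Mod where
  T x := R.tens (R.P x.unop) (M.obj.obj (vtx x))
  τ a := R.tensMap (R.Pmap a.unop.toPath) (M.obj.map (pathHom a.toPath))
  sum_eq_zero x z := by
    simp only [PathIdeal.tensMap_comp, ← Functor.map_comp]
    refine R.hom_ext_tens fun w (u : R.Alg x.unop w) m => ?_
    let B := (TensorProduct.mk k (R.Alg z.unop w) (M.obj.obj (vtx z))).compl₁₂
      (LinearMap.applyₗ u ∘ₗ R.rmulLin z.unop x.unop w) (LinearMap.applyₗ m ∘ₗ evalPath M.obj x z)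
    have hB : ∀ ρ σ, B ρ σ = R.rmulLin z.unop x.unop w ρ u ⊗ₜ[k] evalPath M.obj x z σ m :=
      fun _ _ => rfl
    have h := R.sum_arrow₂_eq_zero B
      (fun ρ hρ => LinearMap.ext fun σ => by
        rw [hB, R.rmulLin_eq_zero hρ, LinearMap.zero_apply, TensorProduct.zero_tmul]; rfl)
      (fun σ hσ ρ => by rw [hB, M.property x z σ hσ, LinearMap.zero_apply, TensorProduct.tmul_zero])
    refine (map_sum _ _ _).trans (Eq.trans ?_ h)
    rw [← (arrow₂Op x z).sum_comp]
    refine Finset.sum_congr rfl fun t _ => ?_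
    rw [hB, R.rmulLin_single, evalPath_single, one_smul, Arrow₂.opPath_path]
    exact congrArg (fun a : R.Alg z.unop w =>
      a ⊗ₜ[k] (M.obj.map (pathHom t.2.1.toPath ≫ pathHom t.2.2.toPath)).hom m) (R.rmul_rmul t.2.2.unop.toPath t.2.1.unop.toPath u)

open scoped TensorProduct in
/-- The modules `I_x ⊗ N(x)` over the quadratic dual and the morphisms `I[αᵒ] ⊗ N(α)` attached to a
module `N`. -/
def PathIdeal.familyG (R : PathIdeal k V) (N : R.Mod) : GradedFamily V R.dual.Mod where
  T x := R.dual.tens (R.dual.I (op x)) (N.obj.obj (vtx x))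
  τ a := R.dual.tensMap (R.dual.Imap a.op.toPath) (N.obj.map (pathHom a.toPath))
  sum_eq_zero x z := by
    simp only [PathIdeal.tensMap_comp, ← Functor.map_comp]
    refine R.dual.hom_ext_tens fun w (f : Module.Dual k (R.dual.Alg w (op x))) m => ?_
    let B := ((TensorProduct.mk k (Module.Dual k (R.dual.Alg w (op z)))
      (N.obj.obj (vtx z))).compl₁₂ (LinearMap.compRight k f ∘ₗ R.dual.lmulLin w (op z) (op x))
      (LinearMap.applyₗ m ∘ₗ evalPath N.obj x z)).flip
    have hB : ∀ ρ σ, B ρ σ = (f ∘ₗ R.dual.lmulLin w (op z) (op x) σ :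
        Module.Dual k (R.dual.Alg w (op z))) ⊗ₜ[k] evalPath N.obj x z ρ m :=
      fun _ _ => rfl
    have h := R.sum_arrow₂_eq_zero
      (C := (Module.Dual k (R.dual.Alg w (op z))) ⊗[k] (N.obj.obj (vtx z))) B
      (fun ρ hρ => LinearMap.ext fun σ => by
        rw [hB, N.property x z ρ hρ, LinearMap.zero_apply, TensorProduct.tmul_zero]; rfl)
      (fun σ hσ ρ => by
        rw [hB, R.dual.lmulLin_eq_zero hσ, LinearMap.comp_zero, TensorProduct.zero_tmul])
    refine (map_sum _ _ _).trans (Eq.trans ?_ h)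
    refine Finset.sum_congr rfl fun t _ => ?_
    rw [hB, Arrow₂.opPath_path, R.dual.lmulLin_single, evalPath_single, one_smul]
    refine congrArg (fun a : Module.Dual k (R.dual.Alg w (op z)) =>
      a ⊗ₜ[k] (N.obj.map (pathHom t.2.1.toPath ≫ pathHom t.2.2.toPath)).hom m) (LinearMap.ext fun v => ?_)
    exact congrArg f (R.dual.lmul_lmul t.2.2.op.toPath t.2.1.op.toPath v)

lemma PathIdeal.familyF_naturality (R : PathIdeal k V) {M N : R.dual.Mod} (f : M ⟶ N) {x y : Vᵒᵖ}
    (a : x ⟶ y) :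
    (R.familyF M).τ a ≫ R.tensMap (𝟙 (R.P y.unop)) (f.hom.app (vtx y)) =
      R.tensMap (𝟙 (R.P x.unop)) (f.hom.app (vtx x)) ≫ (R.familyF N).τ a := by
  simp only [PathIdeal.familyF, PathIdeal.tensMap_comp, Category.comp_id, Category.id_comp,
    NatTrans.naturality]

lemma PathIdeal.familyG_naturality (R : PathIdeal k V) {M N : R.Mod} (f : M ⟶ N) {x y : V}
    (a : x ⟶ y) :
    (R.familyG M).τ a ≫ R.dual.tensMap (𝟙 (R.dual.I (op y))) (f.hom.app (vtx y)) =
      R.dual.tensMap (𝟙 (R.dual.I (op x))) (f.hom.app (vtx x)) ≫ (R.familyG N).τ a := by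
  simp only [PathIdeal.familyG, PathIdeal.tensMap_comp, Category.comp_id, Category.id_comp,
    NatTrans.naturality]

/-- The Koszul functor `F : Mod Λ^! ⥤ C(Mod Λ)`. The complex `F(M)` has the terms
`F(M)ⁿ = ⨁ P_x ⊗ M(x)`, where `x` runs over `(Qᵒ)ⁿ = Q⁻ⁿ`, and the component
`P_x ⊗ M(x) ⟶ P_y ⊗ M(y)` of its differential is the sum of `P[α] ⊗ M(αᵒ)` over the arrows
`α : y ⟶ x` of `Q`. -/
def koszulF (g : Grading V) (R : PathIdeal k V) : R.dual.Mod ⥤ CochainComplex R.Mod ℤ where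
  obj M := (R.familyF M).complex g.op
  map f := GradedFamily.complexMap g.op
    (fun x => R.tensMap (𝟙 (R.P x.unop)) (f.hom.app (vtx x))) (R.familyF_naturality f)
  map_id M := GradedFamily.complexMap_eq_id _ _ _ _ fun x => R.tensMap_id _ _
  map_comp f f' := GradedFamily.complexMap_comp _ _ _ _ _ _ _ fun x =>
    (PathIdeal.tensMap_comp _ _ _ _ _).trans (by rw [Category.id_comp]; rfl)

instance (g : Grading V) (R : PathIdeal k V) : (koszulF g R).Additive where
  map_add {_ _ f h} := GradedFamily.complexMap_add _ _ (R.familyF_naturality f) _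
    (R.familyF_naturality h) _ (R.familyF_naturality (f + h)) fun _ => R.tensMap_add _ _ _

/-- The Koszul functor `G : Mod Λ ⥤ C(Mod Λ^!)`. The complex `G(N)` has the terms
`G(N)ⁿ = ⨁ I^!_x ⊗ N(x)`, where `x` runs over `Qⁿ` and `I^!_x` is the injective module of `Λ^!` at
`x`, and the component `I^!_x ⊗ N(x) ⟶ I^!_y ⊗ N(y)` of its differential is the sum of
`I[αᵒ] ⊗ N(α)` over the arrows `α : x ⟶ y` of `Q`. -/
def koszulG (g : Grading V) (R : PathIdeal k V) : R.Mod ⥤ CochainComplex R.dual.Mod ℤ where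
  obj N := (R.familyG N).complex g
  map f := GradedFamily.complexMap g
    (fun x => R.dual.tensMap (𝟙 (R.dual.I (op x))) (f.hom.app (vtx x))) (R.familyG_naturality f)
  map_id N := GradedFamily.complexMap_eq_id _ _ _ _ fun x => R.dual.tensMap_id _ _
  map_comp f f' := GradedFamily.complexMap_comp _ _ _ _ _ _ _ fun x =>
    (PathIdeal.tensMap_comp _ _ _ _ _).trans (by rw [Category.id_comp]; rfl)

instance (R : PathIdeal k V) (X : HomologicalComplex₂ R.Mod (ComplexShape.up ℤ)
    (ComplexShape.up ℤ)) : X.HasTotal (ComplexShape.up ℤ) := fun _ => inferInstance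

/-- The complex Koszul functor `F^C : C(Mod Λ^!) ⥤ C(Mod Λ)`: apply `F` to every term of a complex
to obtain a double complex, and take its total complex. -/
def koszulFC (g : Grading V) (R : PathIdeal k V) :
    CochainComplex R.dual.Mod ℤ ⥤ CochainComplex R.Mod ℤ :=
  (koszulF g R).mapHomologicalComplex (ComplexShape.up ℤ) ⋙
    HomologicalComplex₂.totalFunctor R.Mod (ComplexShape.up ℤ) (ComplexShape.up ℤ)
      (ComplexShape.up ℤ)

end Koszul

end BoundQuiver

end

/-! Everything is checked one vertex `y` at a time. At `y`, the term of index `(i, j)` of the double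
complex `F(G(M)ⁱ)ʲ` is the direct sum of the spaces `e_yΛe_x ⊗ I^!_a(x) ⊗ M(a)` with `deg a = i` and
`deg x = -j`. A nonzero contribution needs a path of `Q` from `a` to `x` and one from `x` to `y`, so
`i ≤ -j ≤ deg y`. Hence nothing survives in positive total degree, the columns of index greater than
`deg y` vanish at `y`, and the column of index `deg y` has a single nonzero term there, in total
degree zero, which is a copy of `M(y)`.

The column of index `i` is a direct sum of copies of the complexes `F(I^!_a)`, one for each vertex
`a` of degree `i` and each element of a basis of `M(a)`. If `Λ` is Koszul, then `F(I^!_a)` resolves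
`S_a` up to a shift, so every column of index different from `deg y` is exact at `y`
(`IsKoszul.F_G_exact`). An element of the total complex meets finitely many columns, and its
leftmost components can be removed one after the other by boundaries (`exists_sub_d_mem_range`).
Every cycle is thus homologous to one in the column of index `deg y`, which the augmentation
identifies with `M(y)` (`doubleAug_bijective`).

The heart of the matter is that `F(I^!_a)` resolves `S_a`. Minimality and homogeneity of a linear
resolution force the generators of its term `P⁻ⁿ` into degree `deg a + n` (`deg_vertex`), and the
generators of the corresponding term of `F(I^!_a)` lie in the same degree. A morphism out of such a
module is a free choice of linear maps in that single degree (`FreeIn`). The two complexes are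
therefore isomorphic, by induction on `n`, as soon as their differentials have the same image and no
kernel in the degree of the generators (`FreeIn.exists_iso`). For `F(I^!_a)` this is a statement
about `Λ^!` alone: `e_aΛ^!e_x` is generated by the arrows that leave `x` in `Qᵒ` (`F_I_injective`),
subject to the quadratic dual relations (`F_I_exact`). Exactness at all other vertices is then
inherited from the given resolution (`IsKoszul.F_I_exact`). -/

noncomputable section

namespace BoundQuiver

/-! ### Modules vertex by vertex, and the projectives `P_x ⊗ W` -/

section Basics

variable {k : Type u} [Field k] {V : Type u} [Quiver.{u} V] (R : PathIdeal k V)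

namespace PathIdeal

/-- The functor `M ↦ M(y)` on the category of modules. -/
abbrev evalFunctor (y : V) : R.Mod ⥤ ModuleCat.{u} k := R.IsRep.ι ⋙ evalAt k y

variable {R}

lemma mapAt_comp {L M N : R.Mod} (f : L ⟶ M) (h : M ⟶ N) (y : V) :
    R.mapAt (f ≫ h) y = R.mapAt h y ∘ₗ R.mapAt f y := rfl

lemma mapAt_comp_apply {L M N : R.Mod} (f : L ⟶ M) (h : M ⟶ N) (y : V) (m : L.obj.obj (vtx y)) :
    R.mapAt (f ≫ h) y m = R.mapAt h y (R.mapAt f y m) := rfl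

@[simp] lemma mapAt_zero (M N : R.Mod) (y : V) : R.mapAt (0 : M ⟶ N) y = 0 := rfl

lemma mapAt_add {M N : R.Mod} (f h : M ⟶ N) (y : V) :
    R.mapAt (f + h) y = R.mapAt f y + R.mapAt h y := rfl

lemma mapAt_sum {ι : Type*} (s : Finset ι) {M N : R.Mod} (f : ι → (M ⟶ N)) (y : V) :
    R.mapAt (∑ i ∈ s, f i) y = ∑ i ∈ s, R.mapAt (f i) y := by
  classical
  induction s using Finset.induction_on with
  | empty => rfl
  | insert i s hi h => rw [Finset.sum_insert hi, Finset.sum_insert hi, mapAt_add, h]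

lemma mapAt_units_smul {M N : R.Mod} (e : ℤˣ) (f : M ⟶ N) (y : V) :
    R.mapAt (e • f) y = e • R.mapAt f y := by
  rcases Int.units_eq_one_or e with rfl | rfl
  · simp
  · simp only [Units.neg_smul, one_smul]; rfl

lemma mapAt_ext {M N : R.Mod} {f h : M ⟶ N} (e : ∀ y, R.mapAt f y = R.mapAt h y) : f = h :=
  ObjectProperty.hom_ext _ (NatTrans.ext (funext fun y => ModuleCat.hom_ext (e y)))

lemma mapAt_naturality {M N : R.Mod} (f : M ⟶ N) {x y : V} (p : Quiver.Path x y)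
    (m : M.obj.obj (vtx x)) :
    R.mapAt f y ((M.obj.map (pathHom p)).hom m) = (N.obj.map (pathHom p)).hom (R.mapAt f x m) :=
  LinearMap.congr_fun (congrArg ModuleCat.Hom.hom (f.hom.naturality (pathHom p))) m

/-- A morphism of modules from its components. -/
def homOfMapAt {M N : R.Mod} (f : ∀ y, M.obj.obj (vtx y) →ₗ[k] N.obj.obj (vtx y))
    (hf : ∀ {x y : V} (p : Quiver.Path x y) (m : M.obj.obj (vtx x)),
      f y ((M.obj.map (pathHom p)).hom m) = (N.obj.map (pathHom p)).hom (f x m)) : M ⟶ N :=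
  R.IsRep.homMk
    { app := fun y => ModuleCat.ofHom (f y)
      naturality := fun _ _ p => ModuleCat.hom_ext (LinearMap.ext fun m => hf p m) }

lemma mapAt_surjective_of_epi {M N : R.Mod} (f : M ⟶ N) [Epi f] (y : V) :
    Function.Surjective (R.mapAt f y) := by
  have : Epi ((R.evalFunctor y).map f) := inferInstance
  exact (ModuleCat.epi_iff_surjective _).1 this

lemma epi_of_mapAt_surjective {M N : R.Mod} (f : M ⟶ N)
    (hf : ∀ y, Function.Surjective (R.mapAt f y)) : Epi f where
  left_cancellation {L} a b h := mapAt_ext fun y => LinearMap.ext fun n => by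
    obtain ⟨m, rfl⟩ := hf y n
    exact LinearMap.congr_fun (congrArg (fun c => R.mapAt c y) h) m

lemma isZero_of_subsingleton {M : R.Mod} (h : ∀ y, Subsingleton (M.obj.obj (vtx y))) :
    IsZero M := by
  rw [IsZero.iff_id_eq_zero]
  exact mapAt_ext fun y => LinearMap.ext fun m => (h y).elim _ _

/-- In an abelian category, exactness means that the kernel inclusion followed by the cokernel
projection is zero. This vanishing can be tested on elements at each vertex. -/
lemma exact_of_mapAt (S : ShortComplex R.Mod)
    (h : ∀ y m, R.mapAt S.g y m = 0 → ∃ l, R.mapAt S.f y l = m) : S.Exact := by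
  rw [S.exact_iff_kernel_ι_comp_cokernel_π_zero]
  refine mapAt_ext fun y => LinearMap.ext fun m => ?_
  obtain ⟨l, hl⟩ := h y (R.mapAt (kernel.ι S.g) y m) (by
    rw [← mapAt_comp_apply, kernel.condition]; rfl)
  rw [mapAt_comp_apply, ← hl, ← mapAt_comp_apply, cokernel.condition]; rfl

/-- The values of a coproduct at a vertex are spanned by those of its summands. -/
lemma iSup_range_sigmaι {J : Type*} (T : J → R.Mod) [HasCoproduct T] (y : V)
    [PreservesColimit (Discrete.functor T) (R.evalFunctor y)] :
    ⨆ i, LinearMap.range (R.mapAt (Sigma.ι T i) y) = ⊤ := by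
  let U := ⨆ i, LinearMap.range (R.mapAt (Sigma.ι T i) y)
  have h : ModuleCat.ofHom U.mkQ = 0 := by
    refine (isColimitOfPreserves (R.evalFunctor y)
      (coproductIsCoproduct T)).hom_ext fun j => ?_
    refine ModuleCat.hom_ext (LinearMap.ext fun m => ?_)
    refine (Submodule.Quotient.mk_eq_zero U).2 ?_
    exact Submodule.mem_iSup_of_mem j.as ⟨m, rfl⟩
  refine U.ker_mkQ.symm.trans ?_
  exact LinearMap.ker_eq_top.2 (congrArg ModuleCat.Hom.hom h)

@[elab_as_elim]
lemma sigma_induction {J : Type*} {T : J → R.Mod} [HasCoproduct T] {y : V}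
    [PreservesColimit (Discrete.functor T) (R.evalFunctor y)]
    {p : ((∐ T : R.Mod).obj.obj (vtx y)) → Prop} (m : (∐ T : R.Mod).obj.obj (vtx y))
    (ι : ∀ i t, p (R.mapAt (Sigma.ι T i) y t)) (zero : p 0)
    (add : ∀ a b, p a → p b → p (a + b)) : p m := by
  have hm : m ∈ ⨆ i, LinearMap.range (R.mapAt (Sigma.ι T i) y) := by
    rw [iSup_range_sigmaι]; trivial
  refine Submodule.iSup_induction _ (motive := p) hm ?_ zero add
  rintro i _ ⟨t, rfl⟩
  exact ι i t

lemma biproduct_induction {n : ℕ} {T : Fin n → R.Mod} {y : V}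
    (m : (⨁ T : R.Mod).obj.obj (vtx y)) :
    m = ∑ i, R.mapAt (biproduct.ι T i) y (R.mapAt (biproduct.π T i) y m) := by
  have h := congrArg (fun f => R.mapAt f y m) (biproduct.total (f := T))
  simp only [mapAt_sum, LinearMap.sum_apply] at h
  exact h.symm

/-- The action `e_y Λ e_x × N(x) → N(y)`. -/
def act (N : R.Mod) (x y : V) : R.Alg x y →ₗ[k] N.obj.obj (vtx x) →ₗ[k] N.obj.obj (vtx y) :=
  Submodule.liftQ _ (evalPath N.obj x y) fun ρ hρ => N.property x y ρ hρ

@[simp] lemma act_mk_single (N : R.Mod) {x y : V} (p : Quiver.Path x y)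
    (m : N.obj.obj (vtx x)) :
    act N x y (Submodule.Quotient.mk (Finsupp.single p 1)) m = (N.obj.map (pathHom p)).hom m := by
  change evalPath N.obj x y (Finsupp.single p 1) m = _
  rw [evalPath_single, one_smul]

@[elab_as_elim]
lemma Alg.induction {x y : V} {p : R.Alg x y → Prop} (u : R.Alg x y)
    (single : ∀ q : Quiver.Path x y, p (Submodule.Quotient.mk (Finsupp.single q 1)))
    (zero : p 0) (add : ∀ a b, p a → p b → p (a + b)) (smul : ∀ (c : k) a, p a → p (c • a)) :
    p u := by
  obtain ⟨γ, rfl⟩ := Submodule.Quotient.mk_surjective _ u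
  induction γ using Finsupp.induction_linear with
  | zero => exact zero
  | add f g hf hg => exact add _ _ hf hg
  | single q c =>
    have : (Finsupp.single q c : PathSpace k x y) = c • Finsupp.single q 1 := by simp
    rw [this, Submodule.Quotient.mk_smul]
    exact smul c _ (single q)

lemma act_lmul (N : R.Mod) {x y z : V} (q : Quiver.Path y z) (u : R.Alg x y)
    (m : N.obj.obj (vtx x)) :
    act N x z (R.lmul q u) m = (N.obj.map (pathHom q)).hom (act N x y u m) := by
  induction u using Alg.induction with
  | single p =>
    simp only [lmul_mk, postcomp_single, act_mk_single]
    rw [pathHom_comp, N.obj.map_comp]; rfl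
  | zero => simp only [map_zero, LinearMap.zero_apply]
  | add a b ha hb => simp only [map_add, LinearMap.add_apply, ha, hb]
  | smul c a ha => simp only [map_smul, LinearMap.smul_apply, ha]

lemma act_rmul (N : R.Mod) {x y z : V} (q : Quiver.Path x y) (u : R.Alg y z)
    (m : N.obj.obj (vtx x)) :
    act N x z (R.rmul q u) m = act N y z u ((N.obj.map (pathHom q)).hom m) := by
  induction u using Alg.induction with
  | single p =>
    simp only [rmul_mk, precomp_single, act_mk_single]
    rw [pathHom_comp, N.obj.map_comp]; rfl
  | zero => simp only [map_zero, LinearMap.zero_apply]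
  | add a b ha hb => simp only [map_add, LinearMap.add_apply, ha, hb]
  | smul c a ha => simp only [map_smul, LinearMap.smul_apply, ha]

lemma mapAt_act {M N : R.Mod} (f : M ⟶ N) {x y : V} (u : R.Alg x y) (m : M.obj.obj (vtx x)) :
    R.mapAt f y (act M x y u m) = act N x y u (R.mapAt f x m) := by
  induction u using Alg.induction with
  | single p => simp only [act_mk_single, mapAt_naturality]
  | zero => simp only [map_zero, LinearMap.zero_apply]
  | add a b ha hb => simp only [map_add, LinearMap.add_apply, ha, hb]
  | smul c a ha => simp only [map_smul, LinearMap.smul_apply, ha]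

variable (R) in
/-- The class `e_x` of the trivial path. -/
def e (x : V) : R.Alg x x := Submodule.Quotient.mk (Finsupp.single .nil 1)

@[simp] lemma act_e (N : R.Mod) (x : V) (m : N.obj.obj (vtx x)) : act N x x (R.e x) m = m := by
  rw [e, act_mk_single, pathHom_nil, N.obj.map_id]; rfl

variable (R) in
/-- The class of a path. -/
abbrev cls {x y : V} (p : Quiver.Path x y) : R.Alg x y :=
  Submodule.Quotient.mk (Finsupp.single p 1)

lemma lmul_e {x y : V} (p : Quiver.Path x y) : R.lmul p (R.e x) = R.cls p := by
  simp [e]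

lemma rmul_e {x y : V} (p : Quiver.Path x y) : R.rmul p (R.e y) = R.cls p := by
  simp [e]

variable (R) in
/-- The elements of `P_x(y) = e_y Λ e_x`. -/
def pmk (x y : V) : R.Alg x y →ₗ[k] (R.P x).obj.obj (vtx y) := LinearMap.id

lemma pmk_surjective (x y : V) : Function.Surjective (R.pmk x y) := fun u => ⟨u, rfl⟩

lemma act_pmk_e {x y : V} (u : R.Alg x y) : act (R.P x) x y u (R.pmk x x (R.e x)) = R.pmk x y u := by
  induction u using Alg.induction with
  | single p => rw [act_mk_single]; exact lmul_e p
  | zero => simp only [map_zero, LinearMap.zero_apply]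
  | add a b ha hb => simp only [map_add, LinearMap.add_apply, ha, hb]
  | smul c a ha => simp only [map_smul, LinearMap.smul_apply, ha]

/-- The morphism `P_x ⟶ N` with `e_x ↦ n`. -/
def PLift (x : V) (N : R.Mod) (n : N.obj.obj (vtx x)) : R.P x ⟶ N :=
  homOfMapAt (M := R.P x) (fun y => (act N x y).flip n) fun p u => act_lmul N p u n

lemma mapAt_PLift {x : V} (N : R.Mod) (n : N.obj.obj (vtx x)) {y : V} (u : R.Alg x y) :
    R.mapAt (PLift x N n) y (R.pmk x y u) = act N x y u n := rfl

/-- The single element `e_x` generates `P_x`. -/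
lemma P_hom_ext {x : V} {N : R.Mod} {f h : R.P x ⟶ N}
    (e : R.mapAt f x (R.pmk x x (R.e x)) = R.mapAt h x (R.pmk x x (R.e x))) : f = h :=
  mapAt_ext fun y => LinearMap.ext fun u => by
    obtain ⟨u, rfl⟩ := R.pmk_surjective x y u
    rw [← act_pmk_e, mapAt_act, mapAt_act, e]

open scoped TensorProduct

variable (R) in
/-- The elements `m ⊗ w` of `(M ⊗ W)(y) = M(y) ⊗ W`. -/
def tmk (M : R.Mod) (W : ModuleCat.{u} k) (y : V) :
    M.obj.obj (vtx y) →ₗ[k] W →ₗ[k] (R.tens M W).obj.obj (vtx y) :=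
  TensorProduct.mk k (M.obj.obj (vtx y)) W

/-- The linear map out of `(M ⊗ W)(y)` induced by a bilinear map. -/
def tlift {M : R.Mod} {W : ModuleCat.{u} k} {y : V} {C : Type*} [AddCommGroup C] [Module k C]
    (B : M.obj.obj (vtx y) →ₗ[k] W →ₗ[k] C) : (R.tens M W).obj.obj (vtx y) →ₗ[k] C :=
  TensorProduct.lift B

@[elab_as_elim]
lemma tens_induction {M : R.Mod} {W : ModuleCat.{u} k} {y : V}
    {p : (R.tens M W).obj.obj (vtx y) → Prop} (t : (R.tens M W).obj.obj (vtx y))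
    (tmul : ∀ (m : M.obj.obj (vtx y)) (w : W), p (R.tmk M W y m w)) (zero : p 0)
    (add : ∀ a b, p a → p b → p (a + b)) : p t :=
  TensorProduct.induction_on (motive := p) t zero tmul add

lemma tens_map_tmk (M : R.Mod) (W : ModuleCat.{u} k) {y z : V} (p : Quiver.Path y z)
    (m : M.obj.obj (vtx y)) (w : W) :
    ((R.tens M W).obj.map (pathHom p)).hom (R.tmk M W y m w) =
      R.tmk M W z ((M.obj.map (pathHom p)).hom m) w := rfl

lemma act_tens (M : R.Mod) (W : ModuleCat.{u} k) {y z : V} (u : R.Alg y z)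
    (m : M.obj.obj (vtx y)) (w : W) :
    act (R.tens M W) y z u (R.tmk M W y m w) = R.tmk M W z (act M y z u m) w := by
  induction u using Alg.induction with
  | single p => rw [act_mk_single, act_mk_single, tens_map_tmk]
  | zero => simp only [map_zero, LinearMap.zero_apply]
  | add a b ha hb => simp only [map_add, LinearMap.add_apply, ha, hb]
  | smul c a ha => simp only [map_smul, LinearMap.smul_apply, ha]

/-- The morphism `P_x ⊗ W ⟶ N` with `e_x ⊗ w ↦ h w`. -/
def tensLift {x : V} {W : ModuleCat.{u} k} {N : R.Mod} (h : W →ₗ[k] N.obj.obj (vtx x)) :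
    R.tens (R.P x) W ⟶ N :=
  homOfMapAt (M := R.tens (R.P x) W)
    (fun y => tlift (M := R.P x) (W := W) (y := y) ((act N x y).compl₂ h))
    fun {y z} p m => by
      induction m using tens_induction with
      | tmul u w => exact act_lmul N p u (h w)
      | zero => simp only [map_zero]
      | add a b ha hb => simp only [map_add, ha, hb]

lemma mapAt_tensLift {x : V} {W : ModuleCat.{u} k} {N : R.Mod} (h : W →ₗ[k] N.obj.obj (vtx x))
    {y : V} (u : R.Alg x y) (w : W) :
    R.mapAt (tensLift h) y (R.tmk (R.P x) W y (R.pmk x y u) w) = act N x y u (h w) := rfl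

lemma tens_P_hom_ext {x : V} {W : ModuleCat.{u} k} {N : R.Mod} {f h : R.tens (R.P x) W ⟶ N}
    (e : ∀ w : W, R.mapAt f x (R.tmk (R.P x) W x (R.pmk x x (R.e x)) w) =
      R.mapAt h x (R.tmk (R.P x) W x (R.pmk x x (R.e x)) w)) : f = h :=
  mapAt_ext fun y => LinearMap.ext fun t => by
    induction t using tens_induction with
    | tmul u w =>
      obtain ⟨u, rfl⟩ := R.pmk_surjective x y u
      have := act_tens (R.P x) W u (R.pmk x x (R.e x)) w
      rw [act_pmk_e] at this
      rw [← this, mapAt_act, mapAt_act, e]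
    | zero => simp only [map_zero]
    | add a b ha hb => simp only [map_add, ha, hb]

/-- Morphisms from `P_x ⊗ W` to `N` are the linear maps `W → N(x)`, and these lift along surjections
because vector spaces are projective. -/
instance projective_tens_P (x : V) (W : ModuleCat.{u} k) : Projective (R.tens (R.P x) W) where
  factors {E X} f π _ := by
    let φ : W →ₗ[k] X.obj.obj (vtx x) :=
      R.mapAt f x ∘ₗ R.tmk (R.P x) W x (R.pmk x x (R.e x))
    obtain ⟨ψ, hψ⟩ := Module.projective_lifting_property (R.mapAt π x) φ
      (mapAt_surjective_of_epi π x)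
    refine ⟨tensLift ψ, tens_P_hom_ext fun w => ?_⟩
    rw [mapAt_comp_apply, mapAt_tensLift, act_e]
    exact LinearMap.congr_fun hψ w

end PathIdeal

end Basics

/-! ### Modules freely generated in a single degree -/

section Free

variable {k : Type u} [Field k] {V : Type u} [Quiver.{u} V] {R : PathIdeal k V} {g : Grading V}

/-- The grading makes the length of a path a function of its endpoints. All later vanishing
arguments and all identifications of short paths rest on this. -/
lemma Grading.deg_path (g : Grading V) {x y : V} (p : Quiver.Path x y) :
    g.deg y = g.deg x + p.length := by
  induction p with
  | nil => simp
  | cons p a ih => rw [g.deg_arrow a, ih, Quiver.Path.length_cons]; push_cast; ring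

namespace PathIdeal

lemma alg_subsingleton {x y : V} (h : IsEmpty (Quiver.Path x y)) : Subsingleton (R.Alg x y) :=
  ⟨fun u v => by
    obtain ⟨γ, rfl⟩ := Submodule.Quotient.mk_surjective _ u
    obtain ⟨δ, rfl⟩ := Submodule.Quotient.mk_surjective _ v
    rw [Subsingleton.elim γ δ]⟩

lemma isEmpty_path_of_deg_lt (g : Grading V) {x y : V} (h : g.deg y < g.deg x) :
    IsEmpty (Quiver.Path x y) :=
  ⟨fun p => by have := g.deg_path p; omega⟩

lemma isEmpty_path_of_deg_eq (g : Grading V) {x y : V} (h : g.deg y = g.deg x) (hne : x ≠ y) :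
    IsEmpty (Quiver.Path x y) :=
  ⟨fun p => hne (Quiver.Path.eq_of_length_zero p (by have := g.deg_path p; omega))⟩

lemma alg_eq_smul_e (g : Grading V) {x : V} (u : R.Alg x x) : ∃ c : k, u = c • R.e x := by
  induction u using Alg.induction with
  | single p =>
    have hp : p.length = 0 := by have := g.deg_path p; omega
    refine ⟨1, ?_⟩
    cases p with
    | nil => rw [one_smul]; rfl
    | cons p a => simp at hp
  | zero => exact ⟨0, (zero_smul _ _).symm⟩
  | add a b ha hb =>
    obtain ⟨c, rfl⟩ := ha
    obtain ⟨d, rfl⟩ := hb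
    exact ⟨c + d, (add_smul _ _ _).symm⟩
  | smul c a ha =>
    obtain ⟨d, rfl⟩ := ha
    exact ⟨c * d, (mul_smul _ _ _).symm⟩

/-- A module is free in degree `e` if it is freely generated by its values at the vertices of
degree `e`. -/
def FreeIn (g : Grading V) (e : ℤ) (Q : R.Mod) : Prop :=
  ∀ (N : R.Mod) (h : ∀ x, g.deg x = e → (Q.obj.obj (vtx x) →ₗ[k] N.obj.obj (vtx x))),
    ∃! φ : Q ⟶ N, ∀ x hx, R.mapAt φ x = h x hx

lemma FreeIn.hom_ext {e : ℤ} {Q N : R.Mod} (hQ : FreeIn g e Q) {φ ψ : Q ⟶ N}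
    (h : ∀ x, g.deg x = e → R.mapAt φ x = R.mapAt ψ x) : φ = ψ :=
  (hQ N fun x _ => R.mapAt ψ x).unique h fun _ _ => rfl

/-- Among the vertices of the degree of `x`, only `x` itself carries a nonzero value of `P_x`,
namely the line through `e_x`. Prescribing linear maps in that degree thus amounts to prescribing
the image of `e_x`. -/
lemma freeIn_P {e : ℤ} {x : V} (hx : g.deg x = e) : FreeIn g e (R.P x) := fun N h => by
  refine ⟨PLift x N (h x hx (R.pmk x x (R.e x))), fun z hz => ?_, fun φ hφ => ?_⟩
  · refine LinearMap.ext fun u => ?_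
    obtain ⟨u, rfl⟩ := R.pmk_surjective x z u
    rw [mapAt_PLift]
    by_cases hxz : x = z
    · subst hxz
      obtain ⟨c, rfl⟩ := alg_eq_smul_e g u
      simp only [map_smul, LinearMap.smul_apply, act_e]
    · have := alg_subsingleton (R := R) (isEmpty_path_of_deg_eq g (hz.trans hx.symm) hxz)
      rw [Subsingleton.elim u 0]
      simp only [map_zero, LinearMap.zero_apply]
  · refine P_hom_ext ?_
    rw [mapAt_PLift, act_e, hφ x hx]

lemma freeIn_tens_P {e : ℤ} {x : V} (hx : g.deg x = e) (W : ModuleCat.{u} k) :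
    FreeIn g e (R.tens (R.P x) W) := fun N h => by
  refine ⟨tensLift (h x hx ∘ₗ R.tmk (R.P x) W x (R.pmk x x (R.e x))), fun z hz => ?_,
    fun φ hφ => ?_⟩
  · refine LinearMap.ext fun t => ?_
    induction t using tens_induction with
    | tmul u w =>
      obtain ⟨u, rfl⟩ := R.pmk_surjective x z u
      rw [mapAt_tensLift]
      by_cases hxz : x = z
      · subst hxz
        obtain ⟨c, rfl⟩ := alg_eq_smul_e g u
        simp only [map_smul, LinearMap.smul_apply, act_e, LinearMap.comp_apply]
      · have := alg_subsingleton (R := R) (isEmpty_path_of_deg_eq g (hz.trans hx.symm) hxz)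
        rw [Subsingleton.elim u 0]
        simp only [map_zero, LinearMap.zero_apply]
    | zero => simp only [map_zero]
    | add a b ha hb => simp only [map_add, ha, hb]
  · refine tens_P_hom_ext fun w => ?_
    rw [mapAt_tensLift, act_e, hφ x hx]
    rfl

/-- The universal property is split into existence of a descent and joint surjectivity of the
inclusions, so that one argument covers both arbitrary coproducts and finite biproducts. -/
lemma freeIn_of_generators {e : ℤ} {J : Type*} {T : J → R.Mod} {Q : R.Mod} (ι : ∀ i, T i ⟶ Q)
    (desc : ∀ (N : R.Mod) (f : ∀ i, T i ⟶ N), ∃ φ : Q ⟶ N, ∀ i, ι i ≫ φ = f i)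
    (span : ∀ y, ⨆ i, LinearMap.range (R.mapAt (ι i) y) = ⊤) (hT : ∀ i, FreeIn g e (T i)) :
    FreeIn g e Q := fun N h => by
  have ext : ∀ (y : V) {f f' : Q.obj.obj (vtx y) →ₗ[k] N.obj.obj (vtx y)},
      (∀ i, f ∘ₗ R.mapAt (ι i) y = f' ∘ₗ R.mapAt (ι i) y) → f = f' := fun y f f' hf => by
    refine LinearMap.ext_on_range (v := fun m : Σ i, (T i).obj.obj (vtx y) =>
      R.mapAt (ι m.1) y m.2) ?_ fun m => LinearMap.congr_fun (hf m.1) m.2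
    rw [eq_top_iff, ← span y, iSup_le_iff]
    rintro i _ ⟨m, rfl⟩
    exact Submodule.subset_span ⟨⟨i, m⟩, rfl⟩
  choose f hf _ using fun i => hT i N fun x hx => h x hx ∘ₗ R.mapAt (ι i) x
  obtain ⟨φ, hφ⟩ := desc N f
  refine ⟨φ, fun x hx => ext x fun i => ?_, fun ψ hψ => mapAt_ext fun y => ext y fun i => ?_⟩
  · rw [← mapAt_comp, hφ, hf i x hx]
  · rw [← mapAt_comp, ← mapAt_comp]
    congr 1
    refine (hT i).hom_ext fun x hx => ?_
    rw [mapAt_comp, hψ x hx, hφ, hf i x hx]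

lemma freeIn_sigma {e : ℤ} {J : Type u} {T : J → R.Mod} (hT : ∀ i, FreeIn g e (T i)) :
    FreeIn g e (∐ T) :=
  freeIn_of_generators (Sigma.ι T) (fun _ f => ⟨Sigma.desc f, fun i => Sigma.ι_desc f i⟩)
    (fun y => iSup_range_sigmaι T y) hT

lemma freeIn_biproduct {e : ℤ} {n : ℕ} {T : Fin n → R.Mod} (hT : ∀ i, FreeIn g e (T i)) :
    FreeIn g e (⨁ T) :=
  freeIn_of_generators (biproduct.ι T)
    (fun _ f => ⟨biproduct.desc f, fun i => biproduct.ι_desc f i⟩)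
    (fun y => eq_top_iff.2 fun m _ => by
      rw [biproduct_induction m]
      exact Submodule.sum_mem _ fun i _ => Submodule.mem_iSup_of_mem i ⟨_, rfl⟩) hT

/-- Two covers which are free in degree `e` are isomorphic if they have the same image in degree
`e` and are injective there. -/
lemma FreeIn.exists_iso {e : ℤ} {Q Q' B B' : R.Mod} (hQ : FreeIn g e Q) (hQ' : FreeIn g e Q')
    (f : Q ⟶ B) (f' : Q' ⟶ B') (β : B ≅ B')
    (hf : ∀ x, g.deg x = e → Function.Injective (R.mapAt f x))
    (hf' : ∀ x, g.deg x = e → Function.Injective (R.mapAt f' x))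
    (hr : ∀ x, g.deg x = e → ∀ b, b ∈ LinearMap.range (R.mapAt f x) ↔
      R.mapAt β.hom x b ∈ LinearMap.range (R.mapAt f' x)) :
    ∃ γ : Q ≅ Q', γ.hom ≫ f' = f ≫ β.hom := by
  have hβ : ∀ x b, R.mapAt β.hom x (R.mapAt β.inv x b) = b := fun x b => by
    rw [← mapAt_comp_apply, β.inv_hom_id]; rfl
  have hβ' : ∀ x b, R.mapAt β.inv x (R.mapAt β.hom x b) = b := fun x b => by
    rw [← mapAt_comp_apply, β.hom_inv_id]; rfl
  -- In degree `e` the map `f'` is an isomorphism onto its image, and this image contains `β ∘ f`.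
  -- Composing with the inverse gives the only possible value of the comparison map.
  have lift : ∀ x (hx : g.deg x = e), ∃ s : Q.obj.obj (vtx x) →ₗ[k] Q'.obj.obj (vtx x),
      R.mapAt f' x ∘ₗ s = R.mapAt β.hom x ∘ₗ R.mapAt f x := fun x hx => by
    refine ⟨(LinearEquiv.ofInjective _ (hf' x hx)).symm.toLinearMap ∘ₗ
      LinearMap.codRestrict _ (R.mapAt β.hom x ∘ₗ R.mapAt f x) fun m =>
        (hr x hx _).1 ⟨m, rfl⟩, LinearMap.ext fun m => ?_⟩
    exact congrArg Subtype.val ((LinearEquiv.ofInjective _ (hf' x hx)).apply_symm_apply _)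
  have lift' : ∀ x (hx : g.deg x = e), ∃ s : Q'.obj.obj (vtx x) →ₗ[k] Q.obj.obj (vtx x),
      R.mapAt f x ∘ₗ s = R.mapAt β.inv x ∘ₗ R.mapAt f' x := fun x hx => by
    refine ⟨(LinearEquiv.ofInjective _ (hf x hx)).symm.toLinearMap ∘ₗ
      LinearMap.codRestrict _ (R.mapAt β.inv x ∘ₗ R.mapAt f' x) fun m =>
        (hr x hx _).2 ⟨m, (hβ x _).symm⟩, LinearMap.ext fun m => ?_⟩
    exact congrArg Subtype.val ((LinearEquiv.ofInjective _ (hf x hx)).apply_symm_apply _)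
  choose s hs using lift
  choose s' hs' using lift'
  obtain ⟨γ, hγ, -⟩ := hQ Q' s
  obtain ⟨γ', hγ', -⟩ := hQ' Q s'
  refine ⟨⟨γ, γ', hQ.hom_ext fun x hx => LinearMap.ext fun m => hf x hx ?_,
    hQ'.hom_ext fun x hx => LinearMap.ext fun m => hf' x hx ?_⟩, hQ.hom_ext fun x hx => ?_⟩
  · have h1 := LinearMap.congr_fun (hs x hx) m
    have h2 := LinearMap.congr_fun (hs' x hx) (s x hx m)
    simp only [LinearMap.comp_apply] at h1 h2
    rw [mapAt_comp, hγ x hx, hγ' x hx, LinearMap.comp_apply, h2, h1, hβ']; rfl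
  · have h1 := LinearMap.congr_fun (hs x hx) (s' x hx m)
    have h2 := LinearMap.congr_fun (hs' x hx) m
    simp only [LinearMap.comp_apply] at h1 h2
    rw [mapAt_comp, hγ x hx, hγ' x hx, LinearMap.comp_apply, h1, h2, hβ]; rfl
  · rw [mapAt_comp, hγ x hx, hs x hx]; rfl

end PathIdeal

end Free

/-! ### Linear resolutions: degrees of the generators and injectivity on them -/

section Resolution

variable {k : Type u} [Field k] {V : Type u} [Quiver.{u} V] {R : PathIdeal k V} {g : Grading V}

namespace PathIdeal

/-- Composition with a path never shortens paths, so vanishing of all coefficients below a given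
length is preserved. -/
lemma mapDomain_apply_eq_zero {α β : Type*} {f : α → β} {ℓ : α → ℕ} {ℓ' : β → ℕ}
    (hf : ∀ p, ℓ p ≤ ℓ' (f p)) {n : ℕ} {γ : α →₀ k} (h : ∀ p, ℓ p < n → γ p = 0) (r : β)
    (hr : ℓ' r < n) : Finsupp.mapDomain f γ r = 0 := by
  classical
  by_contra hne
  obtain ⟨p, hp, rfl⟩ := Finset.mem_image.1
    (Finsupp.mapDomain_support (Finsupp.mem_support_iff.2 hne))
  exact Finsupp.mem_support_iff.1 hp (h p ((hf p).trans_lt hr))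

/-- The generators of the ideal have degree at least two. Trivial paths and arrows therefore stay
linearly independent in the quotient, which is what makes `coeff` well defined. -/
lemma IsHomogeneous.apply_eq_zero (hR : R.IsHomogeneous) {x y : V} {γ : PathSpace k x y}
    (hγ : γ ∈ R.carrier x y) {p : Quiver.Path x y} (hp : p.length < 2) : γ p = 0 := by
  obtain ⟨S, hS, rfl⟩ := hR
  suffices h : ∀ γ ∈ (PathIdeal.span S).carrier x y, ∀ p, p.length < 2 → γ p = 0 from h γ hγ p hp
  intro γ hγ
  refine Submodule.span_induction ?_ (fun _ _ => rfl) (fun a b _ _ ha hb p hp => ?_)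
    (fun c a _ ha p hp => ?_) hγ
  · rintro _ ⟨a, b, p, q, ρ, hρ, rfl⟩
    obtain ⟨n, hn, hρn⟩ := hS a b ρ hρ
    have h1 : ∀ r : Quiver.Path a b, r.length < 2 → ρ r = 0 := fun r hr => by
      by_contra hne
      have : r.length = n := hρn (Finsupp.mem_support_iff.2 hne)
      omega
    exact mapDomain_apply_eq_zero (ℓ := Quiver.Path.length) (ℓ' := Quiver.Path.length)
      (fun (r : Quiver.Path _ _) => by simp)
      (mapDomain_apply_eq_zero (ℓ := Quiver.Path.length) (ℓ' := Quiver.Path.length)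
        (fun (r : Quiver.Path _ _) => by simp) h1)
  · rw [Finsupp.add_apply, ha p hp, hb p hp, add_zero]
  · rw [Finsupp.smul_apply, ha p hp, smul_zero]

/-- The coefficient of a path of length at most one, as a linear form on `e_y Λ e_x`. -/
def IsHomogeneous.coeff (hR : R.IsHomogeneous) {x y : V} (p : Quiver.Path x y)
    (hp : p.length < 2) : R.Alg x y →ₗ[k] k :=
  Submodule.liftQ _ (Finsupp.lapply p) fun _ hγ => hR.apply_eq_zero hγ hp

@[simp] lemma IsHomogeneous.coeff_mk (hR : R.IsHomogeneous) {x y : V} (p : Quiver.Path x y)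
    (hp : p.length < 2) (γ : PathSpace k x y) :
    hR.coeff p hp (Submodule.Quotient.mk γ) = γ p := rfl

lemma IsHomogeneous.e_ne_zero (hR : R.IsHomogeneous) (x : V) : R.e x ≠ 0 := fun h => by
  have h0 : (Quiver.Path.nil : Quiver.Path x x).length < 2 := Nat.zero_lt_two
  have := congrArg (hR.coeff .nil h0) h
  rw [e, hR.coeff_mk, map_zero] at this
  simp at this

lemma mapAt_mem_radical {M N : R.Mod} (f : M ⟶ N) {y : V} {m : M.obj.obj (vtx y)}
    (hm : m ∈ R.radical M y) : R.mapAt f y m ∈ R.radical N y := by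
  suffices R.radical M y ≤ (R.radical N y).comap (R.mapAt f y) from this hm
  refine iSup_le fun p => ?_
  rintro _ ⟨l, rfl⟩
  refine Submodule.mem_comap.2 ?_
  rw [mapAt_naturality]
  exact Submodule.mem_iSup_of_mem (p := fun p : (Σ z : V, z ⟶ y) =>
    LinearMap.range (N.obj.map (pathHom p.2.toPath)).hom) p ⟨_, rfl⟩

lemma radical_eq_bot {M : R.Mod} {y : V}
    (h : ∀ z : V, (z ⟶ y) → Subsingleton (M.obj.obj (vtx z))) : R.radical M y = ⊥ := by
  refine eq_bot_iff.2 (iSup_le fun p => ?_)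
  rintro _ ⟨l, rfl⟩
  have := h p.1 p.2
  rw [Subsingleton.elim l 0, map_zero]
  exact Submodule.zero_mem _

lemma P_subsingleton {x y : V} (h : IsEmpty (Quiver.Path x y)) :
    Subsingleton ((R.P x).obj.obj (vtx y)) := alg_subsingleton h

lemma radical_P_self (g : Grading V) (x : V) : R.radical (R.P x) x = ⊥ :=
  radical_eq_bot fun z a => P_subsingleton
    (isEmpty_path_of_deg_lt g (by have := g.deg_arrow a; omega))

lemma biproduct_subsingleton {n : ℕ} {T : Fin n → R.Mod} {y : V}
    (h : ∀ i, Subsingleton ((T i).obj.obj (vtx y))) :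
    Subsingleton ((⨁ T : R.Mod).obj.obj (vtx y)) :=
  subsingleton_of_forall_eq 0 fun m => by
    rw [biproduct_induction m]
    exact Finset.sum_eq_zero fun i _ => by
      rw [Subsingleton.elim (R.mapAt (biproduct.π T i) y m) 0, map_zero]

/-- Every path from `a` to `y ≠ a` ends with an arrow, so all of `P_a(y)` lies in the radical. -/
lemma S_subsingleton_of_ne {a y : V} (h : a ≠ y) :
    Subsingleton ((R.S a).obj.obj (vtx y)) := by
  have htop : R.radical (R.P a) y = ⊤ := by
    refine Submodule.eq_top_iff'.2 fun u => ?_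
    obtain ⟨u, rfl⟩ := R.pmk_surjective a y u
    induction u using Alg.induction with
    | single p =>
      cases p with
      | nil => exact absurd rfl h
      | @cons z _ q b =>
        refine Submodule.mem_iSup_of_mem (p := fun p : (Σ z : V, z ⟶ y) =>
          LinearMap.range ((R.P a).obj.map (pathHom p.2.toPath)).hom) ⟨z, b⟩
          ⟨R.pmk a z (R.cls q), ?_⟩
        exact (R.lmul_mk b.toPath _).trans
          (congrArg (Submodule.Quotient.mk (p := R.carrier a y)) (postcomp_single _ _ _))
    | zero => rw [map_zero]; exact Submodule.zero_mem _
    | add a b ha hb => rw [map_add]; exact Submodule.add_mem _ ha hb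
    | smul c a ha => rw [map_smul]; exact Submodule.smul_mem _ c ha
  exact (Submodule.unique_quotient_iff_eq_top.2 htop).elim fun h => @Unique.instSubsingleton _ h

namespace LinearResolution

variable {a : V} (L : R.LinearResolution a)

/-- The term `P⁻ⁿ`. -/
abbrev term (n : ℕ) : R.Mod := ⨁ fun i => R.P (L.vertex n i)

/-- The generators of the term `P⁻ⁿ`. -/
def gen (n : ℕ) (i : Fin (L.rank n)) : (L.term n).obj.obj (vtx (L.vertex n i)) :=
  R.mapAt (biproduct.ι (fun i => R.P (L.vertex n i)) i) _ (R.pmk _ _ (R.e _))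

/-- Projecting to the summand `P_x` would place the nonzero element `e_x` in the radical of `P_x` at
`x`; this radical is zero, since no path from `x` reaches a predecessor of `x`. -/
lemma gen_notMem_radical (g : Grading V) (hR : R.IsHomogeneous) (n : ℕ) (i : Fin (L.rank n)) :
    L.gen n i ∉ R.radical (L.term n) (L.vertex n i) := fun h => by
  have h1 := mapAt_mem_radical (biproduct.π (fun i => R.P (L.vertex n i)) i) h
  rw [radical_P_self g, Submodule.mem_bot, gen, ← mapAt_comp_apply, biproduct.ι_π_self] at h1
  exact hR.e_ne_zero _ h1

/-- Minimality forbids a generator to lie in the kernel of the next map. At the start this forces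
the vertex to be `a`, the only place where `S_a` is nonzero. Later, the nonzero image of a generator
is, by homogeneity, a combination of arrows, so the degree goes up by exactly one. -/
lemma deg_vertex (hR : R.IsHomogeneous) (g : Grading V) (n : ℕ) (i : Fin (L.rank n)) :
    g.deg (L.vertex n i) = g.deg a + n := by
  induction n with
  | zero =>
    have h : a = L.vertex 0 i := by
      by_contra hne
      have := S_subsingleton_of_ne (R := R) hne
      exact L.gen_notMem_radical g hR 0 i (L.ker_aug_le _ (Subsingleton.elim _ _))
    rw [← h]; simp
  | succ n ih =>
    have h : R.mapAt (L.d n) _ (L.gen (n + 1) i) ≠ 0 := fun h =>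
      L.gen_notMem_radical g hR (n + 1) i (L.ker_d_le n _ h)
    rw [biproduct_induction (R.mapAt (L.d n) _ (L.gen (n + 1) i))] at h
    obtain ⟨j, -, hj⟩ := Finset.exists_ne_zero_of_sum_ne_zero h
    have hj' := fun h0 => hj ((congrArg (R.mapAt (biproduct.ι
      (fun i => R.P (L.vertex n i)) j) (L.vertex (n + 1) i)) h0).trans (map_zero _))
    -- The generator has internal degree `0`, so each component of its image comes from a
    -- combination of paths of length `0 + 1`. Any path in the support of a nonzero one gives the
    -- degree shift.
    obtain ⟨γ, hγ, hγ'⟩ : ∃ γ ∈ homogeneous k (0 + 1) (L.vertex n j) (L.vertex (n + 1) i),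
        R.pmk _ _ (Submodule.Quotient.mk γ) =
          R.mapAt (biproduct.π (fun i => R.P (L.vertex n i)) j) (L.vertex (n + 1) i)
            (R.mapAt (L.d n) _ (L.gen (n + 1) i)) :=
      L.homogeneous_d n i j 0 (L.vertex (n + 1) i) (R.e _)
        (Submodule.mem_map_of_mem (Finsupp.single_mem_supported k 1 rfl))
    have hγ0 : γ ≠ 0 := fun h0 => hj' (by
      rw [← hγ', h0, Submodule.Quotient.mk_zero, map_zero])
    obtain ⟨p, hp⟩ := Finsupp.support_nonempty_iff.2 hγ0
    have hp1 : p.length = 0 + 1 := hγ hp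
    rw [g.deg_path p, ih j, hp1]; push_cast; ring

lemma freeIn_term (hR : R.IsHomogeneous) (g : Grading V) (n : ℕ) :
    FreeIn g (g.deg a + n) (L.term n) :=
  freeIn_biproduct fun i => freeIn_P (L.deg_vertex hR g n i)

lemma radical_term (hR : R.IsHomogeneous) (g : Grading V) (n : ℕ) {y : V}
    (hy : g.deg y = g.deg a + n) : R.radical (L.term n) y = ⊥ :=
  radical_eq_bot fun z b => biproduct_subsingleton fun i => P_subsingleton
    (isEmpty_path_of_deg_lt g (by
      have := g.deg_arrow b; rw [L.deg_vertex hR g n i]; omega))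

/-- The kernel lies in the radical, and the radical of a term vanishes in the degree of its
generators. -/
lemma injective_d (hR : R.IsHomogeneous) (g : Grading V) (n : ℕ) {y : V}
    (hy : g.deg y = g.deg a + (n + 1 : ℕ)) : Function.Injective (R.mapAt (L.d n) y) := by
  rw [← LinearMap.ker_eq_bot, eq_bot_iff, ← L.radical_term hR g (n + 1) hy]
  exact L.ker_d_le n y

lemma injective_aug (hR : R.IsHomogeneous) (g : Grading V) {y : V}
    (hy : g.deg y = g.deg a) : Function.Injective (R.mapAt L.aug y) := by
  rw [← LinearMap.ker_eq_bot, eq_bot_iff, ← L.radical_term hR g 0 (by simpa using hy)]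
  exact L.ker_aug_le y

end LinearResolution

end PathIdeal

end Resolution

/-! ### Elements and projections for the complex of a graded family -/

namespace GradedFamily

section Projections

variable {W : Type u} [Quiver.{u} W] [LocallyFinite W] {𝒞 : Type (u + 1)} [Category.{u} 𝒞]
  [Preadditive 𝒞] [HasCoproducts.{u} 𝒞] (D : GradedFamily W 𝒞) (g : Grading W)

open Classical in
/-- The projection of the direct sum of degree `n` onto `T x`. -/
def π (n : ℤ) (x : W) : D.X g n ⟶ D.T x :=
  Sigma.desc fun z => if h : z.1 = x then eqToHom (by rw [h]) else 0

lemma ι_π_self {n : ℤ} {x : W} (hx : g.deg x = n) : D.ι g n x ≫ D.π g n x = 𝟙 _ := by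
  have h := D.ι_of_eq g ⟨x, hx⟩
  dsimp only at h
  rw [h]
  refine (Sigma.ι_desc _ _).trans ?_
  rw [dif_pos rfl, eqToHom_refl]

lemma ι_π_of_ne {n : ℤ} {x z : W} (h : z ≠ x) : D.ι g n z ≫ D.π g n x = 0 := by
  by_cases hz : g.deg z = n
  · have h' := D.ι_of_eq g ⟨z, hz⟩
    dsimp only at h'
    rw [h']
    refine (Sigma.ι_desc _ _).trans ?_
    rw [dif_neg h]
  · rw [ι_of_ne _ _ hz, zero_comp]

instance fintype_hom (x z : W) : Fintype (x ⟶ z) :=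
  @Fintype.ofFinite _ (Finite.of_injective (fun a => (⟨z, a⟩ : Σ y : W, x ⟶ y))
    fun a b h => by cases h; rfl)

/-- Several parallel arrows may join `x` to `z`, so a matrix entry of the differential is a sum over
all of them. -/
lemma ι_d_π {i j : ℤ} {x z : W} (hx : g.deg x = i) (hz : g.deg z = j) :
    D.ι g i x ≫ D.d g i j ≫ D.π g j z = ∑ a : x ⟶ z, D.τ a := by
  rw [← Category.assoc, D.ι_d g j hx, Preadditive.sum_comp]
  symm
  refine Fintype.sum_of_injective (fun a : x ⟶ z => (⟨z, a⟩ : Σ y : W, x ⟶ y))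
    (fun a b h => by cases h; rfl) _ _ (fun p hp => ?_) fun a => ?_
  · have hne : p.1 ≠ z := by
      rintro rfl
      exact hp ⟨p.2, rfl⟩
    rw [Category.assoc, ι_π_of_ne _ _ hne, comp_zero]
  · rw [Category.assoc, ι_π_self _ _ hz, Category.comp_id]

end Projections

section Modules

variable {k : Type u} [Field k] {V : Type u} [Quiver.{u} V] {R : PathIdeal k V}
  {W : Type u} [Quiver.{u} W] [LocallyFinite W] (D : GradedFamily W R.Mod) (g : Grading W)

lemma X_induction {n : ℤ} {y : V} {p : (D.X g n).obj.obj (vtx y) → Prop}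
    (m : (D.X g n).obj.obj (vtx y))
    (ι : ∀ x, g.deg x = n → ∀ t, p (R.mapAt (D.ι g n x) y t)) (zero : p 0)
    (add : ∀ a b, p a → p b → p (a + b)) : p m := by
  refine PathIdeal.sigma_induction (T := fun x : {x : W // g.deg x = n} => D.T x) (p := p) m
    (fun x t => ?_) zero add
  rw [← D.ι_of_eq g x]
  exact ι x x.2 t

lemma mapAt_d_ι {i : ℤ} (j : ℤ) {x : W} (hx : g.deg x = i) {y : V}
    (t : (D.T x).obj.obj (vtx y)) :
    R.mapAt (D.d g i j) y (R.mapAt (D.ι g i x) y t) =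
      ∑ p : Σ z : W, x ⟶ z, R.mapAt (D.ι g j p.1) y (R.mapAt (D.τ p.2) y t) := by
  have h := congrArg (fun f => R.mapAt f y t) (D.ι_d g j hx)
  simp only [PathIdeal.mapAt_sum, LinearMap.sum_apply] at h
  exact h

lemma mapAt_π_d_ι {i j : ℤ} {x z : W} (hx : g.deg x = i) (hz : g.deg z = j) {y : V}
    (t : (D.T x).obj.obj (vtx y)) :
    R.mapAt (D.π g j z) y (R.mapAt (D.d g i j) y (R.mapAt (D.ι g i x) y t)) =
      ∑ a : x ⟶ z, R.mapAt (D.τ a) y t := by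
  have h := congrArg (fun f => R.mapAt f y t) (D.ι_d_π g hx hz)
  simp only [PathIdeal.mapAt_sum, LinearMap.sum_apply] at h
  exact h

lemma mapAt_π_ι_self {n : ℤ} {x : W} (hx : g.deg x = n) {y : V}
    (t : (D.T x).obj.obj (vtx y)) :
    R.mapAt (D.π g n x) y (R.mapAt (D.ι g n x) y t) = t := by
  rw [← PathIdeal.mapAt_comp_apply, ι_π_self _ _ hx]; rfl

lemma mapAt_π_ι_of_ne {n : ℤ} {x z : W} (h : z ≠ x) {y : V}
    (t : (D.T z).obj.obj (vtx y)) :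
    R.mapAt (D.π g n x) y (R.mapAt (D.ι g n z) y t) = 0 := by
  rw [← PathIdeal.mapAt_comp_apply, ι_π_of_ne _ _ h]; rfl

end Modules

end GradedFamily

/-! ### Elements of the injectives and of the complexes `F(N)` -/

section Injectives

variable {k : Type u} [Field k] {V : Type u} [Quiver.{u} V] {R : PathIdeal k V}

namespace PathIdeal

variable (R) in
/-- The elements `f` of `I_a(x) = Hom(e_a Λ e_x, k)`. -/
def imk (a x : V) : Module.Dual k (R.Alg x a) →ₗ[k] (R.I a).obj.obj (vtx x) := LinearMap.id

lemma imk_surjective (a x : V) : Function.Surjective (R.imk a x) := fun u => ⟨u, rfl⟩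

lemma I_map_imk (a : V) {x y : V} (p : Quiver.Path x y) (f : Module.Dual k (R.Alg x a)) :
    ((R.I a).obj.map (pathHom p)).hom (R.imk a x f) = R.imk a y (f ∘ₗ R.rmul p) := rfl

end PathIdeal

end Injectives

section Koszul

variable {k : Type u} [Field k] {V : Type u} [Quiver.{u} V] [LocallyFinite V]
  {R : PathIdeal k V} (g : Grading V)

namespace PathIdeal

/-- The element `u ⊗ m` of the summand `P_x ⊗ N(x)` of `F(N)ⁿ`. -/
def fgen (N : R.dual.Mod) (n : ℤ) (x : Vᵒᵖ) (y : V) :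
    R.Alg x.unop y →ₗ[k] N.obj.obj (vtx x) →ₗ[k]
      (((koszulF g R).obj N).X n).obj.obj (vtx y) :=
  ((R.tmk (R.P x.unop) (N.obj.obj (vtx x)) y).compr₂
    (R.mapAt ((R.familyF N).ι g.op n x) y)) ∘ₗ R.pmk x.unop y

lemma F_induction {N : R.dual.Mod} {n : ℤ} {y : V}
    {p : (((koszulF g R).obj N).X n).obj.obj (vtx y) → Prop}
    (c : (((koszulF g R).obj N).X n).obj.obj (vtx y))
    (gen : ∀ x, g.op.deg x = n → ∀ q m, p (fgen g N n x y (R.cls q) m)) (zero : p 0)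
    (add : ∀ a b, p a → p b → p (a + b)) : p c := by
  refine (R.familyF N).X_induction g.op (p := p) c (fun x hx t => ?_) zero add
  let φ : (R.tens (R.P x.unop) (N.obj.obj (vtx x))).obj.obj (vtx y) →ₗ[k]
      (((koszulF g R).obj N).X n).obj.obj (vtx y) := R.mapAt ((R.familyF N).ι g.op n x) y
  suffices h : ∀ t, p (φ t) from h t
  intro t
  induction t using tens_induction with
  | tmul u m =>
    obtain ⟨u, rfl⟩ := R.pmk_surjective _ _ u
    change p (fgen g N n x y u m)
    induction u using Alg.induction generalizing m with
    | single q => exact gen x hx q m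
    | zero => rw [map_zero]; exact zero
    | add a b ha hb => rw [map_add]; exact add _ _ (ha m) (hb m)
    | smul c a ha =>
      -- The scalar moves from the path to the element of `N`, so the induction principle needs no
      -- closure under scalars.
      rw [map_smul, LinearMap.smul_apply, ← map_smul]
      exact ha _
  | zero => rw [map_zero]; exact zero
  | add a b ha hb => rw [map_add]; exact add _ _ ha hb

lemma F_d_fgen (N : R.dual.Mod) {n : ℤ} (n' : ℤ) {x : Vᵒᵖ} (hx : g.op.deg x = n) {y : V}
    (u : R.Alg x.unop y) (m : N.obj.obj (vtx x)) :
    R.mapAt (((koszulF g R).obj N).d n n') y (fgen g N n x y u m) =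
      ∑ p : Σ z : Vᵒᵖ, x ⟶ z, fgen g N n' p.1 y (R.rmul p.2.unop.toPath u)
        ((N.obj.map (pathHom p.2.toPath)).hom m) :=
  (R.familyF N).mapAt_d_ι g.op n' hx _

lemma F_map_fgen {N N' : R.dual.Mod} (f : N ⟶ N') (n : ℤ) (x : Vᵒᵖ) {y : V}
    (u : R.Alg x.unop y) (m : N.obj.obj (vtx x)) :
    R.mapAt (((koszulF g R).map f).f n) y (fgen g N n x y u m) =
      fgen g N' n x y u (R.dual.mapAt f x m) := by
  have h := congrArg (fun f => R.mapAt f y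
    (R.tmk (R.P x.unop) (N.obj.obj (vtx x)) y (R.pmk x.unop y u) m))
    (GradedFamily.ι_mapX g.op (D := R.familyF N) (D' := R.familyF N')
      (fun x => R.tensMap (𝟙 (R.P x.unop)) (f.hom.app (vtx x))) n x)
  exact h

/-- The projection of `F(N)ⁿ` onto its summand `P_x ⊗ N(x)`, composed with the map induced by a
bilinear map. -/
def fproj (N : R.dual.Mod) (n : ℤ) (x : Vᵒᵖ) (y : V) {C : Type*} [AddCommGroup C] [Module k C]
    (B : R.Alg x.unop y →ₗ[k] N.obj.obj (vtx x) →ₗ[k] C) :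
    (((koszulF g R).obj N).X n).obj.obj (vtx y) →ₗ[k] C :=
  tlift (M := R.P x.unop) (W := N.obj.obj (vtx x)) (y := y) B ∘ₗ
    R.mapAt ((R.familyF N).π g.op n x) y

lemma fproj_fgen_self {N : R.dual.Mod} {n : ℤ} {x : Vᵒᵖ} (hx : g.op.deg x = n) {y : V}
    {C : Type*} [AddCommGroup C] [Module k C]
    (B : R.Alg x.unop y →ₗ[k] N.obj.obj (vtx x) →ₗ[k] C) (u : R.Alg x.unop y)
    (m : N.obj.obj (vtx x)) : fproj g N n x y B (fgen g N n x y u m) = B u m := by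
  exact congrArg (tlift (M := R.P x.unop) (W := N.obj.obj (vtx x)) (y := y) B)
    ((R.familyF N).mapAt_π_ι_self g.op hx _)

lemma fproj_fgen_of_ne {N : R.dual.Mod} {n : ℤ} {x z : Vᵒᵖ} (h : z ≠ x) {y : V}
    {C : Type*} [AddCommGroup C] [Module k C]
    (B : R.Alg x.unop y →ₗ[k] N.obj.obj (vtx x) →ₗ[k] C) (u : R.Alg z.unop y)
    (m : N.obj.obj (vtx z)) : fproj g N n x y B (fgen g N n z y u m) = 0 := by
  exact (congrArg (tlift (M := R.P x.unop) (W := N.obj.obj (vtx x)) (y := y) B)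
    ((R.familyF N).mapAt_π_ι_of_ne g.op h _)).trans (map_zero _)

lemma fproj_d_fgen (N : R.dual.Mod) {n n' : ℤ} {x z : Vᵒᵖ} (hx : g.op.deg x = n)
    (hz : g.op.deg z = n') {y : V} {C : Type*} [AddCommGroup C] [Module k C]
    (B : R.Alg z.unop y →ₗ[k] N.obj.obj (vtx z) →ₗ[k] C)
    (u : R.Alg x.unop y) (m : N.obj.obj (vtx x)) :
    fproj g N n' z y B (R.mapAt (((koszulF g R).obj N).d n n') y (fgen g N n x y u m)) =
      ∑ a : x ⟶ z, B (R.rmul a.unop.toPath u) ((N.obj.map (pathHom a.toPath)).hom m) := by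
  refine (congrArg (tlift (M := R.P z.unop) (W := N.obj.obj (vtx z)) (y := y) B)
    ((R.familyF N).mapAt_π_d_ι g.op hx hz
      (R.tmk (R.P x.unop) (N.obj.obj (vtx x)) y (R.pmk x.unop y u) m))).trans ?_
  exact map_sum _ _ _

end PathIdeal

end Koszul

/-! ### Quadratic duality: `F(I_a)` in the degrees of its generators -/

section Paths

variable {V : Type u} [Quiver.{u} V]

/-- Splits off the first arrow of a path. -/
def uncons {x : V} : ∀ {y : V}, Quiver.Path x y → Option (Σ z : V, (x ⟶ z) × Quiver.Path z y)
  | _, .nil => none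
  | _, .cons .nil b => some ⟨_, b, .nil⟩
  | _, .cons (.cons p c) b => (uncons (.cons p c)).map fun t => ⟨t.1, t.2.1, t.2.2.cons b⟩

/-- Paths are built by appending arrows at their end, so the first arrow is only reached by
recursion along the path. -/
lemma uncons_comp {x z y : V} (a : x ⟶ z) (q : Quiver.Path z y) :
    uncons (a.toPath.comp q) = some ⟨z, a, q⟩ := by
  induction q with
  | nil => rfl
  | cons q b ih =>
    cases q with
    | nil => rfl
    | cons q c =>
      change (uncons (a.toPath.comp (q.cons c))).map _ = _
      rw [ih]; rfl

lemma exists_eq_toPath_comp {x y : V} (p : Quiver.Path x y) (hp : p.length ≠ 0) :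
    ∃ (z : V) (a : x ⟶ z) (q : Quiver.Path z y), p = a.toPath.comp q := by
  obtain ⟨n, hn⟩ := Nat.exists_eq_succ_of_ne_zero hp
  obtain ⟨z, a, q, -, rfl⟩ := Quiver.Path.eq_toPath_comp_of_length_eq_succ p hn
  exact ⟨z, a, q, rfl⟩

end Paths

section Injectives

variable {k : Type u} [Field k] {V : Type u} [Quiver.{u} V] {R : PathIdeal k V}

namespace PathIdeal

/-- If `x ≠ a`, then an element of `I_a(x)` is determined by its multiples by arrows. -/
lemma I_eq_zero_of_arrows {a x : V} (hxa : x ≠ a) (f : Module.Dual k (R.Alg x a))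
    (h : ∀ (z : V) (b : x ⟶ z), f ∘ₗ R.rmul b.toPath = (0 : Module.Dual k (R.Alg z a))) :
    f = 0 := by
  refine Alg.hom_ext R fun p => ?_
  obtain ⟨z, b, q, rfl⟩ := exists_eq_toPath_comp p fun hp =>
    hxa (Quiver.Path.eq_of_length_zero p hp)
  have := LinearMap.congr_fun (h z b) (R.cls q)
  simpa using this

end PathIdeal

end Injectives

section Koszul

variable {k : Type u} [Field k] {V : Type u} [Quiver.{u} V] [LocallyFinite V]
  {R : PathIdeal k V} (g : Grading V)

namespace PathIdeal

/-- The summands `P_z ⊗ N(z)` that occur have `deg z = deg x`, and the only path from such a `z` to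
`x` is the trivial one, with `z = x`. -/
lemma F_exists_fgen_e {N : R.dual.Mod} {n : ℤ} {x : Vᵒᵖ} (hn : g.op.deg x = n)
    (c : (((koszulF g R).obj N).X n).obj.obj (vtx x.unop)) :
    ∃ m, c = fgen g N n x x.unop (R.e x.unop) m := by
  induction c using F_induction with
  | gen z hz q m =>
    have hl : q.length = 0 := by
      have := g.deg_path q
      change -g.deg _ = _ at hz
      change -g.deg _ = _ at hn
      omega
    obtain ⟨z⟩ := z
    obtain ⟨x⟩ := x
    cases q with
    | nil => exact ⟨m, rfl⟩
    | cons q a => simp at hl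
  | zero => exact ⟨0, (map_zero _).symm⟩
  | add a b ha hb =>
    obtain ⟨m, rfl⟩ := ha
    obtain ⟨m', rfl⟩ := hb
    exact ⟨m + m', (map_add _ _ _).symm⟩

/-- One step further, the summands `P_z ⊗ N(z)` have `z` one degree below `x` in `Q`, so the paths
from `z` to `x` are single arrows. The value at `x` is spanned by elements `α ⊗ m`, with `α` an
arrow of `Q` ending at `x`. -/
lemma F_exists_sum_arrows {N : R.dual.Mod} {n : ℤ} {x : Vᵒᵖ} (hn : g.op.deg x + 1 = n)
    (c : (((koszulF g R).obj N).X n).obj.obj (vtx x.unop)) :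
    ∃ f : ∀ p : Σ z : Vᵒᵖ, x ⟶ z, N.obj.obj (vtx p.1),
      c = ∑ p : Σ z : Vᵒᵖ, x ⟶ z, fgen g N n p.1 x.unop (R.cls p.2.unop.toPath) (f p) := by
  classical
  induction c using F_induction with
  | gen z hz q m =>
    have hl : q.length = 1 := by
      have := g.deg_path q
      change -g.deg _ = _ at hz
      change -g.deg _ + 1 = _ at hn
      omega
    obtain ⟨a, rfl⟩ : ∃ a : z.unop ⟶ x.unop, q = a.toPath := by
      obtain ⟨w, a, r, rfl⟩ := exists_eq_toPath_comp q (by omega)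
      have hr : r.length = 0 := by
        rw [Quiver.Path.length_comp, Quiver.Path.length_toPath] at hl
        omega
      cases r with
      | nil => exact ⟨a, rfl⟩
      | cons r b => simp at hr
    refine ⟨Pi.single ⟨z, a.op⟩ m, ?_⟩
    rw [Finset.sum_eq_single (⟨z, a.op⟩ : Σ z : Vᵒᵖ, x ⟶ z) (fun p _ hp => ?_) (by simp)]
    · rw [Pi.single_eq_same]; rfl
    · rw [Pi.single_eq_of_ne hp, map_zero]
  | zero => exact ⟨0, (Finset.sum_eq_zero fun p _ => map_zero _).symm⟩
  | add a b ha hb =>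
    obtain ⟨f, rfl⟩ := ha
    obtain ⟨f', rfl⟩ := hb
    refine ⟨f + f', ?_⟩
    rw [← Finset.sum_add_distrib]
    exact Finset.sum_congr rfl fun p _ => (map_add _ _ _).symm

/-- The arrows remain independent in `Λ` because the relations have degree at least two. Combined
with `F_exists_sum_arrows`, this gives unique coordinates. -/
lemma F_sum_arrows_eq_zero (hR : R.IsHomogeneous) {N : R.dual.Mod} {n : ℤ} {x : Vᵒᵖ}
    (hn : g.op.deg x + 1 = n) (f : ∀ p : Σ z : Vᵒᵖ, x ⟶ z, N.obj.obj (vtx p.1))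
    (h : ∑ p : Σ z : Vᵒᵖ, x ⟶ z, fgen g N n p.1 x.unop (R.cls p.2.unop.toPath) (f p) = 0)
    (p : Σ z : Vᵒᵖ, x ⟶ z) : f p = 0 := by
  have hz : g.op.deg p.1 = n := by rw [g.op.deg_arrow p.2, hn]
  have h1 : p.2.unop.toPath.length < 2 := Nat.one_lt_two
  -- The projection isolates the source vertex of the arrow, and the coefficient form then separates
  -- it from its parallel arrows.
  have := congrArg (fproj g N n p.1 x.unop
    ((hR.coeff p.2.unop.toPath h1).smulRight LinearMap.id)) h
  rw [map_sum, map_zero, Finset.sum_eq_single p ?_ (by simp), fproj_fgen_self g hz] at this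
  · simpa using this
  · rintro ⟨z, a⟩ - hne
    by_cases hzp : z = p.1
    · subst hzp
      rw [fproj_fgen_self g hz, LinearMap.smulRight_apply, hR.coeff_mk,
        Finsupp.single_eq_of_ne, zero_smul, LinearMap.zero_apply]
      intro hpath
      refine hne ?_
      have : p.2.unop = a.unop := by
        simpa [Quiver.Hom.toPath] using hpath
      obtain ⟨z, b⟩ := p
      exact congrArg (Sigma.mk z) (Quiver.Hom.unop_inj this).symm
    · rw [fproj_fgen_of_ne g hzp]

/-- The differential of `F(I_a)` is injective on the values at `x` of the term generated at the
vertices of the same degree as `x ≠ a`. -/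
lemma F_I_injective (hR : R.IsHomogeneous) {a x : Vᵒᵖ} (hxa : x ≠ a) {n n' : ℤ}
    (hn : g.op.deg x = n) (hn' : n + 1 = n') :
    Function.Injective (R.mapAt (((koszulF g R).obj (R.dual.I a)).d n n') x.unop) := by
  rw [injective_iff_map_eq_zero]
  intro c hc
  obtain ⟨m, rfl⟩ := F_exists_fgen_e g hn c
  obtain ⟨m, rfl⟩ := R.dual.imk_surjective a x m
  rw [F_d_fgen g _ _ hn] at hc
  simp only [rmul_e] at hc
  have h := F_sum_arrows_eq_zero g hR (by rw [hn, hn']) _ hc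
  rw [I_eq_zero_of_arrows hxa m fun z b => h ⟨z, b⟩, map_zero, map_zero]

end PathIdeal

end Koszul

section Pairing

variable {k : Type u} [Field k] {V : Type u} [Quiver.{u} V]

/-- The linear form `ρ^*`. -/
def pairingForm {x y : V} (ρ : PathSpace k x y) : PathSpace k x y →ₗ[k] k :=
  Finsupp.linearCombination k fun p => ρ p

/-- The two sides are sums over the supports of different arguments; both agree with the sum over
the union. -/
lemma pairingForm_apply {x y : V} (ρ δ : PathSpace k x y) :
    pairingForm ρ δ = pathPairing ρ δ := by
  classical
  rw [pairingForm, Finsupp.linearCombination_apply, pathPairing,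
    Finsupp.sum_of_support_subset δ (Finset.subset_union_right (s₁ := ρ.support)) _ (by simp),
    Finsupp.sum_of_support_subset ρ (Finset.subset_union_left (s₂ := δ.support)) _ (by simp)]
  exact Finset.sum_congr rfl fun p _ => mul_comm _ _

end Pairing

section Koszul

variable {k : Type u} [Field k] {V : Type u} [Quiver.{u} V] [LocallyFinite V]
  {R : PathIdeal k V} (g : Grading V)

lemma homogeneous_two_eq_sum {x z : V} {ρ : PathSpace k x z} (hρ : ρ ∈ homogeneous k 2 x z) :
    ρ = ∑ t : Arrow₂ x z, ρ t.path • Finsupp.single t.path 1 := by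
  classical
  ext p
  rw [Finsupp.finsetSum_apply]
  by_cases hp : p.length = 2
  · obtain ⟨t, rfl⟩ := Arrow₂.exists_path_eq p hp
    rw [Finset.sum_eq_single t (fun s _ hs => ?_) (by simp)]
    · simp
    · simp [Arrow₂.path_injective.ne hs]
  · have h0 : ρ p = 0 := by
      by_contra hne
      exact hp (hρ (Finsupp.mem_support_iff.2 hne))
    rw [h0]
    symm
    refine Finset.sum_eq_zero fun t _ => ?_
    have : t.path ≠ p := fun h => hp (h ▸ t.length_path)
    simp [this]

/-- The equivalence between composable pairs of arrows and their description as an iterated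
choice. -/
def arrow₂Sigma {W : Type u} [Quiver.{u} W] (x z : W) :
    (Σ p : (Σ y : W, x ⟶ y), p.1 ⟶ z) ≃ Arrow₂ x z where
  toFun t := ⟨t.1.1, t.1.2, t.2⟩
  invFun t := ⟨⟨t.1, t.2.1⟩, t.2.2⟩
  left_inv _ := rfl
  right_inv _ := rfl

namespace PathIdeal

/-- The differential of `F(I_a)` is exact at the values at `x ≠ a` of the term generated at the
predecessors of `x`. -/
lemma F_I_exact {a x : Vᵒᵖ} {n n' n'' : ℤ}
    (hn : g.op.deg x = n) (hn' : n + 1 = n') (hn'' : n' + 1 = n'')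
    (c : (((koszulF g R).obj (R.dual.I a)).X n').obj.obj (vtx x.unop))
    (hc : R.mapAt (((koszulF g R).obj (R.dual.I a)).d n' n'') x.unop c = 0) :
    ∃ b, R.mapAt (((koszulF g R).obj (R.dual.I a)).d n n') x.unop b = c := by
  obtain ⟨f, rfl⟩ := F_exists_sum_arrows g (by rw [hn, hn']) c
  choose f hf using fun p => R.dual.imk_surjective a p.1 (f p)
  obtain rfl := funext hf
  -- The candidate preimage, before passing to the quotient: a path that starts with the arrow `b`
  -- and continues as `q` is sent to `f_b(q)`. The trivial path, if there is one, gets the arbitrary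
  -- value `0`. What has to be shown is that this form vanishes on `R^!`.
  let φ : PathSpace k x a →ₗ[k] k := Finsupp.linearCombination k fun q =>
    (uncons q).elim 0 fun t => f ⟨t.1, t.2.1⟩ (R.dual.cls t.2.2)
  have hφ : ∀ {z : Vᵒᵖ} (b : x ⟶ z) (δ : PathSpace k z a),
      φ (precomp b.toPath δ) = f ⟨z, b⟩ (Submodule.Quotient.mk δ) := fun {z} b δ => by
    induction δ using Finsupp.induction_linear with
    | zero => simp
    | add δ δ' h h' => rw [map_add, map_add, h, h', Submodule.Quotient.mk_add, map_add]
    | single q c =>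
      have hs : (Finsupp.single q c : PathSpace k z a) = c • Finsupp.single q 1 := by simp
      rw [hs, map_smul, map_smul, Submodule.Quotient.mk_smul, map_smul]
      congr 1
      rw [precomp_single, Finsupp.linearCombination_single, one_smul, uncons_comp]
      rfl
  -- This is where the cycle condition enters. For `ρ` orthogonal to `R₂`, applying `ρ^*` tensored
  -- with evaluation at `q` to the equation `dc = 0` gives exactly the vanishing of `φ` on `q ρᵒ`.
  have hquad : ∀ {b : Vᵒᵖ} (q : Quiver.Path b a) (ρ : PathSpace k b.unop x.unop),
      ρ ∈ homogeneous k 2 b.unop x.unop →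
      (∀ δ ∈ R.carrier b.unop x.unop ⊓ homogeneous k 2 b.unop x.unop, pathPairing ρ δ = 0) →
      φ (postcomp q (Finsupp.mapDomain opPath ρ)) = 0 := fun {b} q ρ hρ hρR => by
    have hsum : φ (postcomp q (Finsupp.mapDomain opPath ρ)) =
        ∑ t : Arrow₂ b.unop x.unop, ρ t.path •
          f ⟨op t.1, t.2.2.op⟩ (R.dual.cls (t.2.1.op.toPath.comp q)) := by
      conv_lhs => rw [homogeneous_two_eq_sum hρ]
      simp only [Finsupp.mapDomain_finsetSum, map_sum, Finsupp.mapDomain_smul, map_smul]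
      refine Finset.sum_congr rfl fun t _ => ?_
      congr 1
      rw [Finsupp.mapDomain_single, postcomp_single, Arrow₂.opPath_path]
      have := hφ t.2.2.op (Finsupp.single (t.2.1.op.toPath.comp q) 1)
      rw [precomp_single] at this
      rw [Quiver.Path.comp_assoc]
      exact this
    -- If `b` is not two steps away from `x`, then there are no paths of length two between them and
    -- the sum is empty.
    by_cases hdeg : g.op.deg b = n''
    swap
    · rw [hsum]
      refine Finset.sum_eq_zero fun t _ => absurd ?_ hdeg
      have h1 := g.deg_arrow t.2.1
      have h2 := g.deg_arrow t.2.2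
      change -g.deg _ = _
      change -g.deg _ = _ at hn
      omega
    have hpath : ∀ p : Quiver.Path b.unop x.unop, p.length = 2 := fun p => by
      have := g.deg_path p
      change -g.deg _ = _ at hdeg
      change -g.deg _ = _ at hn
      omega
    -- All paths between these vertices have length two, so the whole component of `R` is its
    -- quadratic part and `ρ^*` descends to `Λ`.
    let ψ : R.Alg b.unop x.unop →ₗ[k] k := Submodule.liftQ _ (pairingForm ρ) fun δ hδ => by
      rw [LinearMap.mem_ker, pairingForm_apply]
      exact hρR δ ⟨hδ, fun p _ => hpath p⟩
    let B : R.Alg b.unop x.unop →ₗ[k] (R.dual.I a).obj.obj (vtx b) →ₗ[k] k :=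
      ψ.smulRight (LinearMap.applyₗ (R.dual.cls q) : Module.Dual k (R.dual.Alg b a) →ₗ[k] k)
    have h := congrArg (fproj g _ n'' b x.unop B) hc
    rw [map_sum, map_sum, map_zero] at h
    rw [hsum, ← h, ← (arrow₂Op x b).sum_comp, ← (arrow₂Sigma x b).sum_comp, Fintype.sum_sigma]
    refine Finset.sum_congr rfl fun p _ => ?_
    rw [fproj_d_fgen g _ (by rw [g.op.deg_arrow p.2, hn, hn']) hdeg]
    refine Finset.sum_congr rfl fun β _ => ?_
    have hB : B (R.rmul β.unop.toPath (R.cls p.2.unop.toPath))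
        (((R.dual.I a).obj.map (pathHom β.toPath)).hom (R.dual.imk a p.1 (f p))) =
        pairingForm ρ (precomp β.unop.toPath (Finsupp.single p.2.unop.toPath 1)) •
          f p (R.dual.rmul β.toPath (R.dual.cls q)) := rfl
    rw [hB, precomp_single, rmul_mk, precomp_single, pairingForm,
      Finsupp.linearCombination_single, one_smul]
    rfl
  have hφR : R.dual.carrier x a ≤ LinearMap.ker φ := by
    refine Submodule.span_le.2 ?_
    rintro _ ⟨y, z, p, q, _, ⟨ρ, hρ, hρR, rfl⟩, rfl⟩
    -- A generator `q ρᵒ p` with nontrivial `p` factors through a first arrow `b`. The remaining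
    -- factor already lies in `R^!`, on which `f_b` is zero by definition. Only the generators `q
    -- ρᵒ` need the cycle condition.
    by_cases hp : p.length = 0
    · cases p with
      | nil => rw [precomp_nil]; exact hquad q ρ hρ hρR
      | cons p b => simp at hp
    · obtain ⟨w, b, r, rfl⟩ := exists_eq_toPath_comp p hp
      rw [← precomp_precomp, ← precomp_postcomp]
      refine (hφ b _).trans ?_
      rw [(Submodule.Quotient.mk_eq_zero _).2, map_zero]
      exact R.dual.postcomp_mem q (R.dual.precomp_mem r
        (PathIdeal.subset_span _ ⟨ρ, hρ, hρR, rfl⟩))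
  -- The preimage is `e_x ⊗ φ`, with `φ` regarded as a form on `e_aΛ^!e_x`. Its multiples by the
  -- arrows are the given `f_b`.
  refine ⟨fgen g _ n x x.unop (R.e x.unop) (R.dual.imk a x (Submodule.liftQ _ φ hφR)), ?_⟩
  rw [F_d_fgen g _ _ hn]
  refine Finset.sum_congr rfl fun p _ => ?_
  rw [rmul_e, I_map_imk]
  congr 2
  refine Alg.hom_ext _ fun q => ?_
  have := hφ p.2 (Finsupp.single q 1)
  exact this

end PathIdeal

end Koszul

/-! ### Comparison of `F(I_a)` with a linear resolution of `S_a` -/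

section Pairing

variable {k : Type u} [Field k] {V : Type u} [Quiver.{u} V] {R : PathIdeal k V}

lemma length_opPath {x y : V} (p : Quiver.Path x y) : (opPath p).length = p.length := by
  induction p with
  | nil => rw [opPath, Quiver.Path.length_nil, Quiver.Path.length_nil]
  | cons p a ih =>
    rw [opPath, Quiver.Path.length_comp, ih, Quiver.Path.length_toPath, Quiver.Path.length_cons, add_comm]

/-- Reversal preserves the length, so the generators of `R^!` have degree two. This makes the
coefficient forms available on `Λ^!`. -/
lemma PathIdeal.isHomogeneous_dual : R.dual.IsHomogeneous := by
  classical
  refine ⟨_, ?_, rfl⟩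
  rintro y x _ ⟨ρ, hρ, -, rfl⟩
  refine ⟨2, le_rfl, fun p hp => ?_⟩
  obtain ⟨q, hq, rfl⟩ := Finset.mem_image.1 (Finsupp.mapDomain_support hp)
  exact (length_opPath q).trans (hρ hq)

namespace PathIdeal

lemma I_subsingleton {a x : V} (h : IsEmpty (Quiver.Path x a)) :
    Subsingleton ((R.I a).obj.obj (vtx x)) := by
  have := alg_subsingleton (R := R) h
  refine subsingleton_of_forall_eq 0 fun f => ?_
  obtain ⟨f, rfl⟩ := R.imk_surjective a x f
  rw [show f = 0 from LinearMap.ext fun u => by rw [Subsingleton.elim u 0, map_zero, map_zero],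
    map_zero]

lemma mapAt_iso_inv_hom {M N : R.Mod} (α : M ≅ N) (y : V) (n : N.obj.obj (vtx y)) :
    R.mapAt α.hom y (R.mapAt α.inv y n) = n := by
  rw [← mapAt_comp_apply, α.inv_hom_id]; rfl

lemma mapAt_iso_hom_inv {M N : R.Mod} (α : M ≅ N) (y : V) (m : M.obj.obj (vtx y)) :
    R.mapAt α.inv y (R.mapAt α.hom y m) = m := by
  rw [← mapAt_comp_apply, α.hom_inv_id]; rfl

end PathIdeal

end Pairing

section Koszul

variable {k : Type u} [Field k] {V : Type u} [Quiver.{u} V] [LocallyFinite V]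
  {R : PathIdeal k V} (g : Grading V)

namespace PathIdeal

/-- The vertices of degree `-e` in `Qᵒ` are those of degree `e` in `Q`, and each `P_x ⊗ W` is
generated at `x`. -/
lemma F_freeIn (N : R.dual.Mod) (e : ℤ) : FreeIn g e (((koszulF g R).obj N).X (-e)) :=
  freeIn_sigma (T := fun x : {x : Vᵒᵖ // g.op.deg x = -e} => (R.familyF N).T x.1)
    fun x => freeIn_tens_P (neg_injective x.2) _

lemma F_I_subsingleton {a : Vᵒᵖ} {n : ℤ} (h : g.op.deg a < n) (y : V) :
    Subsingleton ((((koszulF g R).obj (R.dual.I a)).X n).obj.obj (vtx y)) :=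
  subsingleton_of_forall_eq 0 fun c => by
    induction c using F_induction with
    | gen x hx q m =>
      have := I_subsingleton (R := R.dual) (isEmpty_path_of_deg_lt g.op (x := x) (y := a) (by omega))
      rw [Subsingleton.elim m 0, map_zero]
    | zero => rfl
    | add a b ha hb => rw [ha, hb, add_zero]

/-- This plays the part of the augmentation of a resolution. At `a` both values are lines, at the
other vertices of the same degree both vanish, and freeness extends the chosen isomorphisms to a
morphism. -/
lemma exists_F_I_to_S (hR : R.IsHomogeneous) (a : V) :
    ∃ f : ((koszulF g R).obj (R.dual.I (op a))).X (-g.deg a) ⟶ R.S a,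
      ∀ x, g.deg x = g.deg a → Function.Bijective (R.mapAt f x) := by
  have key : ∀ x, g.deg x = g.deg a → ∃ h :
      (((koszulF g R).obj (R.dual.I (op a))).X (-g.deg a)).obj.obj (vtx x) →ₗ[k]
        (R.S a).obj.obj (vtx x), Function.Bijective h := fun x hx => by
    by_cases hxa : a = x
    · subst hxa
      have hb := radical_P_self (R := R) g a
      let q : R.Alg a a →ₗ[k] (R.S a).obj.obj (vtx a) :=
        Submodule.mkQ (R.radical (R.P a) a) ∘ₗ R.pmk a a
      have hq : Function.Surjective q := Submodule.mkQ_surjective _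
      have hqe : q (R.e a) ≠ 0 := fun h => hR.e_ne_zero a <| by
        have : R.pmk a a (R.e a) ∈ R.radical (R.P a) a := (Submodule.Quotient.mk_eq_zero _).1 h
        rw [hb] at this
        exact (Submodule.mem_bot k).1 this
      let ev : Module.Dual k (R.dual.Alg (op a) (op a)) →ₗ[k] k := LinearMap.applyₗ (R.dual.e (op a))
      let B : R.Alg a a →ₗ[k] (R.dual.I (op a)).obj.obj (vtx (op a)) →ₗ[k]
          (R.S a).obj.obj (vtx a) := LinearMap.flip (ev.smulRight q)
      have hB : ∀ f, fproj g _ (-g.deg a) (op a) a B (fgen g _ (-g.deg a) (op a) a (R.e a)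
          (R.dual.imk (op a) (op a) f)) = f (R.dual.e (op a)) • q (R.e a) := fun f =>
        fproj_fgen_self g (x := op a) rfl B _ _
      refine ⟨fproj g _ (-g.deg a) (op a) a B, ?_, fun s => ?_⟩
      · rw [injective_iff_map_eq_zero]
        intro c hc
        obtain ⟨m, rfl⟩ := F_exists_fgen_e g (x := op a) rfl c
        obtain ⟨f, rfl⟩ := R.dual.imk_surjective _ _ m
        have h0 : f (R.dual.e (op a)) = 0 :=
          (smul_eq_zero.1 ((hB f).symm.trans hc)).resolve_right hqe
        have hf : f = 0 := LinearMap.ext fun u => by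
          obtain ⟨c, rfl⟩ := alg_eq_smul_e g.op u
          rw [map_smul, h0, smul_zero, LinearMap.zero_apply]
        rw [hf, map_zero, map_zero]; rfl
      · obtain ⟨u, rfl⟩ := hq s
        obtain ⟨c, rfl⟩ := alg_eq_smul_e g u
        -- The coefficient of the trivial path is a form with value one at `e_a`, so multiples of it
        -- reach every element of the line.
        have h1 : (Quiver.Path.nil : Quiver.Path (op a) (op a)).length < 2 := Nat.zero_lt_two
        refine ⟨_, (hB (c • isHomogeneous_dual.coeff .nil h1)).trans ?_⟩
        rw [LinearMap.smul_apply, e, IsHomogeneous.coeff_mk, Finsupp.single_eq_same, smul_eq_mul,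
          mul_one, map_smul]
    · have h1 := S_subsingleton_of_ne (R := R) hxa
      have h2 : Subsingleton
          ((((koszulF g R).obj (R.dual.I (op a))).X (-g.deg a)).obj.obj (vtx x)) :=
        subsingleton_of_forall_eq 0 fun c => by
          obtain ⟨m, rfl⟩ := F_exists_fgen_e g (x := op x) (congrArg Neg.neg hx) c
          have := I_subsingleton (R := R.dual) (isEmpty_path_of_deg_eq g.op (x := op x)
            (y := op a) (congrArg Neg.neg hx.symm) fun h => hxa (op_injective h).symm)
          rw [Subsingleton.elim m 0, map_zero]
      exact ⟨0, fun _ _ _ => Subsingleton.elim _ _, fun _ => ⟨0, Subsingleton.elim _ _⟩⟩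
  choose h hh using key
  obtain ⟨f, hf, -⟩ := F_freeIn g (R.dual.I (op a)) (g.deg a) (R.S a) h
  exact ⟨f, fun x hx => by rw [hf x hx]; exact hh x hx⟩

/-- The term `⨁ P_x ⊗ I_a(x)`, over the vertices `x` of degree `deg a + n`, of `F(I_a)`. -/
abbrev KTerm (R : PathIdeal k V) (a : V) (n : ℕ) : R.Mod :=
  ((koszulF g R).obj (R.dual.I (op a))).X (-(g.deg a + (n : ℤ)))

/-- The differential of `F(I_a)`. -/
abbrev Kd (R : PathIdeal k V) (a : V) (n : ℕ) : KTerm g R a (n + 1) ⟶ KTerm g R a n :=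
  ((koszulF g R).obj (R.dual.I (op a))).d _ _

lemma Kd_injective (hR : R.IsHomogeneous) (a : V) (n : ℕ) {x : V}
    (hx : g.deg x = g.deg a + (n + 1 : ℕ)) : Function.Injective (R.mapAt (Kd g R a n) x) :=
  F_I_injective g hR (x := op x) (a := op a) (fun h => by
    rw [op_injective h] at hx; omega) (congrArg Neg.neg hx) (by push_cast; ring)

namespace LinearResolution

variable {g} {a : V} (L : R.LinearResolution a)

/-- Both modules map to `S_a` bijectively in degree `deg a`, which determines them up to
isomorphism. -/
lemma exists_iso_zero (hR : R.IsHomogeneous) (g : Grading V) :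
    Nonempty (KTerm g R a 0 ≅ L.term 0) := by
  obtain ⟨f, hf⟩ := exists_F_I_to_S g hR a
  have h0 : g.deg a + ((0 : ℕ) : ℤ) = g.deg a := by simp
  have hK := F_freeIn g (R.dual.I (op a)) (g.deg a)
  have hL := L.freeIn_term hR g 0
  rw [h0] at hL
  obtain ⟨γ, -⟩ := hK.exists_iso hL f L.aug (Iso.refl _) (fun x hx => (hf x hx).1)
    (fun x hx => L.injective_aug hR g hx) fun x hx b =>
      iff_of_true ((hf x hx).2 b) (L.surjective_aug x _)
  rw [KTerm, h0]
  exact ⟨γ⟩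

/-- In degree `deg a + 1` both differentials are surjective: for `F(I_a)` because the next term
vanishes and every element is a cycle, for the resolution because `S_a` is zero there. -/
lemma exists_iso_one (hR : R.IsHomogeneous) (α : KTerm g R a 0 ≅ L.term 0) :
    ∃ β : KTerm g R a 1 ≅ L.term 1, β.hom ≫ L.d 0 = Kd g R a 0 ≫ α.hom := by
  refine (F_freeIn g (R.dual.I (op a)) _).exists_iso (L.freeIn_term hR g 1) _ _ α
    (fun x hx => Kd_injective g hR a 0 hx) (fun x hx => L.injective_d hR g 0 hx)
    fun x hx b => iff_of_true ?_ ?_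
  · have := F_I_subsingleton (R := R) g (a := op a) (n := -(g.deg a + (0 : ℕ)) + 1)
      (by change -g.deg a < _; simp) x
    exact F_I_exact g (x := op x) (a := op a) (congrArg Neg.neg hx) (by push_cast; ring) rfl b
      (Subsingleton.elim _ _)
  · have := S_subsingleton_of_ne (R := R) (a := a) (y := x) (by rintro rfl; omega)
    exact (L.exact_aug x _).1 (Subsingleton.elim _ _)

/-- In the degree of the new generators both images are the kernels of the following differentials,
and the square already constructed matches these kernels. -/
lemma exists_iso_succ (hR : R.IsHomogeneous) (n : ℕ) (α : KTerm g R a n ≅ L.term n)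
    (β : KTerm g R a (n + 1) ≅ L.term (n + 1)) (h : β.hom ≫ L.d n = Kd g R a n ≫ α.hom) :
    ∃ γ : KTerm g R a (n + 2) ≅ L.term (n + 2),
      γ.hom ≫ L.d (n + 1) = Kd g R a (n + 1) ≫ β.hom := by
  refine (F_freeIn g (R.dual.I (op a)) _).exists_iso (L.freeIn_term hR g (n + 2)) _ _ β
    (fun x hx => Kd_injective g hR a (n + 1) hx) (fun x hx => L.injective_d hR g (n + 1) hx)
    fun x hx b => ?_
  have hc := congrArg (fun f => R.mapAt f x b) h
  simp only [mapAt_comp_apply] at hc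
  constructor
  · rintro ⟨c, rfl⟩
    refine (L.exact_d n x _).1 ?_
    rw [hc, ← mapAt_comp_apply (Kd g R a (n + 1)), HomologicalComplex.d_comp_d]
    exact map_zero _
  · intro hb
    have h0 := (L.exact_d n x _).2 hb
    rw [hc] at h0
    have h1 : R.mapAt (Kd g R a n) x b = 0 := by
      rw [← mapAt_iso_hom_inv α x (R.mapAt (Kd g R a n) x b), h0, map_zero]
    exact F_I_exact g (x := op x) (a := op a) (congrArg Neg.neg hx) (by push_cast; ring)
      (by push_cast; ring) b h1

lemma exists_iso (hR : R.IsHomogeneous) (g : Grading V) (n : ℕ) :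
    ∃ (α : KTerm g R a n ≅ L.term n) (β : KTerm g R a (n + 1) ≅ L.term (n + 1)),
      β.hom ≫ L.d n = Kd g R a n ≫ α.hom := by
  induction n with
  | zero =>
    obtain ⟨α⟩ := L.exists_iso_zero hR g
    exact ⟨α, L.exists_iso_one hR α⟩
  | succ n ih =>
    obtain ⟨α, β, h⟩ := ih
    exact ⟨β, L.exists_iso_succ hR n α β h⟩

/-- Away from `a` the module `S_a` vanishes, so the first differential of the resolution is onto;
the isomorphisms carry this to `F(I_a)`. -/
lemma Kd_exact_zero (L : R.LinearResolution a) (hR : R.IsHomogeneous) (g : Grading V) {y : V} (hy : a ≠ y)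
    (c : (KTerm g R a 0).obj.obj (vtx y)) : ∃ b, R.mapAt (Kd g R a 0) y b = c := by
  obtain ⟨α, β, h⟩ := L.exists_iso hR g 0
  have := S_subsingleton_of_ne (R := R) hy
  obtain ⟨p, hp⟩ := (L.exact_aug y (R.mapAt α.hom y c)).1 (Subsingleton.elim _ _)
  refine ⟨R.mapAt β.inv y p, ?_⟩
  have hc := congrArg (fun f => R.mapAt f y (R.mapAt β.inv y p)) h
  simp only [mapAt_comp_apply, mapAt_iso_inv_hom, hp] at hc
  rw [← mapAt_iso_hom_inv α y (R.mapAt (Kd g R a 0) y _), ← hc, mapAt_iso_hom_inv]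

lemma Kd_exact_succ (L : R.LinearResolution a) (hR : R.IsHomogeneous) (g : Grading V) (n : ℕ) {y : V}
    (c : (KTerm g R a (n + 1)).obj.obj (vtx y)) (hc : R.mapAt (Kd g R a n) y c = 0) :
    ∃ b, R.mapAt (Kd g R a (n + 1)) y b = c := by
  obtain ⟨α, β, h⟩ := L.exists_iso hR g n
  obtain ⟨γ, h'⟩ := L.exists_iso_succ hR n α β h
  have h1 := congrArg (fun f => R.mapAt f y c) h
  simp only [mapAt_comp_apply, hc, map_zero] at h1
  obtain ⟨p, hp⟩ := (L.exact_d n y (R.mapAt β.hom y c)).1 h1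
  refine ⟨R.mapAt γ.inv y p, ?_⟩
  have h2 := congrArg (fun f => R.mapAt f y (R.mapAt γ.inv y p)) h'
  simp only [mapAt_comp_apply, mapAt_iso_inv_hom, hp] at h2
  rw [← mapAt_iso_hom_inv β y (R.mapAt (Kd g R a (n + 1)) y _), ← h2, mapAt_iso_hom_inv]

end LinearResolution

/-- If `Λ` is Koszul, then `F(I_a)` is exact at all vertices different from `a`. -/
lemma IsKoszul.F_I_exact (hR : R.IsKoszul) (a : Vᵒᵖ) {y : V} (hy : a.unop ≠ y) {n n' n'' : ℤ}
    (hn : n + 1 = n') (hn' : n' + 1 = n'')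
    (c : (((koszulF g R).obj (R.dual.I a)).X n').obj.obj (vtx y))
    (hc : R.mapAt (((koszulF g R).obj (R.dual.I a)).d n' n'') y c = 0) :
    ∃ b, R.mapAt (((koszulF g R).obj (R.dual.I a)).d n n') y b = c := by
  obtain ⟨a⟩ := a
  obtain ⟨L⟩ := hR.2 a
  -- Above degree `-deg a` the complex is zero. At or below it, the position is `-(deg a + m)` for a
  -- natural number `m`, and the comparison with the resolution applies.
  by_cases h : g.op.deg (op a) < n'
  · have := F_I_subsingleton (R := R) g h y
    exact ⟨0, Subsingleton.elim _ _⟩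
  · obtain ⟨m, hm⟩ : ∃ m : ℕ, n' = -(g.deg a + m) :=
      ⟨(-g.deg a - n').toNat, by
        change ¬ (-g.deg a < n') at h
        omega⟩
    subst hm
    cases m with
    | zero =>
      obtain rfl : n = -(g.deg a + ((0 + 1 : ℕ) : ℤ)) := by push_cast; omega
      exact L.Kd_exact_zero hR.1 g hy c
    | succ m =>
      obtain rfl : n = -(g.deg a + ((m + 1 + 1 : ℕ) : ℤ)) := by push_cast at hn ⊢; omega
      obtain rfl : n'' = -(g.deg a + (m : ℤ)) := by push_cast at hn' ⊢; omega
      exact L.Kd_exact_succ hR.1 g m c hc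

end PathIdeal

end Koszul

/-! ### Exactness of the columns `F(G(M)ⁱ)` -/

section Tensor

variable {k : Type u} [Field k] {V : Type u} [Quiver.{u} V] {R : PathIdeal k V}

namespace PathIdeal

/-- The morphism `M ⟶ M ⊗ W`, `m ↦ m ⊗ w`. -/
def tensIncl (M : R.Mod) (W : ModuleCat.{u} k) (w : W) : M ⟶ R.tens M W :=
  homOfMapAt (fun y => (R.tmk M W y).flip w) fun _ _ => rfl

lemma mapAt_tensIncl (M : R.Mod) (W : ModuleCat.{u} k) (w : W) (y : V) (m : M.obj.obj (vtx y)) :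
    R.mapAt (tensIncl M W w) y m = R.tmk M W y m w := rfl

/-- The morphism `M ⊗ W ⟶ M`, `m ⊗ w ↦ φ w • m`. -/
def tensProj (M : R.Mod) (W : ModuleCat.{u} k) (φ : Module.Dual k W) : R.tens M W ⟶ M :=
  homOfMapAt (M := R.tens M W)
    (fun y => tlift (M := M) (W := W) (y := y) (LinearMap.flip (φ.smulRight LinearMap.id)))
    fun {y z} p m => by
      induction m using tens_induction with
      | tmul u w => exact (map_smul (M.obj.map (pathHom p)).hom (φ w) u).symm
      | zero => simp only [map_zero]
      | add a b ha hb => simp only [map_add, ha, hb]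

lemma mapAt_tensProj (M : R.Mod) (W : ModuleCat.{u} k) (φ : Module.Dual k W) (y : V)
    (m : M.obj.obj (vtx y)) (w : W) :
    R.mapAt (tensProj M W φ) y (R.tmk M W y m w) = φ w • m := rfl

end PathIdeal

end Tensor

section Koszul

variable {k : Type u} [Field k] {V : Type u} [Quiver.{u} V] [LocallyFinite V]
  {R : PathIdeal k V} (g : Grading V)

namespace PathIdeal

/-- The inclusion of the summand `I_a ⊗ M(a)` into `G(M)ⁿ`. -/
def Gincl (M : R.Mod) (n : ℤ) (a : V) :
    R.dual.tens (R.dual.I (op a)) (M.obj.obj (vtx a)) ⟶ ((koszulG g R).obj M).X n :=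
  (R.familyG M).ι g n a

/-- The projection of `G(M)ⁿ` onto the summand `I_a ⊗ M(a)`. -/
def Gproj (M : R.Mod) (n : ℤ) (a : V) :
    ((koszulG g R).obj M).X n ⟶ R.dual.tens (R.dual.I (op a)) (M.obj.obj (vtx a)) :=
  (R.familyG M).π g n a

lemma Gincl_Gproj_self_assoc (M : R.Mod) {n : ℤ} {a : V} (h : g.deg a = n) {N : R.dual.Mod}
    (f : R.dual.tens (R.dual.I (op a)) (M.obj.obj (vtx a)) ⟶ N) :
    Gincl g M n a ≫ Gproj g M n a ≫ f = f :=
  (Category.assoc _ _ _).symm.trans ((congrArg (· ≫ f) ((R.familyG M).ι_π_self g h)).trans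
    (Category.id_comp f))

lemma Gincl_Gproj_of_ne_assoc (M : R.Mod) {n : ℤ} {a b : V} (h : a ≠ b) {N : R.dual.Mod}
    (f : R.dual.tens (R.dual.I (op b)) (M.obj.obj (vtx b)) ⟶ N) :
    Gincl g M n a ≫ Gproj g M n b ≫ f = 0 :=
  (Category.assoc _ _ _).symm.trans ((congrArg (· ≫ f) ((R.familyG M).ι_π_of_ne g h)).trans
    zero_comp)

/-- The element `f ⊗ m` of the summand `I_a ⊗ M(a)` of `G(M)ⁿ`. -/
def ggen (M : R.Mod) (n : ℤ) (a : V) (w : Vᵒᵖ) :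
    Module.Dual k (R.dual.Alg w (op a)) →ₗ[k] M.obj.obj (vtx a) →ₗ[k]
      (((koszulG g R).obj M).X n).obj.obj (vtx w) :=
  ((R.dual.tmk (R.dual.I (op a)) (M.obj.obj (vtx a)) w).compr₂
    (R.dual.mapAt (Gincl g M n a) w)) ∘ₗ R.dual.imk (op a) w

lemma G_induction {M : R.Mod} {n : ℤ} {w : Vᵒᵖ}
    {p : (((koszulG g R).obj M).X n).obj.obj (vtx w) → Prop}
    (c : (((koszulG g R).obj M).X n).obj.obj (vtx w))
    (gen : ∀ a, g.deg a = n → ∀ f m, p (ggen g M n a w f m)) (zero : p 0)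
    (add : ∀ a b, p a → p b → p (a + b)) : p c := by
  refine (R.familyG M).X_induction g (p := p) c (fun a ha t => ?_) zero add
  let φ : (R.dual.tens (R.dual.I (op a)) (M.obj.obj (vtx a))).obj.obj (vtx w) →ₗ[k]
      (((koszulG g R).obj M).X n).obj.obj (vtx w) := R.dual.mapAt ((R.familyG M).ι g n a) w
  suffices h : ∀ t, p (φ t) from h t
  intro t
  induction t using tens_induction with
  | tmul f m =>
    obtain ⟨f, rfl⟩ := R.dual.imk_surjective _ _ f
    exact gen a ha f m
  | zero => rw [map_zero]; exact zero
  | add a b ha hb => rw [map_add]; exact add _ _ ha hb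

lemma G_d_ggen (M : R.Mod) {n : ℤ} (n' : ℤ) {a : V} (ha : g.deg a = n) {w : Vᵒᵖ}
    (f : Module.Dual k (R.dual.Alg w (op a))) (m : M.obj.obj (vtx a)) :
    R.dual.mapAt (((koszulG g R).obj M).d n n') w (ggen g M n a w f m) =
      ∑ p : Σ b : V, a ⟶ b, ggen g M n' p.1 w (f ∘ₗ R.dual.lmul p.2.op.toPath)
        ((M.obj.map (pathHom p.2.toPath)).hom m) :=
  (R.familyG M).mapAt_d_ι g n' ha _

lemma G_map_ggen {M M' : R.Mod} (h : M ⟶ M') (n : ℤ) (a : V) {w : Vᵒᵖ}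
    (f : Module.Dual k (R.dual.Alg w (op a))) (m : M.obj.obj (vtx a)) :
    R.dual.mapAt (((koszulG g R).map h).f n) w (ggen g M n a w f m) =
      ggen g M' n a w f (R.mapAt h a m) := by
  have h := congrArg (fun f' => R.dual.mapAt f' w
    (R.dual.tmk (R.dual.I (op a)) (M.obj.obj (vtx a)) w (R.dual.imk (op a) w f) m))
    (GradedFamily.ι_mapX g (D := R.familyG M) (D' := R.familyG M')
      (fun a => R.dual.tensMap (𝟙 (R.dual.I (op a))) (h.hom.app (vtx a))) n a)
  exact h

lemma G_map_path_ggen (M : R.Mod) (n : ℤ) (a : V) {w w' : Vᵒᵖ} (q : Quiver.Path w w')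
    (f : Module.Dual k (R.dual.Alg w (op a))) (m : M.obj.obj (vtx a)) :
    ((((koszulG g R).obj M).X n).obj.map (pathHom q)).hom (ggen g M n a w f m) =
      ggen g M n a w' (f ∘ₗ R.dual.rmul q) m :=
  (mapAt_naturality ((R.familyG M).ι g n a) q
    (R.dual.tmk (R.dual.I (op a)) (M.obj.obj (vtx a)) w (R.dual.imk (op a) w f) m)).symm

/-- Exactness of `F` at a direct sum. -/
lemma F_exact_of_summands {N : R.dual.Mod} {S : Type*} {I : S → R.dual.Mod} (θ : ∀ s, I s ⟶ N)
    (ψ : ∀ s, N ⟶ I s) (hself : ∀ s, θ s ≫ ψ s = 𝟙 _) (hne : ∀ s t, s ≠ t → θ s ≫ ψ t = 0)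
    (span : ∀ w, ⨆ s, LinearMap.range (R.dual.mapAt (θ s) w) = ⊤) {y : V} {n n' n'' : ℤ}
    (exact : ∀ s c, R.mapAt (((koszulF g R).obj (I s)).d n' n'') y c = 0 →
      ∃ b, R.mapAt (((koszulF g R).obj (I s)).d n n') y b = c)
    (c : (((koszulF g R).obj N).X n').obj.obj (vtx y))
    (hc : R.mapAt (((koszulF g R).obj N).d n' n'') y c = 0) :
    ∃ b, R.mapAt (((koszulF g R).obj N).d n n') y b = c := by
  classical
  have hcomm : ∀ {N N' : R.dual.Mod} (f : N ⟶ N') (i j : ℤ) c,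
      R.mapAt (((koszulF g R).obj N').d i j) y (R.mapAt (((koszulF g R).map f).f i) y c) =
        R.mapAt (((koszulF g R).map f).f j) y (R.mapAt (((koszulF g R).obj N).d i j) y c) :=
    fun f i j c => by
      rw [← mapAt_comp_apply, ← mapAt_comp_apply, HomologicalComplex.Hom.comm]
  have hψθ : ∀ s t i c, R.mapAt (((koszulF g R).map (ψ t)).f i) y
      (R.mapAt (((koszulF g R).map (θ s)).f i) y c) =
      R.mapAt (((koszulF g R).map (θ s ≫ ψ t)).f i) y c := fun s t i c => by
    rw [Functor.map_comp]; rfl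
  -- `F(N)` is linear in `N` on generators, so the images of the summands still span it; each
  -- element is then a finite sum of components.
  have hspan : ∀ c, c ∈ ⨆ s, LinearMap.range (R.mapAt (((koszulF g R).map (θ s)).f n') y) := by
    intro c
    induction c using F_induction with
    | gen x hx q m =>
      have hm : m ∈ ⨆ s, LinearMap.range (R.dual.mapAt (θ s) x) := by rw [span]; trivial
      refine Submodule.iSup_induction _ (motive := fun m => fgen g N n' x y (R.cls q) m ∈ _) hm
        ?_ (by rw [map_zero]; exact Submodule.zero_mem _)
        fun a b ha hb => by rw [map_add]; exact Submodule.add_mem _ ha hb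
      rintro s _ ⟨m, rfl⟩
      exact Submodule.mem_iSup_of_mem s ⟨_, F_map_fgen g (θ s) n' x (R.cls q) m⟩
    | zero => exact Submodule.zero_mem _
    | add a b ha hb => exact Submodule.add_mem _ ha hb
  obtain ⟨f, hf, hfc⟩ := (Submodule.mem_iSup_iff_exists_finsupp _ _).1 (hspan c)
  choose c' hc' using hf
  -- Applying `F(ψ_t)` to `dc = 0` removes all summands but one, so every component of a cycle is a
  -- cycle.
  have hzero : ∀ t ∈ f.support, R.mapAt (((koszulF g R).obj (I t)).d n' n'') y (c' t) = 0 := by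
    intro t ht
    have h := congrArg (R.mapAt (((koszulF g R).map (ψ t)).f n'') y) hc
    rw [← hfc, Finsupp.sum, map_sum, map_sum, map_zero, Finset.sum_eq_single t ?_
      (fun h => absurd ht h)] at h
    · rw [← hc', hcomm, hψθ, hself, CategoryTheory.Functor.map_id] at h
      exact h
    · intro s _ hst
      rw [← hc', hcomm, hψθ, hne s t hst, Functor.map_zero]
      rfl
  have hb : ∀ t, ∃ b, t ∈ f.support →
      R.mapAt (((koszulF g R).obj (I t)).d n n') y b = c' t := fun t => by
    by_cases ht : t ∈ f.support
    · obtain ⟨b, hb⟩ := exact t _ (hzero t ht)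
      exact ⟨b, fun _ => hb⟩
    · exact ⟨0, fun h => absurd h ht⟩
  choose b hb using hb
  refine ⟨∑ t ∈ f.support, R.mapAt (((koszulF g R).map (θ t)).f n) y (b t), ?_⟩
  rw [map_sum, ← hfc, Finsupp.sum]
  refine Finset.sum_congr rfl fun t ht => ?_
  rw [hcomm, hb t ht, hc']

/-- If `Λ` is Koszul, then `F(G(M)ⁱ)` is exact at the vertices of degree different from `i`. -/
lemma IsKoszul.F_G_exact (hR : R.IsKoszul) (M : R.Mod) {i : ℤ} {y : V} (hy : g.deg y ≠ i)
    {n n' n'' : ℤ} (hn : n + 1 = n') (hn' : n' + 1 = n'')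
    (c : (((koszulF g R).obj (((koszulG g R).obj M).X i)).X n').obj.obj (vtx y))
    (hc : R.mapAt (((koszulF g R).obj (((koszulG g R).obj M).X i)).d n' n'') y c = 0) :
    ∃ b, R.mapAt (((koszulF g R).obj (((koszulG g R).obj M).X i)).d n n') y b = c := by
  let W : V → ModuleCat.{u} k := fun a => M.obj.obj (vtx a)
  -- A basis of `M(a)` turns `I_a ⊗ M(a)` into a direct sum of copies of `I_a`, possibly infinitely
  -- many. The inclusions tensor with a basis vector and the projections apply its coordinate form.
  let B := fun a : V => Module.Basis.ofVectorSpace k (W a)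
  let S := Σ a : {a : V // g.deg a = i}, Module.Basis.ofVectorSpaceIndex k (W a.1)
  refine F_exact_of_summands g (S := S) (I := fun s => R.dual.I (op s.1.1))
    (fun s => tensIncl (R.dual.I (op s.1.1)) (W s.1.1) (B s.1.1 s.2) ≫ Gincl g M i s.1.1)
    (fun s => Gproj g M i s.1.1 ≫
      tensProj (R.dual.I (op s.1.1)) (W s.1.1) ((B s.1.1).coord s.2))
    (fun s => ?_) (fun s t hst => ?_) (fun w => ?_)
    (fun s c hc => hR.F_I_exact g (op s.1.1) (fun h => hy ((congrArg g.deg h).symm.trans s.1.2)) hn hn' c hc) c hc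
  · rw [Category.assoc, Gincl_Gproj_self_assoc g M s.1.2]
    refine mapAt_ext fun w => LinearMap.ext fun f => ?_
    rw [mapAt_comp_apply, mapAt_tensIncl, mapAt_tensProj, Module.Basis.coord_apply,
      Module.Basis.repr_self, Finsupp.single_eq_same, one_smul]
    rfl
  · rw [Category.assoc]
    obtain ⟨a, s⟩ := s
    obtain ⟨b, t⟩ := t
    by_cases hab : a = b
    · subst hab
      have hst' : s ≠ t := fun h => hst (h ▸ rfl)
      rw [Gincl_Gproj_self_assoc g M a.2]
      refine mapAt_ext fun w => LinearMap.ext fun f => ?_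
      rw [mapAt_comp_apply, mapAt_tensIncl, mapAt_tensProj, Module.Basis.coord_apply,
        Module.Basis.repr_self, Finsupp.single_eq_of_ne hst'.symm, zero_smul]
      rfl
    · rw [Gincl_Gproj_of_ne_assoc g M fun h => hab (Subtype.ext h), comp_zero]
  · rw [Submodule.eq_top_iff']
    generalize hU : (⨆ s, _ : Submodule k ((((koszulG g R).obj M).X i).obj.obj (vtx w))) = U
    intro c
    induction c using G_induction with
    | gen a ha f m =>
      refine Submodule.span_induction (p := fun m _ => ggen g M i a w f m ∈ U) ?_
        (by rw [map_zero]; exact Submodule.zero_mem _)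
        (fun a b _ _ ha hb => by rw [map_add]; exact Submodule.add_mem _ ha hb)
        (fun c a _ ha => by rw [map_smul]; exact Submodule.smul_mem _ c ha) ((B a).mem_span m)
      rintro _ ⟨j, rfl⟩
      rw [← hU]
      exact Submodule.mem_iSup_of_mem (⟨⟨a, ha⟩, j⟩ : S) ⟨R.dual.imk (op a) w f, rfl⟩
    | zero => exact Submodule.zero_mem _
    | add a b ha hb => exact Submodule.add_mem _ ha hb

end PathIdeal

end Koszul

/-! ### Total complexes filtered by columns -/

section Total

variable {k : Type u} [Field k] {V : Type u} [Quiver.{u} V] {R : PathIdeal k V}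
  (K : HomologicalComplex₂ R.Mod (ComplexShape.up ℤ) (ComplexShape.up ℤ))

namespace PathIdeal

/-- The inclusion of `Kⁱʲ` into the term of degree `n = i + j` of the total complex. -/
abbrev tι {i j n : ℤ} (h : i + j = n) : (K.X i).X j ⟶ (K.total (ComplexShape.up ℤ)).X n :=
  K.ιTotal (ComplexShape.up ℤ) i j n h

lemma map_units_smul {A B : Type*} [AddCommGroup A] [AddCommGroup B] [Module k A] [Module k B]
    (f : A →ₗ[k] B) (s : ℤˣ) (a : A) : f (s • a) = s • f a := by
  rw [Units.smul_def, Units.smul_def, map_zsmul]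

lemma total_induction {n : ℤ} {y : V}
    {p : ((K.total (ComplexShape.up ℤ)).X n).obj.obj (vtx y) → Prop}
    (c : ((K.total (ComplexShape.up ℤ)).X n).obj.obj (vtx y))
    (ι : ∀ (i j : ℤ) (h : i + j = n) t, p (R.mapAt (tι K h) y t)) (zero : p 0)
    (add : ∀ a b, p a → p b → p (a + b)) : p c :=
  sigma_induction (T := fun x : (ComplexShape.π (ComplexShape.up ℤ) (ComplexShape.up ℤ)
      (ComplexShape.up ℤ)) ⁻¹' {n} => K.toGradedObject x.1) (p := p) c
    (fun x t => ι x.1.1 x.1.2 x.2 t) zero add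

lemma tι_d {i j n n' : ℤ} (h : i + j = n) (hn : n + 1 = n') :
    tι K h ≫ (K.total (ComplexShape.up ℤ)).d n n' =
      (K.d i (i + 1)).f j ≫ tι K (by omega : i + 1 + j = n') +
        i.negOnePow • ((K.X i).d j (j + 1) ≫ tι K (by omega : i + (j + 1) = n')) := by
  rw [HomologicalComplex₂.total_d, Preadditive.comp_add, HomologicalComplex₂.ι_D₁,
    HomologicalComplex₂.ι_D₂, K.d₁_eq _ (show (ComplexShape.up ℤ).Rel i (i + 1) from rfl) _ _
      (show i + 1 + j = n' by omega),
    K.d₂_eq _ _ (show (ComplexShape.up ℤ).Rel j (j + 1) from rfl) _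
      (show i + (j + 1) = n' by omega)]
  congr 1
  exact one_smul ℤˣ _

lemma mapAt_d_tι {i j n n' : ℤ} (h : i + j = n) (hn : n + 1 = n') {y : V}
    (c : ((K.X i).X j).obj.obj (vtx y)) :
    R.mapAt ((K.total (ComplexShape.up ℤ)).d n n') y (R.mapAt (tι K h) y c) =
      R.mapAt (tι K (by omega : i + 1 + j = n')) y (R.mapAt ((K.d i (i + 1)).f j) y c) +
        i.negOnePow • R.mapAt (tι K (by omega : i + (j + 1) = n')) y
          (R.mapAt ((K.X i).d j (j + 1)) y c) := by
  have := congrArg (fun f => R.mapAt f y c) (tι_d K h hn)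
  simp only [mapAt_add, mapAt_units_smul] at this
  exact this

/-- The projection of the total complex onto `Kⁱʲ`. -/
def tπ (i j n : ℤ) : (K.total (ComplexShape.up ℤ)).X n ⟶ (K.X i).X j :=
  K.totalDesc fun i' j' _ =>
    if h : i' = i ∧ j' = j then eqToHom (by rw [h.1, h.2]) else 0

lemma mapAt_tπ_tι_self {i j n : ℤ} (h : i + j = n) {y : V} (c : ((K.X i).X j).obj.obj (vtx y)) :
    R.mapAt (tπ K i j n) y (R.mapAt (tι K h) y c) = c := by
  rw [← mapAt_comp_apply, tπ, HomologicalComplex₂.ι_totalDesc, dif_pos ⟨rfl, rfl⟩, eqToHom_refl]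
  rfl

lemma mapAt_tπ_tι_of_ne {i i' j j' n : ℤ} (h : i' + j' = n) (hne : i' ≠ i) {y : V}
    (c : ((K.X i').X j').obj.obj (vtx y)) :
    R.mapAt (tπ K i j n) y (R.mapAt (tι K h) y c) = 0 := by
  rw [← mapAt_comp_apply, tπ, HomologicalComplex₂.ι_totalDesc, dif_neg fun h => hne h.1]
  rfl

/-- The sum of the summands `Kⁱʲ` with `i ≥ p` of the total complex, at the vertex `y`. -/
def tfil (p n : ℤ) (y : V) : Submodule k (((K.total (ComplexShape.up ℤ)).X n).obj.obj (vtx y)) :=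
  ⨆ (i : ℤ) (j : ℤ) (h : i + j = n) (_ : p ≤ i), LinearMap.range (R.mapAt (tι K h) y)

lemma tι_mem_tfil {p i j n : ℤ} (h : i + j = n) (hp : p ≤ i) {y : V}
    (c : ((K.X i).X j).obj.obj (vtx y)) : R.mapAt (tι K h) y c ∈ tfil K p n y :=
  Submodule.mem_iSup_of_mem i (Submodule.mem_iSup_of_mem j (Submodule.mem_iSup_of_mem h
    (Submodule.mem_iSup_of_mem hp ⟨c, rfl⟩)))

lemma tfil_le {p n : ℤ} {y : V}
    {U : Submodule k (((K.total (ComplexShape.up ℤ)).X n).obj.obj (vtx y))}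
    (hU : ∀ (i j : ℤ) (h : i + j = n), p ≤ i → ∀ c, R.mapAt (tι K h) y c ∈ U) :
    tfil K p n y ≤ U := by
  refine iSup_le fun i => iSup_le fun j => iSup_le fun h => iSup_le fun hp => ?_
  rintro _ ⟨c, rfl⟩
  exact hU i j h hp c

/-- The total complex is made of direct sums, so an element meets finitely many columns and has a
leftmost one. The elimination of columns from the left terminates for this reason. -/
lemma exists_mem_tfil {n : ℤ} {y : V} (c : ((K.total (ComplexShape.up ℤ)).X n).obj.obj (vtx y)) :
    ∃ p, c ∈ tfil K p n y := by
  induction c using total_induction with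
  | ι i j h t => exact ⟨i, tι_mem_tfil K h le_rfl t⟩
  | zero => exact ⟨0, Submodule.zero_mem _⟩
  | add a b ha hb =>
    obtain ⟨p, hp⟩ := ha
    obtain ⟨q, hq⟩ := hb
    have hmono : ∀ p p' : ℤ, p' ≤ p → tfil K p n y ≤ tfil K p' n y := fun p p' h =>
      tfil_le K fun i j hij hi c => tι_mem_tfil K hij (h.trans hi) c
    exact ⟨min p q, Submodule.add_mem _ (hmono _ _ (min_le_left _ _) hp)
      (hmono _ _ (min_le_right _ _) hq)⟩

lemma exists_eq_add_of_mem_tfil {p q n : ℤ} (h : p + q = n) {y : V}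
    {c : ((K.total (ComplexShape.up ℤ)).X n).obj.obj (vtx y)} (hc : c ∈ tfil K p n y) :
    ∃ a, ∃ c' ∈ tfil K (p + 1) n y, c = R.mapAt (tι K h) y a + c' := by
  have hle : tfil K p n y ≤ LinearMap.range (R.mapAt (tι K h) y) ⊔ tfil K (p + 1) n y :=
    tfil_le K fun i j hij hi t => by
      rcases hi.eq_or_lt with rfl | hi
      · obtain rfl : q = j := by omega
        exact Submodule.mem_sup_left ⟨t, rfl⟩
      · exact Submodule.mem_sup_right (tι_mem_tfil K hij hi t)
  obtain ⟨_, ⟨a, rfl⟩, c', hc', rfl⟩ := Submodule.mem_sup.1 (hle hc)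
  exact ⟨a, c', hc', rfl⟩

lemma d_mem_tfil {p n n' : ℤ} (hn : n + 1 = n') {y : V}
    {c : ((K.total (ComplexShape.up ℤ)).X n).obj.obj (vtx y)} (hc : c ∈ tfil K p n y) :
    R.mapAt ((K.total (ComplexShape.up ℤ)).d n n') y c ∈ tfil K p n' y := by
  suffices tfil K p n y ≤ (tfil K p n' y).comap
    (R.mapAt ((K.total (ComplexShape.up ℤ)).d n n') y) from this hc
  refine tfil_le K fun i j hij hi t => ?_
  rw [Submodule.mem_comap, mapAt_d_tι K hij hn]
  refine Submodule.add_mem _ (tι_mem_tfil K _ (by omega) _) ?_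
  rw [Units.smul_def]
  exact zsmul_mem (tι_mem_tfil K _ hi _) _

lemma tπ_of_mem_tfil {p q i n : ℤ} (hp : i < p) {y : V}
    {c : ((K.total (ComplexShape.up ℤ)).X n).obj.obj (vtx y)} (hc : c ∈ tfil K p n y) :
    R.mapAt (tπ K i q n) y c = 0 := by
  suffices tfil K p n y ≤ LinearMap.ker (R.mapAt (tπ K i q n) y) from this hc
  exact tfil_le K fun i' j hij hi t => mapAt_tπ_tι_of_ne K hij (by omega) t

/-- If all columns of index greater than `N` vanish and all columns of index less than `N` are
exact, then every cycle of the total complex is homologous to one in the column of index `N`. -/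
lemma exists_sub_d_mem_range {N n n₀ n₁ q : ℤ} (hn : n₀ + 1 = n) (hn₁ : n + 1 = n₁) (hq : N + q = n)
    {y : V} (hgt : ∀ i j, N < i → Subsingleton (((K.X i).X j).obj.obj (vtx y)))
    (hlt : ∀ i, i < N → ∀ j₀ j j₁, j₀ + 1 = j → j + 1 = j₁ → ∀ c,
      R.mapAt ((K.X i).d j j₁) y c = 0 → ∃ b, R.mapAt ((K.X i).d j₀ j) y b = c)
    (c : ((K.total (ComplexShape.up ℤ)).X n).obj.obj (vtx y))
    (hc : R.mapAt ((K.total (ComplexShape.up ℤ)).d n n₁) y c = 0) :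
    ∃ b a, c = R.mapAt ((K.total (ComplexShape.up ℤ)).d n₀ n) y b + R.mapAt (tι K hq) y a := by
  have htop : ∀ m, N < m → ∀ c ∈ tfil K m n y, c = 0 := fun m hm c hc => by
    have : tfil K m n y ≤ ⊥ := tfil_le K fun i j h hi t => by
      have := hgt i j (by omega)
      rw [Subsingleton.elim t 0, map_zero]
      exact Submodule.zero_mem _
    exact this hc
  -- Induction on the distance `m` from the leftmost allowed column to column `N`: each step removes
  -- the leftmost component by a boundary and pushes the rest one column to the right.
  have key : ∀ (m : ℕ) c, c ∈ tfil K (N - m) n y →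
      R.mapAt ((K.total (ComplexShape.up ℤ)).d n n₁) y c = 0 →
      ∃ b a, c = R.mapAt ((K.total (ComplexShape.up ℤ)).d n₀ n) y b + R.mapAt (tι K hq) y a := by
    intro m
    induction m with
    | zero =>
      intro c hcm _
      rw [Nat.cast_zero, sub_zero] at hcm
      obtain ⟨a, c', hc', rfl⟩ := exists_eq_add_of_mem_tfil K hq hcm
      refine ⟨0, a, ?_⟩
      rw [htop _ (by omega) c' hc', map_zero, add_zero, zero_add]
    | succ m ih =>
      intro c hcm hdc
      have hpq : N - (m + 1 : ℕ) + (q + m + 1) = n := by push_cast; omega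
      obtain ⟨a, c', hc', rfl⟩ := exists_eq_add_of_mem_tfil K hpq hcm
      have hp1 : N - (m : ℤ) = N - ((m + 1 : ℕ) : ℤ) + 1 := by push_cast; ring
      rw [hp1] at ih
      have hpN : N - ((m + 1 : ℕ) : ℤ) < N := by push_cast; omega
      generalize N - ((m + 1 : ℕ) : ℤ) = p at *
      generalize q + (m : ℤ) = r at *
      -- In column `p`, the total differential only sees the vertical differential of `a`, since
      -- everything else lives in columns of index at least `p + 1`. Thus `a` is a cycle of its
      -- column.
      have hda : R.mapAt ((K.X p).d (r + 1) (r + 1 + 1)) y a = 0 := by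
        have h := congrArg (R.mapAt (tπ K p (r + 1 + 1) n₁) y) hdc
        rw [map_add, map_add, mapAt_d_tι K hpq hn₁, map_add,
          mapAt_tπ_tι_of_ne K _ (by omega : p + 1 ≠ p), zero_add,
          tπ_of_mem_tfil K (by omega) (d_mem_tfil K hn₁ hc'), add_zero, map_zero,
          Units.smul_def, map_zsmul, ← Units.smul_def, mapAt_tπ_tι_self] at h
        exact (smul_eq_zero_iff_eq _).1 h
      obtain ⟨e, rfl⟩ := hlt p hpN r (r + 1) (r + 1 + 1) rfl rfl a hda
      have hpr : p + r = n₀ := by omega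
      have he := mapAt_d_tι K hpr hn e
      -- The sign cancels the factor `(-1)^p` of the vertical part, so `d e'` has leading component
      -- exactly `a`; its other component lies in column `p + 1`.
      let e' := p.negOnePow • R.mapAt (tι K hpr) y e
      have he' : R.mapAt ((K.total (ComplexShape.up ℤ)).d n₀ n) y e' =
          p.negOnePow • R.mapAt (tι K (by omega : p + 1 + r = n)) y
            (R.mapAt ((K.d p (p + 1)).f r) y e) +
          R.mapAt (tι K hpq) y (R.mapAt ((K.X p).d r (r + 1)) y e) := by
        rw [map_units_smul, he, smul_add, smul_smul, Int.units_mul_self, one_smul]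
      have hdd : R.mapAt ((K.total (ComplexShape.up ℤ)).d n n₁) y
          (R.mapAt ((K.total (ComplexShape.up ℤ)).d n₀ n) y e') = 0 := by
        rw [← mapAt_comp_apply, HomologicalComplex.d_comp_d]; rfl
      obtain ⟨b, a, hba⟩ := ih (c' - p.negOnePow • R.mapAt (tι K (by omega : p + 1 + r = n)) y
          (R.mapAt ((K.d p (p + 1)).f r) y e))
        (Submodule.sub_mem _ hc' (by
          rw [Units.smul_def]
          exact zsmul_mem (tι_mem_tfil K _ le_rfl _) _)) (by
        rw [he', map_add] at hdd
        rw [map_add] at hdc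
        rw [map_sub, sub_eq_zero, ← add_right_inj, hdc, add_comm, hdd])
      refine ⟨e' + b, a, ?_⟩
      rw [map_add, he', add_assoc, ← hba]
      abel
  obtain ⟨p, hp⟩ := exists_mem_tfil K c
  -- If the element starts to the right of column `N`, truncation gives `m = 0`; in all cases `N - m
  -- ≤ p`.
  refine key (N - p).toNat c ?_ hc
  refine tfil_le K (fun i j h hi t => tι_mem_tfil K h ?_ t) hp
  omega

end PathIdeal

end Total

/-! ### The augmentation and its naturality -/

section Augmentation

variable {k : Type u} [Field k] {V : Type u} [Quiver.{u} V] [LocallyFinite V]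
  {R : PathIdeal k V} (g : Grading V)

namespace PathIdeal

/-- The double complex `F(G(M)ⁱ)ʲ`. -/
abbrev koszulDouble (M : R.Mod) :
    HomologicalComplex₂ R.Mod (ComplexShape.up ℤ) (ComplexShape.up ℤ) :=
  ((koszulF g R).mapHomologicalComplex (ComplexShape.up ℤ)).obj ((koszulG g R).obj M)

/-- On a summand, `I^!_a(x) ≠ 0` needs a path from `a` to `x` in `Q`, which gives `i ≤ -j`; and
`P_x(y) ≠ 0` needs a path from `x` to `y`, which gives `-j ≤ deg y`. -/
lemma koszulDouble_subsingleton (M : R.Mod) {i j : ℤ} {y : V} (h : 0 < i + j ∨ g.deg y + j < 0) :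
    Subsingleton ((((koszulDouble g M).X i).X j).obj.obj (vtx y)) := by
  suffices h0 : ∀ c : (((koszulF g R).obj (((koszulG g R).obj M).X i)).X j).obj.obj (vtx y),
    c = 0 from ⟨fun a b => (h0 a).trans (h0 b).symm⟩
  intro c
  induction c using F_induction with
  | gen x hx q m =>
    have hx' : -g.deg x.unop = j := hx
    induction m using G_induction with
    | gen a ha f m =>
      rcases h with h | h
      · have hs : Subsingleton (R.dual.Alg x (op a)) :=
          alg_subsingleton (isEmpty_path_of_deg_lt g.op (by
            change -g.deg a < -g.deg x.unop; omega))
        have hf : f = 0 := LinearMap.ext fun u => by rw [Subsingleton.elim u 0, map_zero, map_zero]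
        rw [hf, map_zero, LinearMap.zero_apply, map_zero]
      · exact ((isEmpty_path_of_deg_lt g (by omega)).false q).elim
    | zero => rw [map_zero]
    | add a b ha hb => rw [map_add, ha, hb, add_zero]
  | zero => rfl
  | add a b ha hb => rw [ha, hb, add_zero]

/-- The linear map `G(M)ⁿ(x) → M(x)` with `f ⊗ m ↦ f(e_x) • m` for `f ⊗ m` in the summand
`I_x ⊗ M(x)`, which vanishes on the other summands. -/
def Gev (M : R.Mod) (n : ℤ) (x : Vᵒᵖ) :
    (((koszulG g R).obj M).X n).obj.obj (vtx x) →ₗ[k] M.obj.obj (vtx x.unop) :=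
  let B : Module.Dual k (R.dual.Alg x (op x.unop)) →ₗ[k] M.obj.obj (vtx x.unop) →ₗ[k]
      M.obj.obj (vtx x.unop) :=
    LinearMap.lsmul k _ ∘ₗ Module.Dual.eval k (R.dual.Alg x x) (R.dual.e x)
  tlift (M := R.dual.I (op x.unop)) (W := M.obj.obj (vtx x.unop)) (y := x) B ∘ₗ
    R.dual.mapAt (Gproj g M n x.unop) x

lemma Gev_ggen_self (M : R.Mod) {n : ℤ} {a : V} (h : g.deg a = n)
    (f : Module.Dual k (R.dual.Alg (op a) (op a))) (m : M.obj.obj (vtx a)) :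
    Gev g M n (op a) (ggen g M n a (op a) f m) = f (R.dual.e (op a)) • m := by
  let B : Module.Dual k (R.dual.Alg (op a) (op a)) →ₗ[k] M.obj.obj (vtx a) →ₗ[k]
      M.obj.obj (vtx a) :=
    LinearMap.lsmul k _ ∘ₗ Module.Dual.eval k (R.dual.Alg (op a) (op a)) (R.dual.e (op a))
  exact congrArg (tlift (M := R.dual.I (op a)) (W := M.obj.obj (vtx a)) (y := op a) B)
    ((R.familyG M).mapAt_π_ι_self g h
      (R.dual.tmk (R.dual.I (op a)) (M.obj.obj (vtx a)) (op a) (R.dual.imk (op a) (op a) f) m))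

lemma Gev_ggen_of_ne (M : R.Mod) {n : ℤ} {a : V} {x : Vᵒᵖ} (h : a ≠ x.unop)
    (f : Module.Dual k (R.dual.Alg x (op a))) (m : M.obj.obj (vtx a)) :
    Gev g M n x (ggen g M n a x f m) = 0 := by
  let B : Module.Dual k (R.dual.Alg x (op x.unop)) →ₗ[k] M.obj.obj (vtx x.unop) →ₗ[k]
      M.obj.obj (vtx x.unop) :=
    LinearMap.lsmul k _ ∘ₗ Module.Dual.eval k (R.dual.Alg x x) (R.dual.e x)
  exact (congrArg (tlift (M := R.dual.I (op x.unop)) (W := M.obj.obj (vtx x.unop)) (y := x) B)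
    ((R.familyG M).mapAt_π_ι_of_ne g (n := n) h
      (R.dual.tmk (R.dual.I (op a)) (M.obj.obj (vtx a)) x (R.dual.imk (op a) x f) m))).trans
    (map_zero _)

lemma Gev_naturality {M M' : R.Mod} (h : M ⟶ M') (n : ℤ) (x : Vᵒᵖ)
    (c : (((koszulG g R).obj M).X n).obj.obj (vtx x)) :
    Gev g M' n x (R.dual.mapAt (((koszulG g R).map h).f n) x c) =
      R.mapAt h x.unop (Gev g M n x c) := by
  induction c using G_induction with
  | gen a ha f m =>
    rw [G_map_ggen]
    by_cases hax : a = x.unop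
    · obtain ⟨x⟩ := x
      obtain rfl : a = x := hax
      exact (Gev_ggen_self g M' ha f _).trans (((map_smul (R.mapAt h a) _ m).symm).trans
        (congrArg (R.mapAt h a) (Gev_ggen_self g M ha f m).symm))
    · rw [Gev_ggen_of_ne g M' hax, Gev_ggen_of_ne g M hax, map_zero]
  | zero => simp only [map_zero]
  | add a b ha hb => simp only [map_add, ha, hb]

/-- The compatibility of the evaluations with the differential of `G(M)` and the action of the
arrows. -/
lemma Gev_d (M : R.Mod) {n : ℤ} {x : Vᵒᵖ} (hx : g.deg x.unop = n + 1)
    (c : (((koszulG g R).obj M).X n).obj.obj (vtx x)) :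
    Gev g M (n + 1) x (R.dual.mapAt (((koszulG g R).obj M).d n (n + 1)) x c) =
      ∑ p : Σ z : Vᵒᵖ, x ⟶ z, (M.obj.map (pathHom p.2.unop.toPath)).hom
        (Gev g M n p.1 (((((koszulG g R).obj M).X n).obj.map (pathHom p.2.toPath)).hom c)) := by
  induction c using G_induction with
  | gen a ha f m =>
    obtain ⟨x⟩ := x
    have hx' : g.deg x = n + 1 := hx
    rw [G_d_ggen g M (n + 1) ha, map_sum]
    -- Both sides reduce to the sum of `f(α^!) M(α)m` over the arrows `α : a ⟶ x`. On the left,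
    -- `α^!` arises as left multiplication applied to `e_x`; on the right, as right multiplication
    -- applied to `e_a`.
    let E : (a ⟶ x) → M.obj.obj (vtx x) := fun α =>
      f (R.dual.cls α.op.toPath) • (M.obj.map (pathHom α.toPath)).hom m
    trans ∑ α, E α
    · symm
      refine Fintype.sum_of_injective (fun α : a ⟶ x => (⟨x, α⟩ : Σ b : V, a ⟶ b))
        (fun α β h => by cases h; rfl) _ _ (fun p hp => ?_) fun α => ?_
      · refine Gev_ggen_of_ne g M (x := op x) (fun h => hp ?_) _ _
        obtain ⟨b, α⟩ := p
        obtain rfl : b = x := h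
        exact ⟨α, rfl⟩
      · refine Eq.trans ?_ (Gev_ggen_self g M hx' _ _).symm
        exact congrArg (fun u => f u • (M.obj.map (pathHom α.toPath)).hom m)
          (lmul_e (R := R.dual) α.op.toPath).symm
    · refine Fintype.sum_of_injective
        (fun α : a ⟶ x => (⟨op a, α.op⟩ : Σ z : Vᵒᵖ, op x ⟶ z))
        (fun α β h => by cases h; rfl) _ _ (fun p hp => ?_) fun α => ?_
      · rw [G_map_path_ggen, Gev_ggen_of_ne, map_zero]
        intro h
        obtain ⟨⟨b⟩, α⟩ := p
        obtain rfl : a = b := h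
        exact hp ⟨α.unop, rfl⟩
      · rw [G_map_path_ggen]
        refine Eq.trans ?_ (congrArg (M.obj.map (pathHom α.toPath)).hom
          (Gev_ggen_self g M ha _ _).symm)
        rw [map_smul]
        exact congrArg (fun u => f u • (M.obj.map (pathHom α.toPath)).hom m)
          (rmul_e (R := R.dual) α.op.toPath).symm
  | zero => simp only [map_zero, Finset.sum_const_zero]
  | add a b ha hb => simp only [map_add, ha, hb, Finset.sum_add_distrib]

/-- The morphism `F(G(M)ⁱ)ʲ ⟶ M` with `u ⊗ c ↦ u c(e_x)` for `u ∈ P_x`. -/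
def colAug (M : R.Mod) (i j : ℤ) : ((koszulF g R).obj (((koszulG g R).obj M).X i)).X j ⟶ M :=
  Sigma.desc (f := fun x : {x : Vᵒᵖ // g.op.deg x = j} =>
    (R.familyF (((koszulG g R).obj M).X i)).T x) fun x => tensLift (Gev g M i x.1)

lemma mapAt_colAug (M : R.Mod) (i : ℤ) {j : ℤ} {x : Vᵒᵖ} (hx : g.op.deg x = j) {y : V}
    (u : R.Alg x.unop y) (c : (((koszulG g R).obj M).X i).obj.obj (vtx x)) :
    R.mapAt (colAug g M i j) y (fgen g (((koszulG g R).obj M).X i) j x y u c) =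
      act M x.unop y u (Gev g M i x c) := by
  have h : (R.familyF (((koszulG g R).obj M).X i)).ι g.op j x ≫ colAug g M i j =
      tensLift (Gev g M i x) := by
    have h := (R.familyF (((koszulG g R).obj M).X i)).ι_of_eq g.op ⟨x, hx⟩
    dsimp only at h
    rw [h]
    exact Sigma.ι_desc _ _
  have h' := congrArg (fun φ => R.mapAt φ y
    (R.tmk (R.P x.unop) ((((koszulG g R).obj M).X i).obj.obj (vtx x)) y (R.pmk x.unop y u) c)) h
  exact h'

/-- The morphism `colAug` on the terms of the double complex. -/
def doubleAug (M : R.Mod) (i j : ℤ) : ((koszulDouble g M).X i).X j ⟶ M := colAug g M i j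

/-- The sign `(-1)^(i(i+1)/2)`. -/
def augSign (i : ℤ) : ℤˣ := (i * (i + 1) / 2).negOnePow

/-- This recursion is what makes the horizontal part of the total differential cancel its vertical
part, with sign `(-1)^i`, after augmentation. -/
lemma augSign_succ (i : ℤ) : augSign (i + 1) = -(i.negOnePow * augSign i) := by
  have h : (i + 1) * (i + 1 + 1) / 2 = i * (i + 1) / 2 + (i + 1) := by
    rw [← Int.add_mul_ediv_right _ _ two_ne_zero]; congr 1; ring
  rw [augSign, h, Int.negOnePow_add, Int.negOnePow_succ, mul_neg, mul_comm]
  rfl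

/-- The augmentation `F^C(G(M))⁰ ⟶ M`. -/
def aug (M : R.Mod) : ((koszulDouble g M).total (ComplexShape.up ℤ)).X 0 ⟶ M :=
  (koszulDouble g M).totalDesc fun i j _ => augSign i • doubleAug g M i j

lemma tι_aug (M : R.Mod) {i j : ℤ} (h : i + j = 0) :
    tι (koszulDouble g M) h ≫ aug g M = augSign i • doubleAug g M i j :=
  HomologicalComplex₂.ι_totalDesc _ _ _ _ _

lemma mapAt_aug (M : R.Mod) {i j : ℤ} (h : i + j = 0) {y : V}
    (c : (((koszulDouble g M).X i).X j).obj.obj (vtx y)) :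
    R.mapAt (aug g M) y (R.mapAt (tι (koszulDouble g M) h) y c) =
      augSign i • R.mapAt (doubleAug g M i j) y c := by
  have := congrArg (fun f => R.mapAt f y c) (tι_aug g M h)
  simp only [mapAt_units_smul] at this
  exact this

/-- On `u ⊗ c`, going horizontally gives `u` applied to the evaluation of `dc`; going vertically
gives the sum of the `uα` applied to the evaluations of `αᵒc`. `Gev_d` equates the two. -/
lemma doubleAug_d (M : R.Mod) {i j : ℤ} (h : i + 1 + j = 0) {y : V}
    (c : (((koszulDouble g M).X i).X j).obj.obj (vtx y)) :
    R.mapAt (doubleAug g M (i + 1) j) y (R.mapAt (((koszulDouble g M).d i (i + 1)).f j) y c) =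
      R.mapAt (doubleAug g M i (j + 1)) y (R.mapAt (((koszulDouble g M).X i).d j (j + 1)) y c) := by
  suffices h0 : ∀ c : (((koszulF g R).obj (((koszulG g R).obj M).X i)).X j).obj.obj (vtx y),
      R.mapAt (colAug g M (i + 1) j) y
          (R.mapAt (((koszulF g R).map (((koszulG g R).obj M).d i (i + 1))).f j) y c) =
        R.mapAt (colAug g M i (j + 1)) y
          (R.mapAt (((koszulF g R).obj (((koszulG g R).obj M).X i)).d j (j + 1)) y c) from h0 c
  intro c
  induction c using F_induction with
  | gen x hx q m =>
    have hx' : g.deg x.unop = i + 1 := by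
      have : -g.deg x.unop = j := hx
      omega
    rw [F_map_fgen, F_d_fgen g _ (j + 1) hx, map_sum]
    refine (mapAt_colAug g M (i + 1) hx _ _).trans ?_
    rw [Gev_d g M hx', map_sum]
    refine Finset.sum_congr rfl fun p _ => ?_
    refine Eq.trans ?_ (mapAt_colAug g M i (by rw [g.op.deg_arrow p.2, hx]) _ _).symm
    rw [act_rmul]
  | zero => simp only [map_zero]
  | add a b ha hb => simp only [map_add, ha, hb]

lemma d_aug (M : R.Mod) {n : ℤ} (hn : n + 1 = 0) :
    ((koszulDouble g M).total (ComplexShape.up ℤ)).d n 0 ≫ aug g M = 0 := by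
  refine mapAt_ext fun y => LinearMap.ext fun c => ?_
  rw [mapAt_comp_apply, mapAt_zero, LinearMap.zero_apply]
  induction c using total_induction with
  | ι i j h t =>
    rw [mapAt_d_tι _ h hn, map_add, map_units_smul, mapAt_aug, mapAt_aug,
      doubleAug_d g M (by omega), augSign_succ, Units.neg_smul, mul_smul, neg_add_cancel]
  | zero => simp only [map_zero]
  | add a b ha hb => simp only [map_add, ha, hb, add_zero]

lemma colAug_naturality {M M' : R.Mod} (h : M ⟶ M') (i j : ℤ) :
    (((koszulF g R).map (((koszulG g R).map h).f i)).f j ≫ colAug g M' i j :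
      ((koszulF g R).obj (((koszulG g R).obj M).X i)).X j ⟶ M') = colAug g M i j ≫ h := by
  refine mapAt_ext fun y => LinearMap.ext fun c => ?_
  rw [mapAt_comp_apply, mapAt_comp_apply]
  induction c using F_induction with
  | gen x hx q m =>
    rw [F_map_fgen]
    refine (mapAt_colAug g M' i hx _ _).trans ?_
    rw [Gev_naturality]
    refine Eq.trans ?_ (congrArg (R.mapAt h y) (mapAt_colAug g M i hx _ _).symm)
    rw [mapAt_act]
  | zero => simp only [map_zero]
  | add a b ha hb => simp only [map_add, ha, hb]

/-- The morphism of total complexes induced by a morphism of modules. -/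
abbrev koszulTotalMap {M M' : R.Mod} (h : M ⟶ M') :
    (koszulDouble g M).total (ComplexShape.up ℤ) ⟶ (koszulDouble g M').total (ComplexShape.up ℤ) :=
  HomologicalComplex₂.total.map
    (((koszulF g R).mapHomologicalComplex (ComplexShape.up ℤ)).map ((koszulG g R).map h))
    (ComplexShape.up ℤ)

lemma aug_naturality {M M' : R.Mod} (h : M ⟶ M') :
    (koszulTotalMap g h).f 0 ≫ aug g M' = aug g M ≫ h := by
  refine HomologicalComplex₂.total.hom_ext _ fun i j hij => ?_
  have h1 := HomologicalComplex₂.ιTotal_map (K := koszulDouble g M) (L := koszulDouble g M')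
    (φ := ((koszulF g R).mapHomologicalComplex (ComplexShape.up ℤ)).map ((koszulG g R).map h))
    (c₁₂ := ComplexShape.up ℤ) (i₁ := i) (i₂ := j) (i₁₂ := 0) (h := hij)
  have h2 := colAug_naturality g h i j
  rw [reassoc_of% h1]
  refine (congrArg (_ ≫ ·) (tι_aug g M' hij)).trans ?_
  refine Eq.trans ?_ ((congrArg (· ≫ h) (tι_aug g M hij)).symm.trans (Category.assoc _ _ _))
  rw [Linear.units_smul_comp, Linear.comp_units_smul]
  exact congrArg (augSign i • ·) h2

/-- The augmentation as a morphism of complexes. -/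
def totalAug (M : R.Mod) : (koszulDouble g M).total (ComplexShape.up ℤ) ⟶
    (HomologicalComplex.single R.Mod (ComplexShape.up ℤ) 0).obj M :=
  HomologicalComplex.mkHomToSingle (aug g M) fun _ hi => d_aug g M hi

lemma totalAug_f (M : R.Mod) : (totalAug g M).f 0 =
    aug g M ≫ (HomologicalComplex.singleObjXSelf (ComplexShape.up ℤ) 0 M).inv :=
  HomologicalComplex.mkHomToSingle_f _ _

lemma totalAug_naturality {M M' : R.Mod} (h : M ⟶ M') :
    koszulTotalMap g h ≫ totalAug g M' =
      totalAug g M ≫ (HomologicalComplex.single R.Mod (ComplexShape.up ℤ) 0).map h := by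
  refine HomologicalComplex.to_single_hom_ext ?_
  rw [HomologicalComplex.comp_f, HomologicalComplex.comp_f, totalAug_f, totalAug_f,
    HomologicalComplex.single_map_f_self, Category.assoc, Iso.inv_hom_id_assoc, ← Category.assoc,
    ← Category.assoc, aug_naturality]

/-- The natural transformation from `F^C ∘ G` to the inclusion of modules in degree zero. -/
def koszulAug (R : PathIdeal k V) :
    koszulG g R ⋙ koszulFC g R ⟶ HomologicalComplex.single R.Mod (ComplexShape.up ℤ) 0 where
  app M := totalAug g M
  naturality _ _ h := totalAug_naturality g h

end PathIdeal

end Augmentation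

/-! ### The augmentation is a projective resolution -/

/-- A coproduct of projective objects is projective. -/
lemma projective_sigma {C : Type*} [Category* C] {J : Type*} {T : J → C} [HasCoproduct T]
    (h : ∀ j, Projective (T j)) : Projective (∐ T) where
  factors f π _ := ⟨Sigma.desc fun j => Projective.factorThru (Sigma.ι T j ≫ f) π,
    Sigma.hom_ext _ _ fun j => by simp⟩

section Resolution

variable {k : Type u} [Field k] {V : Type u} [Quiver.{u} V] [LocallyFinite V]
  {R : PathIdeal k V} (g : Grading V)

namespace PathIdeal

/-- Vertices `a ≠ y` of the same degree contribute nothing at `y`, and `I^!_y(y)` is the line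
spanned by the form `δ` dual to `e_y`. Evaluation at `e_y` is therefore a complete coordinate. -/
lemma exists_ggen_Gev (M : R.Mod) (y : V) :
    ∃ δ : Module.Dual k (R.dual.Alg (op y) (op y)), δ (R.dual.e (op y)) = 1 ∧
      ∀ c : (((koszulG g R).obj M).X (g.deg y)).obj.obj (vtx (op y)),
        c = ggen g M (g.deg y) y (op y) δ (Gev g M (g.deg y) (op y) c) := by
  have h0 : (Quiver.Path.nil : Quiver.Path (op y) (op y)).length < 2 := Nat.zero_lt_two
  have hδ : (isHomogeneous_dual (R := R)).coeff .nil h0 (R.dual.e (op y)) = 1 := by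
    rw [e, IsHomogeneous.coeff_mk, Finsupp.single_eq_same]
  refine ⟨isHomogeneous_dual.coeff .nil h0, hδ, fun c => ?_⟩
  induction c using G_induction with
  | gen a ha f m =>
    by_cases hay : a = y
    · subst hay
      rw [Gev_ggen_self g M rfl, map_smul, ← LinearMap.smul_apply, ← map_smul]
      congr 2
      refine LinearMap.ext fun u => ?_
      obtain ⟨c, rfl⟩ := alg_eq_smul_e g.op u
      rw [LinearMap.smul_apply, map_smul, map_smul, hδ, smul_eq_mul, smul_eq_mul, smul_eq_mul,
        mul_one, mul_comm]
    · have hs : Subsingleton (R.dual.Alg (op y) (op a)) :=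
        alg_subsingleton (isEmpty_path_of_deg_eq g.op (by
          change -g.deg a = -g.deg y; omega) fun h => hay (op_injective h).symm)
      have hf : f = 0 := LinearMap.ext fun u => by rw [Subsingleton.elim u 0, map_zero, map_zero]
      rw [hf, map_zero, LinearMap.zero_apply, map_zero, map_zero]
  | zero => rw [map_zero, map_zero]
  | add a b ha hb => rw [map_add, map_add, ← ha, ← hb]

/-- At a vertex `y`, the augmentation identifies `M` with the column of index `deg y`. -/
lemma doubleAug_bijective (M : R.Mod) {y : V} {j : ℤ} (h : g.deg y + j = 0) :
    Function.Bijective (R.mapAt (doubleAug g M (g.deg y) j) y) := by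
  have hy : g.op.deg (op y) = j := by change -g.deg y = j; omega
  obtain ⟨δ, hδ, hc⟩ := exists_ggen_Gev g M y
  have hfgen : ∀ n : (((koszulG g R).obj M).X (g.deg y)).obj.obj (vtx (op y)),
      R.mapAt (colAug g M (g.deg y) j) y
        (fgen g (((koszulG g R).obj M).X (g.deg y)) j (op y) y (R.e y) n) =
        Gev g M (g.deg y) (op y) n := fun n =>
    (mapAt_colAug g M (g.deg y) hy (R.e y) n).trans (act_e M y _)
  constructor
  · refine (injective_iff_map_eq_zero _).2 fun c hc0 => ?_
    obtain ⟨n, hn⟩ := F_exists_fgen_e g hy c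
    have h0 : Gev g M (g.deg y) (op y) n = 0 :=
      (hfgen n).symm.trans ((congrArg (R.mapAt (colAug g M (g.deg y) j) y) hn).symm.trans hc0)
    have hn0 : n = 0 := by rw [hc n, h0, map_zero]
    rw [hn0] at hn
    exact hn.trans (map_zero _)
  · intro m
    refine ⟨fgen g (((koszulG g R).obj M).X (g.deg y)) j (op y) y (R.e y)
      (ggen g M (g.deg y) y (op y) δ m), (hfgen _).trans ?_⟩
    rw [Gev_ggen_self g M rfl, hδ, one_smul]

/-- Every cycle is homologous to one in the column of index `deg y`. -/
lemma IsKoszul.exists_eq_d_add (hR : R.IsKoszul) (M : R.Mod) {n n₀ n₁ q : ℤ} (hn : n₀ + 1 = n)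
    (hn₁ : n + 1 = n₁) {y : V} (hq : g.deg y + q = n)
    (c : (((koszulDouble g M).total (ComplexShape.up ℤ)).X n).obj.obj (vtx y))
    (hc : R.mapAt (((koszulDouble g M).total (ComplexShape.up ℤ)).d n n₁) y c = 0) :
    ∃ b a, c = R.mapAt (((koszulDouble g M).total (ComplexShape.up ℤ)).d n₀ n) y b +
      R.mapAt (tι (koszulDouble g M) hq) y a :=
  exists_sub_d_mem_range (koszulDouble g M) hn hn₁ hq
    (fun i j hi => koszulDouble_subsingleton g M (by omega))
    (fun i hi j₀ j j₁ hj hj₁ c hc => hR.F_G_exact g M (by omega) hj hj₁ c hc) c hc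

lemma koszulTotal_isZero (M : R.Mod) {n : ℤ} (hn : 0 < n) :
    IsZero (((koszulDouble g M).total (ComplexShape.up ℤ)).X n) := by
  refine isZero_of_subsingleton fun y => ?_
  suffices h0 : ∀ c : (((koszulDouble g M).total (ComplexShape.up ℤ)).X n).obj.obj (vtx y),
    c = 0 from ⟨fun a b => (h0 a).trans (h0 b).symm⟩
  intro c
  induction c using total_induction with
  | ι i j h t =>
    have := koszulDouble_subsingleton g M (i := i) (j := j) (y := y) (.inl (by omega))
    rw [Subsingleton.elim t 0, map_zero]
  | zero => rfl
  | add a b ha hb => rw [ha, hb, add_zero]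

lemma projective_koszulF (N : R.dual.Mod) (n : ℤ) : Projective (((koszulF g R).obj N).X n) :=
  projective_sigma (T := fun x : {x : Vᵒᵖ // g.op.deg x = n} => (R.familyF N).T x) fun x =>
    projective_tens_P x.1.unop (N.obj.obj (vtx x.1))

lemma koszulTotal_projective (M : R.Mod) (n : ℤ) :
    Projective (((koszulDouble g M).total (ComplexShape.up ℤ)).X n) := by
  exact projective_sigma (T := fun x : (ComplexShape.π (ComplexShape.up ℤ) (ComplexShape.up ℤ)
    (ComplexShape.up ℤ)) ⁻¹' {n} => (koszulDouble g M).toGradedObject x.1)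
    fun x => projective_koszulF g (((koszulG g R).obj M).X x.1.1) x.1.2

/-- The column of index `deg y` alone already reaches all of `M(y)`; the sign is an involution and
is put into the chosen preimage. -/
lemma aug_surjective (M : R.Mod) (y : V) : Function.Surjective (R.mapAt (aug g M) y) := fun m => by
  have h : g.deg y + -g.deg y = 0 := add_neg_cancel _
  obtain ⟨a, ha⟩ := (doubleAug_bijective g M h).2 (augSign (g.deg y) • m)
  refine ⟨R.mapAt (tι (koszulDouble g M) h) y a, ?_⟩
  rw [mapAt_aug, ha, smul_smul, Int.units_mul_self, one_smul]

/-- Every element of degree zero is a cycle, as the next term vanishes. It is homologous to an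
element of the column of index `deg y`, where the augmentation is injective. -/
lemma IsKoszul.exact_aug (hR : R.IsKoszul) (M : R.Mod) (y : V)
    (c : (((koszulDouble g M).total (ComplexShape.up ℤ)).X 0).obj.obj (vtx y))
    (hc : R.mapAt (aug g M) y c = 0) :
    ∃ b, R.mapAt (((koszulDouble g M).total (ComplexShape.up ℤ)).d (-1) 0) y b = c := by
  have h : g.deg y + -g.deg y = 0 := add_neg_cancel _
  have hd : ((koszulDouble g M).total (ComplexShape.up ℤ)).d 0 1 = 0 :=
    (koszulTotal_isZero g M one_pos).eq_of_tgt _ _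
  have hdc : R.mapAt (((koszulDouble g M).total (ComplexShape.up ℤ)).d 0 1) y c = 0 := by
    rw [hd, mapAt_zero, LinearMap.zero_apply]
  obtain ⟨b, a, rfl⟩ := hR.exists_eq_d_add g M (neg_add_cancel 1) (zero_add 1) h c hdc
  have h1 : R.mapAt (aug g M) y
      (R.mapAt (((koszulDouble g M).total (ComplexShape.up ℤ)).d (-1) 0) y b) = 0 := by
    rw [← mapAt_comp_apply, d_aug g M (neg_add_cancel 1), mapAt_zero, LinearMap.zero_apply]
  rw [map_add, h1, zero_add, mapAt_aug, smul_eq_zero_iff_eq] at hc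
  have ha : a = 0 := (doubleAug_bijective g M h).1 (hc.trans (map_zero _).symm)
  exact ⟨b, by rw [ha, map_zero, add_zero]⟩

/-- At `y`, the column of index `deg y` lives only in total degree zero, so in any other degree the
remainder left after elimination is zero. -/
lemma IsKoszul.exact_total (hR : R.IsKoszul) (M : R.Mod) {n n₀ n₁ : ℤ} (hn : n₀ + 1 = n)
    (hn₁ : n + 1 = n₁) (h0 : n ≠ 0) (y : V)
    (c : (((koszulDouble g M).total (ComplexShape.up ℤ)).X n).obj.obj (vtx y))
    (hc : R.mapAt (((koszulDouble g M).total (ComplexShape.up ℤ)).d n n₁) y c = 0) :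
    ∃ b, R.mapAt (((koszulDouble g M).total (ComplexShape.up ℤ)).d n₀ n) y b = c := by
  have h : g.deg y + (n - g.deg y) = n := by omega
  obtain ⟨b, a, rfl⟩ := hR.exists_eq_d_add g M hn hn₁ h c hc
  have hs := koszulDouble_subsingleton g M (i := g.deg y) (j := n - g.deg y) (y := y) (by omega)
  exact ⟨b, by rw [Subsingleton.elim a 0, map_zero, add_zero]⟩

lemma IsKoszul.quasiIso_totalAug (hR : R.IsKoszul) (M : R.Mod) : QuasiIso (totalAug g M) where
  quasiIsoAt n := by
    by_cases hn : n = 0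
    · subst hn
      -- Because the next term and the neighbouring terms of the target vanish, a quasi-isomorphism
      -- in degree zero amounts to `M` being the cokernel of the incoming differential: exactness at
      -- degree zero and surjectivity of the augmentation.
      rw [quasiIsoAt_iff' _ (-1) 0 1 (by simp) (by simp),
        ShortComplex.quasiIso_iff_of_zeros' _
          ((koszulTotal_isZero g M one_pos).eq_of_tgt _ _) rfl rfl]
      have hf : ∀ y, R.mapAt ((totalAug g M).f 0) y =
          R.mapAt (HomologicalComplex.singleObjXSelf (ComplexShape.up ℤ) 0 M).inv y ∘ₗ
            R.mapAt (aug g M) y := fun y => by rw [totalAug_f]; rfl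
      have hinv : ∀ y m, R.mapAt (HomologicalComplex.singleObjXSelf (ComplexShape.up ℤ) 0 M).hom y
          (R.mapAt (HomologicalComplex.singleObjXSelf (ComplexShape.up ℤ) 0 M).inv y m) = m :=
        fun y m => by rw [← mapAt_comp_apply, Iso.inv_hom_id]; rfl
      have hhom : ∀ y m, R.mapAt (HomologicalComplex.singleObjXSelf (ComplexShape.up ℤ) 0 M).inv y
          (R.mapAt (HomologicalComplex.singleObjXSelf (ComplexShape.up ℤ) 0 M).hom y m) = m :=
        fun y m => by rw [← mapAt_comp_apply, Iso.hom_inv_id]; rfl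
      constructor
      · refine exact_of_mapAt _ fun y c hc => hR.exact_aug g M y c ?_
        have h1 := (LinearMap.congr_fun (hf y) c).symm.trans hc
        exact (hinv y _).symm.trans ((congrArg _ h1).trans (map_zero _))
      · refine epi_of_mapAt_surjective ((totalAug g M).f 0) fun y m => ?_
        obtain ⟨c, hc⟩ := aug_surjective g M y
          (R.mapAt (HomologicalComplex.singleObjXSelf (ComplexShape.up ℤ) 0 M).hom y m)
        refine ⟨c, (LinearMap.congr_fun (hf y) c).trans ?_⟩
        rw [LinearMap.comp_apply, hc, hhom]
    · rw [quasiIsoAt_iff_exactAt' _ _ (HomologicalComplex.exactAt_single_obj _ _ _ _ hn),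
        HomologicalComplex.exactAt_iff' _ (n - 1) n (n + 1) (by simp) (by simp)]
      exact exact_of_mapAt _ fun y c hc =>
        hR.exact_total g M (sub_add_cancel n 1) rfl hn y c hc

end PathIdeal

end Resolution

end BoundQuiver

end

theorem proposition4p6 {k : Type u} [Field k] {V : Type u} [Quiver.{u} V]
    [BoundQuiver.LocallyFinite V] (g : BoundQuiver.Grading V) (R : BoundQuiver.PathIdeal k V)
    (hR : R.IsKoszul) :
    (∃ η : BoundQuiver.koszulG g R ⋙ BoundQuiver.koszulFC g R ⟶
        HomologicalComplex.single R.Mod (ComplexShape.up ℤ) 0,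
      ∀ M : R.Mod, QuasiIso (η.app M)) ∧
    ∀ M : R.Mod,
      (∀ n : ℤ, Projective (((BoundQuiver.koszulG g R ⋙ BoundQuiver.koszulFC g R).obj M).X n)) ∧
      ∀ n : ℤ, 0 < n →
        IsZero (((BoundQuiver.koszulG g R ⋙ BoundQuiver.koszulFC g R).obj M).X n) :=
  ⟨⟨BoundQuiver.PathIdeal.koszulAug g R, fun M => hR.quasiIso_totalAug g M⟩, fun M =>
    ⟨fun n => BoundQuiver.PathIdeal.koszulTotal_projective g M n,
      fun _ hn => BoundQuiver.PathIdeal.koszulTotal_isZero g M hn⟩⟩
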